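/- **Setting.** Let $k,d,r\ge 1$. For $i=1,\dots,k$ let $\mathbf X_{i1},\mathbf X_{i2},\dots$ be $\mathbb R^d$-valued random vectors, identically distributed within each group $i$ and all mutually independent. Group $i$ contributes its first $n_i$ observations, $n=\sum_i n_i\to\infty$ and $n_i/n\to\kappa_i\in(0,1)$ for all $i$. Let $\boldsymbol\mu_i$ and $\boldsymbol\Sigma_i$ be the mean vector and covariance matrix of $\mathbf X_{i1}$. For $v\in\{\mathrm{RR},\mathrm{VV},\mathrm{VN},\mathrm{AZ}\}$ the multivariate coefficient of variation $C_i^v=C^v(\boldsymbol\mu_i,\boldsymbol\Sigma_i)$ is given by $$C^{\mathrm{RR}}=\sqrt{\frac{(\det\boldsymbol\Sigma)^{1/d}}{\boldsymbol\mu^\top\boldsymbol\mu}},\quad C^{\mathrm{VV}}=\sqrt{\frac{\operatorname{tr}\boldsymbol\Sigma}{\boldsymbol\mu^\top\boldsymbol\mu}},\quad C^{\mathrm{VN}}=\sqrt{\frac{1}{\boldsymbol\mu^\top\boldsymbol\Sigma^{-1}\boldsymbol\mu}},\quad C^{\mathrm{AZ}}=\sqrt{\frac{\boldsymbol\mu^\top\boldsymbol\Sigma\boldsymbol\mu}{(\boldsymbol\mu^\top\boldsymbol\mu)^2}},$$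 and $B_i^v=1/C_i^v$. Put $\mathbf C^v=(C_1^v,\dots,C_k^v)^\top$ and $\mathbf B^v=(B_1^v,\dots,B_k^v)^\top$. **Assumptions** (for a fixed $v$ and every group $i$). $\boldsymbol\mu_i\neq\mathbf 0$; all coordinates of $\mathbf X_{i1}$ have finite fourth moments; $\boldsymbol\Sigma_i$ is regular if $v\in\{\mathrm{RR},\mathrm{VN}\}$, $\boldsymbol\Sigma_i\ne\mathbf 0$ if $v=\mathrm{VV}$, and $\boldsymbol\mu_i^\top\boldsymbol\Sigma_i\boldsymbol\mu_i>0$ if $v=\mathrm{AZ}$. No coordinate of $\mathbf X_{i1}$ is conditionally two-point distributed, where a coordinate is called so if, almost surely, its conditional distribution given the other coordinates is concentrated on at most two points. **Variances.** Let $\boldsymbol\Psi_3=\operatorname{Cov}(\operatorname{vec}(\mathbf X\mathbf X^\top),\mathbf X)\in\mathbb R^{d^2\times d}$ and $\boldsymbol\Psi_4=\operatorname{Cov}(\operatorname{vec}(\mathbf X\mathbf X^\top))\in\mathbb R^{d^2\times d^2}$, and let $\widetilde{\mathbf D}(\mathbf x)\in\mathbb R^{d^2\times d}$ have the entry $-(x_r\mathbf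 1\{s=a\}+x_a\mathbf 1\{s=r\})$ at the position $((a,r),s)$. Define the row vectors $$\begin{aligned} \mathbf A_{\mathrm{RR}}&=\Bigl(-2d\det(\boldsymbol\Sigma)\tfrac{\boldsymbol\mu^\top}{(\boldsymbol\mu^\top\boldsymbol\mu)^{d+1}}+\mathbf w\widetilde{\mathbf D}(\boldsymbol\mu),\ \mathbf w\Bigr),&\mathbf w&=\tfrac{\det(\boldsymbol\Sigma)\operatorname{vec}(\boldsymbol\Sigma^{-1})^\top}{(\boldsymbol\mu^\top\boldsymbol\mu)^d},\\ \mathbf A_{\mathrm{VV}}&=\Bigl(-2\operatorname{tr}(\boldsymbol\Sigma)\tfrac{\boldsymbol\mu^\top}{(\boldsymbol\mu^\top\boldsymbol\mu)^2}+\mathbf w\widetilde{\mathbf D}(\boldsymbol\mu),\ \mathbf w\Bigr),&\mathbf w&=\tfrac{\operatorname{vec}(\mathbf I_d)^\top}{\boldsymbol\mu^\top\boldsymbol\mu},\\ \mathbf A_{\mathrm{VN}}&=\bigl(2\boldsymbol\mu^\top\boldsymbol\Sigma^{-1}+\mathbf w\widetilde{\mathbf D}(\boldsymbol\mu),\ \mathbf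 w\bigr),&\mathbf w&=-(\boldsymbol\mu^\top\boldsymbol\Sigma^{-1})\otimes(\boldsymbol\mu^\top\boldsymbol\Sigma^{-1}),\\ \mathbf A_{\mathrm{AZ}}&=\Bigl(-4\boldsymbol\mu^\top\boldsymbol\Sigma\boldsymbol\mu\tfrac{\boldsymbol\mu^\top}{(\boldsymbol\mu^\top\boldsymbol\mu)^3}+2\tfrac{\boldsymbol\mu^\top\boldsymbol\Sigma}{(\boldsymbol\mu^\top\boldsymbol\mu)^2}+\mathbf w\widetilde{\mathbf D}(\boldsymbol\mu),\ \mathbf w\Bigr),&\mathbf w&=\tfrac{\boldsymbol\mu^\top\otimes\boldsymbol\mu^\top}{(\boldsymbol\mu^\top\boldsymbol\mu)^2}, \end{aligned}$$ and $S_{\mathrm{RR}}=d^{-2}(C^{\mathrm{RR}})^{2-4d}$, $S_{\mathrm{VV}}=(C^{\mathrm{VV}})^{-2}$, $S_{\mathrm{VN}}=(C^{\mathrm{VN}})^6$, $S_{\mathrm{AZ}}=(C^{\mathrm{AZ}})^{-2}$. Put $$\sigma^2_{C^v}=\frac{S_v}{4}\,\mathbf A_v\begin{pmatrix}\boldsymbol\Sigma&\boldsymbol\Psi_3^\top\\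 \boldsymbol\Psi_3&\boldsymbol\Psi_4\end{pmatrix}\mathbf A_v^\top,\qquad \sigma^2_{B^v}=(C^v)^{-4}\sigma^2_{C^v}.$$ The estimators $\widehat C_i^v,\widehat B_i^v,\widehat\sigma^2_{i,C^v},\widehat\sigma^2_{i,B^v}$ replace, in these formulas, expectations by averages over the $n_i$ observations of group $i$ and $\boldsymbol\Sigma_i$ by the sample covariance matrix $\widehat{\boldsymbol\Sigma}_i$ (with divisor $n_i$ in all groups, or with divisor $n_i-1$ in all groups). Let $\widehat{\boldsymbol\Sigma}_{C^v}=\operatorname{diag}\bigl((n/n_1)\widehat\sigma^2_{1,C^v},\dots,(n/n_k)\widehat\sigma^2_{k,C^v}\bigr)$. **Procedure.** Let $\mathbf h_1,\dots,\mathbf h_r\in\mathbb R^k\setminus\{\mathbf 0\}$ be contrast vectors ($\mathbf h_\ell^\top\mathbf 1=0$), $\alpha\in(0,1)$, and $$T_{\ell,n}^v=\sqrt n\,\frac{\mathbf h_\ell^\top\widehat{\mathbf C}^v}{\sqrt{\mathbf h_\ell^\top\widehat{\boldsymbol\Sigma}_{C^v}\mathbf h_\ell}},\qquad [\widehat{\mathbf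 R}]_{\ell m}=\frac{\mathbf h_\ell^\top\widehat{\boldsymbol\Sigma}_{C^v}\mathbf h_m}{\sqrt{\mathbf h_\ell^\top\widehat{\boldsymbol\Sigma}_{C^v}\mathbf h_\ell}\sqrt{\mathbf h_m^\top\widehat{\boldsymbol\Sigma}_{C^v}\mathbf h_m}}.$$ Let $\widehat q$ be the two-sided equicoordinate $(1-\alpha)$-quantile of $N(\mathbf 0,\widehat{\mathbf R})$, i.e. the smallest $t$ with $\Pr(|Z_1|\le t,\dots,|Z_r|\le t)\ge 1-\alpha$ for $\mathbf Z\sim N(\mathbf 0,\widehat{\mathbf R})$. **Theorem.** As $n\to\infty$: (a) If $\mathbf h_\ell^\top\mathbf C^v=0$ for all $\ell=1,\dots,r$, then $\Pr\bigl(\max_{\ell}|T_{\ell,n}^v|>\widehat q\bigr)\to\alpha$. (b) Let $I_0=\{\ell:\mathbf h_\ell^\top\mathbf C^v=0\}$. Then $$\limsup_{n\to\infty}\Pr\Bigl(\bigcup_{\ell\in I_0}\{|T_{\ell,n}^v|>\widehat q\}\Bigr)\le\alpha\qquad\text{and}\qquad\lim_{n\to\infty}\Pr\Bigl(\bigcap_{\ell\notin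 I_0}\{|T_{\ell,n}^v|>\widehat q\}\Bigr)=1.$$ (c) $$\Pr\Bigl(\bigcap_{\ell=1}^r\Bigl\{\mathbf h_\ell^\top\mathbf C^v\in\Bigl[\mathbf h_\ell^\top\widehat{\mathbf C}^v\pm n^{-1/2}\sqrt{\mathbf h_\ell^\top\widehat{\boldsymbol\Sigma}_{C^v}\mathbf h_\ell}\ \widehat q\,\Bigr]\Bigr\}\Bigr)\to1-\alpha.$$ (d) Statements (a)-(c) also hold with $\mathbf B^v$, $\widehat{\mathbf B}^v$ and $\widehat\sigma^2_{i,B^v}$ in place of $\mathbf C^v$, $\widehat{\mathbf C}^v$ and $\widehat\sigma^2_{i,C^v}$ throughout. -/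

import Mathlib

open MeasureTheory ProbabilityTheory Filter Topology
open scoped Matrix

noncomputable section

namespace MCV

/-- The four variants of the multivariate coefficient of variation: Reyment, Van Valen,
Voinov-Nikulin, Albert-Zhang. -/
inductive Variant
  | RR
  | VV
  | VN
  | AZ

/-- The two effect sizes: the coefficient of variation `C` itself and the standardized mean
`B = 1 / C`. -/
inductive Effect
  | C
  | B

/-- Mean vector `μ`, covariance matrix `Σ` and the matrices `Ψ₃`, `Ψ₄` of a `d`-dimensional
distribution (or their empirical versions). The index `(a, r)` stands for the position
`a d - d + r` of a vectorized `d × d` matrix. -/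
structure Moments (d : ℕ) where
  mean : Fin d → ℝ
  cov : Matrix (Fin d) (Fin d) ℝ
  psi3 : Matrix (Fin d × Fin d) (Fin d) ℝ
  psi4 : Matrix (Fin d × Fin d) (Fin d × Fin d) ℝ

/-- The population quantities of a distribution `ν` on `ℝ^d`. -/
def populationMoments {d : ℕ} (ν : Measure (Fin d → ℝ)) : Moments d where
  mean := fun a => ∫ x, x a ∂ν
  cov := Matrix.of fun a b => covariance (fun x => x a) (fun x => x b) ν
  psi3 := Matrix.of fun p s =>
    (∫ x, x p.1 * x p.2 * x s ∂ν) - (∫ x, x p.1 * x p.2 ∂ν) * (∫ x, x s ∂ν)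
  psi4 := Matrix.of fun p q =>
    (∫ x, x p.1 * x p.2 * x q.1 * x q.2 ∂ν) -
      (∫ x, x p.1 * x p.2 ∂ν) * (∫ x, x q.1 * x q.2 ∂ν)

/-- The average of `f` over the first `N` observations. -/
def sampleAverage {d : ℕ} (N : ℕ) (x : ℕ → Fin d → ℝ) (f : (Fin d → ℝ) → ℝ) : ℝ :=
  (∑ j ∈ Finset.range N, f (x j)) / (N : ℝ)

/-- The empirical quantities of the first `N` observations of `x`. The sample covariance matrix
has the divisor `N - δ` (`δ = 0`: empirical covariance matrix, `δ = 1`: unbiased one). -/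
def sampleMoments {d : ℕ} (δ : ℕ) (N : ℕ) (x : ℕ → Fin d → ℝ) : Moments d where
  mean := fun a => sampleAverage N x fun y => y a
  cov := Matrix.of fun a b =>
    (∑ j ∈ Finset.range N,
      (x j a - sampleAverage N x fun y => y a) * (x j b - sampleAverage N x fun y => y b)) /
        ((N : ℝ) - (δ : ℝ))
  psi3 := Matrix.of fun p s =>
    (sampleAverage N x fun y => y p.1 * y p.2 * y s) -
      (sampleAverage N x fun y => y p.1 * y p.2) * (sampleAverage N x fun y => y s)
  psi4 := Matrix.of fun p q =>
    (sampleAverage N x fun y => y p.1 * y p.2 * y q.1 * y q.2) -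
      (sampleAverage N x fun y => y p.1 * y p.2) * (sampleAverage N x fun y => y q.1 * y q.2)

/-- The multivariate coefficient of variation `C^v` as a function of `μ` and `Σ`. -/
def mcv {d : ℕ} (v : Variant) (M : Moments d) : ℝ :=
  match v with
  | .RR => √(M.cov.det ^ (1 / (d : ℝ)) / (M.mean ⬝ᵥ M.mean))
  | .VV => √(M.cov.trace / (M.mean ⬝ᵥ M.mean))
  | .VN => √(1 / (M.mean ⬝ᵥ M.cov⁻¹ *ᵥ M.mean))
  | .AZ => √((M.mean ⬝ᵥ M.cov *ᵥ M.mean) / (M.mean ⬝ᵥ M.mean) ^ 2)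

/-- The effect size `C^v` or `B^v = 1 / C^v`. -/
def effect {d : ℕ} (e : Effect) (v : Variant) (M : Moments d) : ℝ :=
  match e with
  | .C => mcv v M
  | .B => 1 / mcv v M

/-- The matrix `D̃(x)`: derivative of `vec (-x xᵀ)`. -/
def dTilde {d : ℕ} (x : Fin d → ℝ) : Matrix (Fin d × Fin d) (Fin d) ℝ :=
  Matrix.of fun p s =>
    -(if s = p.1 ∧ p.1 ≠ p.2 then x p.2 else 0)
      - 2 * (if s = p.2 ∧ p.2 = p.1 then x s else 0)
      - (if p.2 = s ∧ s ≠ p.1 then x p.1 else 0)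

/-- The block of `A_v(μ, Σ)` that belongs to the vectorized covariance matrix. -/
def gradCov {d : ℕ} (v : Variant) (M : Moments d) : Fin d × Fin d → ℝ :=
  match v with
  | .RR => fun p => M.cov.det * M.cov⁻¹ p.1 p.2 / (M.mean ⬝ᵥ M.mean) ^ d
  | .VV => fun p => (1 : Matrix (Fin d) (Fin d) ℝ) p.1 p.2 / (M.mean ⬝ᵥ M.mean)
  | .VN => fun p => -((M.mean ᵥ* M.cov⁻¹) p.1 * (M.mean ᵥ* M.cov⁻¹) p.2)
  | .AZ => fun p => M.mean p.1 * M.mean p.2 / (M.mean ⬝ᵥ M.mean) ^ 2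

/-- The part of the mean block of `A_v(μ, Σ)` that does not involve `D̃(μ)`. -/
def gradMean {d : ℕ} (v : Variant) (M : Moments d) : Fin d → ℝ :=
  match v with
  | .RR => fun s => -2 * (d : ℝ) * M.cov.det * (M.mean s / (M.mean ⬝ᵥ M.mean) ^ (d + 1))
  | .VV => fun s => -2 * M.cov.trace * (M.mean s / (M.mean ⬝ᵥ M.mean) ^ 2)
  | .VN => fun s => 2 * (M.mean ᵥ* M.cov⁻¹) s
  | .AZ => fun s =>
      -4 * (M.mean ⬝ᵥ M.cov *ᵥ M.mean) * (M.mean s / (M.mean ⬝ᵥ M.mean) ^ 3)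
        + 2 * ((M.mean ᵥ* M.cov) s / (M.mean ⬝ᵥ M.mean) ^ 2)

/-- The row vector `A_v(μ, Σ)` of length `d + d²`. -/
def gradVec {d : ℕ} (v : Variant) (M : Moments d) : Fin d ⊕ (Fin d × Fin d) → ℝ :=
  Sum.elim (gradMean v M + gradCov v M ᵥ* dTilde M.mean) (gradCov v M)

/-- The factor `S_v`. -/
def scaleFactor {d : ℕ} (v : Variant) (M : Moments d) : ℝ :=
  match v with
  | .RR => ((d : ℝ) ^ 2)⁻¹ * mcv .RR M ^ (2 - 4 * (d : ℤ))
  | .VV => mcv .VV M ^ (-2 : ℤ)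
  | .VN => mcv .VN M ^ 6
  | .AZ => mcv .AZ M ^ (-2 : ℤ)

/-- The variance `σ²_{C^v} = (S_v / 4) A_v (Σ, Ψ₃ᵀ; Ψ₃, Ψ₄) A_vᵀ`. -/
def varC {d : ℕ} (v : Variant) (M : Moments d) : ℝ :=
  scaleFactor v M / 4 *
    (gradVec v M ⬝ᵥ Matrix.fromBlocks M.cov M.psi3ᵀ M.psi3 M.psi4 *ᵥ gradVec v M)

/-- The variance `σ²_{C^v}` or `σ²_{B^v} = (C^v)⁻⁴ σ²_{C^v}`. -/
def varEffect {d : ℕ} (e : Effect) (v : Variant) (M : Moments d) : ℝ :=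
  match e with
  | .C => varC v M
  | .B => mcv v M ^ (-4 : ℤ) * varC v M

/-- The moment and regularity conditions under which the variant `v` is well defined. -/
def WellDefined {d : ℕ} (v : Variant) (ν : Measure (Fin d → ℝ)) : Prop :=
  (populationMoments ν).mean ≠ 0 ∧
  (∀ l : Fin d, Integrable (fun x => x l ^ 4) ν) ∧
  match v with
  | .RR => IsUnit (populationMoments ν).cov
  | .VV => (populationMoments ν).cov ≠ 0
  | .VN => IsUnit (populationMoments ν).cov
  | .AZ => 0 < (populationMoments ν).mean ⬝ᵥ
      (populationMoments ν).cov *ᵥ (populationMoments ν).mean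

/-- The `l`-th coordinate is conditionally two-point distributed under `ν`: almost surely, its
conditional distribution given the remaining coordinates is degenerate or is concentrated on
two points (the points may depend on the remaining coordinates). -/
def IsCondTwoPoint {d : ℕ} (ν : Measure (Fin d → ℝ)) [IsFiniteMeasure ν] (l : Fin d) : Prop :=
  ∀ᵐ y ∂(ν.map fun (x : Fin d → ℝ) (s : {s : Fin d // s ≠ l}) => x s),
    ∃ a b : ℝ,
      condDistrib (fun x : Fin d → ℝ => x l)
        (fun (x : Fin d → ℝ) (s : {s : Fin d // s ≠ l}) => x s) ν y ({a, b}ᶜ) = 0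

/-- The vector of the group-wise effects `C^v` or `B^v`. -/
def effects {d k : ℕ} (e : Effect) (v : Variant) (ν : Fin k → Measure (Fin d → ℝ)) :
    Fin k → ℝ :=
  fun i => effect e v (populationMoments (ν i))

/-- The vector of the plug-in estimators, when group `i` contributes its first `n i`
observations. -/
def effectsHat {d k : ℕ} (e : Effect) (v : Variant) (δ : ℕ) (n : Fin k → ℕ)
    (x : Fin k → ℕ → Fin d → ℝ) : Fin k → ℝ :=
  fun i => effect e v (sampleMoments δ (n i) (x i))

/-- The total sample size. -/
def total {k : ℕ} (n : Fin k → ℕ) : ℕ := ∑ i, n i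

/-- The estimator `diag((n / n₁) σ̂₁², …, (n / n_k) σ̂_k²)` of the asymptotic covariance matrix. -/
def sigmaHat {d k : ℕ} (e : Effect) (v : Variant) (δ : ℕ) (n : Fin k → ℕ)
    (x : Fin k → ℕ → Fin d → ℝ) : Matrix (Fin k) (Fin k) ℝ :=
  Matrix.diagonal fun i =>
    ((total n : ℝ) / (n i : ℝ)) * varEffect e v (sampleMoments δ (n i) (x i))

/-- The correlation matrix of the contrasts `h_ℓ` (the rows of `H`) under the covariance
matrix `S`. -/
def contrastCorr {k r : ℕ} (H : Matrix (Fin r) (Fin k) ℝ) (S : Matrix (Fin k) (Fin k) ℝ) :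
    Matrix (Fin r) (Fin r) ℝ :=
  Matrix.of fun l m => (H l ⬝ᵥ S *ᵥ H m) / (√(H l ⬝ᵥ S *ᵥ H l) * √(H m ⬝ᵥ S *ᵥ H m))

/-- The (two-sided) equicoordinate `p`-quantile of `N(0, R)`: the smallest `t` such that
`P(|Z_1| ≤ t, …, |Z_r| ≤ t) ≥ p` for `Z ∼ N(0, R)`. -/
def equiQuantile {r : ℕ} (p : ℝ) (R : Matrix (Fin r) (Fin r) ℝ) : ℝ :=
  sInf {t : ℝ | p ≤ (multivariateGaussian 0 R).real {z | ∀ l : Fin r, |z l| ≤ t}}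

/-- The estimated standard error `n^{-1/2} (h_ℓᵀ Σ̂ h_ℓ)^{1/2}` of the `ℓ`-th contrast. -/
def contrastSE {d k r : ℕ} (e : Effect) (v : Variant) (δ : ℕ) (H : Matrix (Fin r) (Fin k) ℝ)
    (n : Fin k → ℕ) (x : Fin k → ℕ → Fin d → ℝ) (l : Fin r) : ℝ :=
  √(H l ⬝ᵥ sigmaHat e v δ n x *ᵥ H l) / √(total n : ℝ)

/-- The studentized contrast `T_{ℓ,n}`. -/
def studentized {d k r : ℕ} (e : Effect) (v : Variant) (δ : ℕ) (H : Matrix (Fin r) (Fin k) ℝ)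
    (n : Fin k → ℕ) (x : Fin k → ℕ → Fin d → ℝ) (l : Fin r) : ℝ :=
  √(total n : ℝ) * ((H l ⬝ᵥ effectsHat e v δ n x) / √(H l ⬝ᵥ sigmaHat e v δ n x *ᵥ H l))

/-- The max-type statistic `max_ℓ |T_{ℓ,n}|`. -/
def maxStat {d k r : ℕ} (e : Effect) (v : Variant) (δ : ℕ) (H : Matrix (Fin r) (Fin k) ℝ)
    (n : Fin k → ℕ) (x : Fin k → ℕ → Fin d → ℝ) : ℝ :=
  ⨆ l : Fin r, |studentized e v δ H n x l|

/-- The critical value: the equicoordinate `(1 - α)`-quantile of `N(0, R̂)`. -/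
def critValue {d k r : ℕ} (e : Effect) (v : Variant) (δ : ℕ) (α : ℝ)
    (H : Matrix (Fin r) (Fin k) ℝ) (n : Fin k → ℕ) (x : Fin k → ℕ → Fin d → ℝ) : ℝ :=
  equiQuantile (1 - α) (contrastCorr H (sigmaHat e v δ n x))

end MCV

end

/-! Each effect is a smooth function of mean vector and covariance matrix, so the delta method
reduces its estimator to an average of i.i.d. terms. With `influence` the derivative of the inner
function applied to `(x - μ, (x - μ)(x - μ)ᵀ - Σ)`, the scaled error `√nᵢ (Ĉᵢ - Cᵢ)` equals
`effectScale` times `√nᵢ` times the average of `influence`, up to a term vanishing in probability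
(`tendsto_effect_linear`). Up to a constant, `influence` is `A_v` applied to `(x, vec(x xᵀ))`, with
`D̃(μ)` accounting for the centring. Hence its variance is the quadratic form in the definition of
`σ²`, and `S_v / 4` is the square of the outer derivative. Passing from `C` to `B` only multiplies
the derivative by `-C⁻²`, so both effects are treated at once.

The limit variance is positive (`varEffect_pos`). Otherwise `A_v · (x, vec(x xᵀ))` would be almost
surely constant. With all coordinates but the `l`-th frozen this is a quadratic polynomial in `x l`
with leading coefficient `gradCov v M (l, l)`, which is nonzero for some `l`; that coordinate would
be conditionally two-point distributed.

By the central limit theorem in each group and independence between the groups, the studentized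
contrasts, centred at the true ones, behave like `A g` with `g` standard normal and `A Aᵀ` the
limiting correlation matrix (`tendsto_centredContrast_sub`, `tendsto_real_norm_mulVec_groupSum`).
This matrix may be singular. All that matters is that the rows of `A` are nonzero: then the
distribution function of `‖A g‖` (sup norm) is continuous, strictly increasing on `[0, ∞)`, and
continuous in `A`. So the estimated quantile converges in probability to the quantile `q₀` of the
limit (`tendsto_equiQuantile`), and the centred maximum stays below the critical value with
probability tending to `1 - α` (`tendsto_real_norm_centredContrast`).

The conclusions follow from this limit. Centred and uncentred statistics agree for true hypotheses,
the confidence intervals are the inverted tests, and for false hypotheses the statistic diverges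
while the critical value stays bounded. Convergence in probability is convergence along the filter
`probFilter`, defined by outer probabilities. Slutsky-type arguments thus become limit algebra, and
neither the estimators nor the critical value have to be measurable. -/

noncomputable section

namespace MCV

/-! ### Derivatives of determinants and quadratic forms along lines. -/

section Gradient

variable {d : ℕ}

theorem tendsto_dotProduct {X : Type*} {l : Filter X} {x y : X → Fin d → ℝ} {a b : Fin d → ℝ}
    (hx : Tendsto x l (𝓝 a)) (hy : Tendsto y l (𝓝 b)) :
    Tendsto (fun p => x p ⬝ᵥ y p) l (𝓝 (a ⬝ᵥ b)) := by
  have h : Continuous fun q : (Fin d → ℝ) × (Fin d → ℝ) => q.1 ⬝ᵥ q.2 :=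
    continuous_fst.dotProduct continuous_snd
  exact (h.tendsto (a, b)).comp (hx.prodMk_nhds hy)

theorem tendsto_mulVec {X : Type*} {l : Filter X} {A : X → Matrix (Fin d) (Fin d) ℝ}
    {A₀ : Matrix (Fin d) (Fin d) ℝ} {y : X → Fin d → ℝ} {b : Fin d → ℝ}
    (hA : Tendsto A l (𝓝 A₀)) (hy : Tendsto y l (𝓝 b)) :
    Tendsto (fun p => A p *ᵥ y p) l (𝓝 (A₀ *ᵥ b)) := by
  have h : Continuous fun q : Matrix (Fin d) (Fin d) ℝ × (Fin d → ℝ) => q.1 *ᵥ q.2 :=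
    continuous_fst.matrix_mulVec continuous_snd
  exact (h.tendsto (A₀, b)).comp (hA.prodMk_nhds hy)

/-- Separates the qualitative question of differentiability from the formula: once the former is
known, uniqueness of line derivatives leaves only one-variable calculus. -/
theorem hasFDerivAt_of_hasDerivAt_lines {E : Type*} [NormedAddCommGroup E] [NormedSpace ℝ E]
    {f : E → ℝ} {L : E →L[ℝ] ℝ} {x : E} (hf : DifferentiableAt ℝ f x)
    (h : ∀ w, HasDerivAt (fun t : ℝ => f (x + t • w)) (L w) 0) : HasFDerivAt f L x := by
  have h1 : fderiv ℝ f x = L := by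
    ext w
    exact (hf.hasFDerivAt.hasLineDerivAt w).unique (h w)
  exact h1 ▸ hf.hasFDerivAt

/-- Traces, squared norms and quadratic forms with moving matrix and argument are polynomials of
degree at most three along a line, so only the linear coefficient has to be read off. -/
theorem hasDerivAt_cubic_zero (a b c e : ℝ) :
    HasDerivAt (fun t : ℝ => a + b * t + c * t ^ 2 + e * t ^ 3) b 0 := by
  have := ((((hasDerivAt_id (0 : ℝ)).const_mul b).const_add a).add
    ((hasDerivAt_pow 2 (0 : ℝ)).const_mul c)).add ((hasDerivAt_pow 3 (0 : ℝ)).const_mul e)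
  convert! this using 1
  simp

theorem hasDerivAt_dotProduct_line (μ u : Fin d → ℝ) :
    HasDerivAt (fun t : ℝ => (μ + t • u) ⬝ᵥ (μ + t • u)) (2 * (μ ⬝ᵥ u)) 0 := by
  convert! hasDerivAt_cubic_zero (μ ⬝ᵥ μ) (2 * (μ ⬝ᵥ u)) (u ⬝ᵥ u) 0 using 2 with t
  simp only [dotProduct_add, add_dotProduct, smul_dotProduct, dotProduct_smul, smul_eq_mul,
    dotProduct_comm u μ]
  ring

theorem hasDerivAt_trace_line (S V : Matrix (Fin d) (Fin d) ℝ) :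
    HasDerivAt (fun t : ℝ => (S + t • V).trace) V.trace 0 := by
  convert! hasDerivAt_cubic_zero S.trace V.trace 0 0 using 2 with t
  simp [Matrix.trace_add, Matrix.trace_smul]
  ring

theorem dotProduct_mulVec_symm {S : Matrix (Fin d) (Fin d) ℝ} (hS : Sᵀ = S) (x y : Fin d → ℝ) :
    x ⬝ᵥ S *ᵥ y = y ⬝ᵥ S *ᵥ x := by
  rw [Matrix.dotProduct_mulVec, ← Matrix.mulVec_transpose, hS, dotProduct_comm]

theorem hasDerivAt_quadraticForm_line {S : Matrix (Fin d) (Fin d) ℝ} (hS : Sᵀ = S)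
    (V : Matrix (Fin d) (Fin d) ℝ) (μ u : Fin d → ℝ) :
    HasDerivAt (fun t : ℝ => (μ + t • u) ⬝ᵥ (S + t • V) *ᵥ (μ + t • u))
      (2 * (μ ᵥ* S ⬝ᵥ u) + μ ⬝ᵥ V *ᵥ μ) 0 := by
  convert! hasDerivAt_cubic_zero (μ ⬝ᵥ S *ᵥ μ) (2 * (μ ᵥ* S ⬝ᵥ u) + μ ⬝ᵥ V *ᵥ μ)
    (u ⬝ᵥ S *ᵥ u + μ ⬝ᵥ V *ᵥ u + u ⬝ᵥ V *ᵥ μ) (u ⬝ᵥ V *ᵥ u) using 2 with t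
  simp only [dotProduct_add, add_dotProduct, smul_dotProduct, dotProduct_smul, smul_eq_mul,
    Matrix.add_mulVec, Matrix.mulVec_add, Matrix.smul_mulVec, Matrix.mulVec_smul,
    dotProduct_mulVec_symm hS u μ, ← Matrix.dotProduct_mulVec]
  ring

/-- Jacobi's formula. Factoring out `S` leaves `det (1 + t S⁻¹ V)`, a polynomial in `t` that begins
with `1 + t tr (S⁻¹ V)`. -/
theorem hasDerivAt_det_line {S : Matrix (Fin d) (Fin d) ℝ} (hS : IsUnit S)
    (V : Matrix (Fin d) (Fin d) ℝ) :
    HasDerivAt (fun t : ℝ => (S + t • V).det) (S.det * (S⁻¹ * V).trace) 0 := by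
  have hS' : IsUnit S.det := (Matrix.isUnit_iff_isUnit_det S).1 hS
  have h : ∀ t : ℝ, (S + t • V).det = S.det * (1 + (S⁻¹ * V).trace * t +
      (Matrix.det (1 + (Polynomial.X : Polynomial ℝ) •
        (S⁻¹ * V).map Polynomial.C)).divX.divX.eval t * t ^ 2) := by
    intro t
    rw [← Matrix.det_one_add_smul, ← Matrix.det_mul, mul_add, mul_one, mul_smul_comm,
      Matrix.mul_nonsing_inv_cancel_left _ _ hS']
  simp_rw [h]
  refine HasDerivAt.const_mul _ ?_
  have h1 := ((hasDerivAt_id (0 : ℝ)).const_mul (S⁻¹ * V).trace).const_add 1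
  have h2 := ((Matrix.det (1 + (Polynomial.X : Polynomial ℝ) •
        (S⁻¹ * V).map Polynomial.C)).divX.divX.hasDerivAt (0 : ℝ)).mul (hasDerivAt_pow 2 (0 : ℝ))
  convert! h1.add h2 using 1
  simp

theorem continuousAt_matrix_inv {X : Type*} [TopologicalSpace X]
    {A : X → Matrix (Fin d) (Fin d) ℝ} {x : X} (hA : ContinuousAt A x) (hx : IsUnit (A x)) :
    ContinuousAt (fun y => (A y)⁻¹) x := by
  have hdet : (A x).det ≠ 0 := ((Matrix.isUnit_iff_isUnit_det _).1 hx).ne_zero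
  simp_rw [Matrix.inv_def, Ring.inverse_eq_inv']
  exact ((continuous_id.matrix_det.continuousAt.comp hA).inv₀ hdet).smul
    (continuous_id.matrix_adjugate.continuousAt.comp hA)

/-- The resolvent identity `(S + tV)⁻¹ = S⁻¹ - t (S + tV)⁻¹ V S⁻¹` splits the form into one with the
fixed matrix `S⁻¹` and a term `t * g t`. Continuity of the inverse therefore suffices; it need not
be differentiated. -/
theorem hasDerivAt_inv_quadraticForm_line {S : Matrix (Fin d) (Fin d) ℝ} (hS : IsUnit S)
    (hsymm : Sᵀ = S) (V : Matrix (Fin d) (Fin d) ℝ) (μ u : Fin d → ℝ) :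
    HasDerivAt (fun t : ℝ => (μ + t • u) ⬝ᵥ (S + t • V)⁻¹ *ᵥ (μ + t • u))
      (2 * (μ ᵥ* S⁻¹ ⬝ᵥ u) - μ ᵥ* S⁻¹ ⬝ᵥ V *ᵥ (S⁻¹ *ᵥ μ)) 0 := by
  have hS' : IsUnit S.det := (Matrix.isUnit_iff_isUnit_det S).1 hS
  have hcont : Continuous fun t : ℝ => S + t • V := by fun_prop
  have hinv : ContinuousAt (fun t : ℝ => (S + t • V)⁻¹) 0 :=
    continuousAt_matrix_inv hcont.continuousAt (by simpa using hS)
  have hev : ∀ᶠ t : ℝ in 𝓝 0, IsUnit (S + t • V).det := by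
    have : ContinuousAt (fun t : ℝ => (S + t • V).det) 0 := hcont.matrix_det.continuousAt
    filter_upwards [this.eventually_ne (y := 0) (by simpa using hS'.ne_zero)] with t ht
    exact isUnit_iff_ne_zero.2 ht
  set g : ℝ → ℝ := fun t => (μ + t • u) ⬝ᵥ (S + t • V)⁻¹ *ᵥ (V *ᵥ (S⁻¹ *ᵥ (μ + t • u))) with hg
  have hgc : ContinuousAt g 0 := by
    have h1 : Continuous fun t : ℝ => μ + t • u := by fun_prop
    have h2 : Continuous fun t : ℝ => V *ᵥ (S⁻¹ *ᵥ (μ + t • u)) := by fun_prop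
    exact tendsto_dotProduct h1.continuousAt (tendsto_mulVec hinv h2.continuousAt)
  -- The slope of `t * g t` at zero is `g t` itself, so continuity of `g` at zero is enough.
  have hprod : HasDerivAt (fun t : ℝ => t * g t) (g 0) 0 := by
    rw [hasDerivAt_iff_tendsto_slope]
    have : Tendsto g (𝓝[≠] 0) (𝓝 (g 0)) := hgc.tendsto.mono_left nhdsWithin_le_nhds
    refine this.congr' ?_
    filter_upwards [self_mem_nhdsWithin] with t ht
    have ht : t ≠ 0 := ht
    simp [slope_def_field, ht]
  have hq := hasDerivAt_quadraticForm_line (S := S⁻¹)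
    (by rw [Matrix.transpose_nonsing_inv, hsymm]) 0 μ u
  have h3 := hq.sub hprod
  have hg0 : g 0 = μ ᵥ* S⁻¹ ⬝ᵥ V *ᵥ (S⁻¹ *ᵥ μ) := by
    simp [hg, Matrix.dotProduct_mulVec]
  rw [hg0] at h3
  convert! h3.congr_of_eventuallyEq (f₁ := _) ?_ using 1
  · simp
  · filter_upwards [hev] with t ht
    have key : (S + t • V)⁻¹ = S⁻¹ - t • ((S + t • V)⁻¹ * V * S⁻¹) := by
      have h4 : (S + t • V)⁻¹ * (S + t • V) * S⁻¹ = S⁻¹ := by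
        rw [Matrix.nonsing_inv_mul _ ht, one_mul]
      rw [Matrix.mul_add, Matrix.add_mul, Matrix.mul_nonsing_inv_cancel_right _ _ hS'] at h4
      rw [eq_sub_iff_add_eq]
      simpa using h4
    simp only [Pi.sub_apply, hg]
    nth_rewrite 1 [key]
    simp [Matrix.sub_mulVec, Matrix.smul_mulVec, dotProduct_sub, Matrix.mulVec_mulVec,
      Matrix.mul_assoc]

end Gradient

/-! ### Chain rule for the four coefficients of variation. -/

section Regular

variable {d : ℕ}

/-- Mean and covariance matrix for which the variant `v` is positive and differentiable. -/
structure Regular (v : Variant) (M : Moments d) : Prop where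
  mean_ne : M.mean ≠ 0
  posSemidef : M.cov.PosSemidef
  nondegenerate : match v with
    | .RR => IsUnit M.cov
    | .VV => M.cov ≠ 0
    | .VN => IsUnit M.cov
    | .AZ => 0 < M.mean ⬝ᵥ M.cov *ᵥ M.mean

/-- The quantity whose square root is the coefficient of variation. -/
def radicand (v : Variant) (M : Moments d) : ℝ :=
  match v with
  | .RR => M.cov.det ^ (1 / (d : ℝ)) / (M.mean ⬝ᵥ M.mean)
  | .VV => M.cov.trace / (M.mean ⬝ᵥ M.mean)
  | .VN => 1 / (M.mean ⬝ᵥ M.cov⁻¹ *ᵥ M.mean)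
  | .AZ => (M.mean ⬝ᵥ M.cov *ᵥ M.mean) / (M.mean ⬝ᵥ M.mean) ^ 2

theorem mcv_eq_sqrt_radicand (v : Variant) (M : Moments d) : mcv v M = √(radicand v M) := by
  cases v <;> rfl

theorem dotProduct_self_pos_of_ne {x : Fin d → ℝ} (hx : x ≠ 0) : 0 < x ⬝ᵥ x :=
  lt_of_le_of_ne (Finset.sum_nonneg fun i _ => mul_self_nonneg (x i))
    (Ne.symm (mt dotProduct_self_eq_zero.1 hx))

theorem Regular.mean_pos {v : Variant} {M : Moments d} (h : Regular v M) :
    0 < M.mean ⬝ᵥ M.mean := dotProduct_self_pos_of_ne h.mean_ne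

theorem Regular.dim_pos {v : Variant} {M : Moments d} (h : Regular v M) : 0 < d := by
  rcases Nat.eq_zero_or_pos d with rfl | hd
  · exact absurd (Subsingleton.elim _ _) h.mean_ne
  · exact hd

theorem Regular.cov_transpose {v : Variant} {M : Moments d} (h : Regular v M) :
    M.covᵀ = M.cov := by
  simpa [Matrix.IsHermitian, Matrix.conjTranspose_eq_transpose_of_trivial] using
    h.posSemidef.isHermitian

theorem posDef_of_isUnit {S : Matrix (Fin d) (Fin d) ℝ} (h : S.PosSemidef) (hu : IsUnit S) :
    S.PosDef := h.posDef_iff_isUnit.2 hu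

theorem PosDef.quadraticForm_pos {S : Matrix (Fin d) (Fin d) ℝ} (h : S.PosDef) {x : Fin d → ℝ}
    (hx : x ≠ 0) : 0 < x ⬝ᵥ S *ᵥ x := by
  simpa using h.dotProduct_mulVec_pos hx

theorem Regular.radicand_pos {v : Variant} {M : Moments d} (h : Regular v M) :
    0 < radicand v M := by
  have hm := h.mean_pos
  have hn := h.nondegenerate
  cases v with
  | RR => exact div_pos (Real.rpow_pos_of_pos (posDef_of_isUnit h.posSemidef hn).det_pos _) hm
  | VV =>
    refine div_pos (lt_of_le_of_ne h.posSemidef.trace_nonneg fun h0 => hn ?_) hm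
    exact h.posSemidef.trace_eq_zero_iff.1 h0.symm
  | VN =>
    exact one_div_pos.2 (PosDef.quadraticForm_pos (posDef_of_isUnit h.posSemidef hn).inv h.mean_ne)
  | AZ => exact div_pos hn (pow_pos hm 2)

theorem Regular.mcv_pos {v : Variant} {M : Moments d} (h : Regular v M) : 0 < mcv v M := by
  rw [mcv_eq_sqrt_radicand]
  exact Real.sqrt_pos.2 h.radicand_pos

/-- The outer derivative in the chain rule for the coefficient of variation. -/
def outerDeriv (v : Variant) (M : Moments d) : ℝ :=
  match v with
  | .RR => mcv .RR M ^ (1 - 2 * (d : ℤ)) / (2 * d)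
  | .VV => (2 * mcv .VV M)⁻¹
  | .VN => -(mcv .VN M ^ 3 / 2)
  | .AZ => (2 * mcv .AZ M)⁻¹

/-- The rows `A_v` are gradients of an inner function `y`: `y = C ^ (2 d)` for RR, `y = C²` for VV
and AZ, `y = C⁻²` for VN. `outerDeriv` is `dC/dy` written in terms of `C`, and this lemma explains
the factor `S_v / 4`. -/
theorem outerDeriv_sq {v : Variant} {M : Moments d} (h : Regular v M) :
    outerDeriv v M ^ 2 = scaleFactor v M / 4 := by
  have hC := h.mcv_pos.ne'
  cases v with
  | RR =>
    have h1 : mcv .RR M ^ (2 - 4 * (d : ℤ)) = (mcv .RR M ^ (1 - 2 * (d : ℤ))) ^ 2 := by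
      rw [← zpow_natCast, ← zpow_mul]; congr 1; push_cast; ring
    simp only [outerDeriv, scaleFactor, h1]
    ring
  | VV => simp only [outerDeriv, scaleFactor, zpow_neg]; norm_cast; ring
  | VN => simp only [outerDeriv, scaleFactor]; ring
  | AZ => simp only [outerDeriv, scaleFactor, zpow_neg]; norm_cast; ring

theorem outerDeriv_ne_zero {v : Variant} {M : Moments d} (h : Regular v M) :
    outerDeriv v M ≠ 0 := by
  have hC := h.mcv_pos.ne'
  have hd : (d : ℝ) ≠ 0 := by exact_mod_cast h.dim_pos.ne'
  cases v <;> simp only [outerDeriv, ne_eq, neg_eq_zero] <;> positivity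

/-- The derivative of the inner function in the direction `(u, V)`. -/
def gradPairing (v : Variant) (M : Moments d) (u : Fin d → ℝ) (V : Fin d → Fin d → ℝ) : ℝ :=
  gradMean v M ⬝ᵥ u + ∑ a, ∑ b, gradCov v M (a, b) * V a b

/-- The pairing of `vec(Σ⁻¹)` with `vec(V)` is `tr (Σ⁻¹ V)` only up to a transpose, which the
symmetry of `Σ` removes. -/
theorem gradPairing_RR {M : Moments d} (h : Regular .RR M) (u : Fin d → ℝ)
    (V : Fin d → Fin d → ℝ) :
    gradPairing .RR M u V = -2 * d * M.cov.det * (M.mean ⬝ᵥ u) / (M.mean ⬝ᵥ M.mean) ^ (d + 1)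
      + M.cov.det * (M.cov⁻¹ * Matrix.of V).trace / (M.mean ⬝ᵥ M.mean) ^ d := by
  have hsymm : ∀ a b, M.cov⁻¹ a b = M.cov⁻¹ b a := fun a b => by
    rw [← Matrix.transpose_apply M.cov⁻¹, Matrix.transpose_nonsing_inv, h.cov_transpose]
  have h1 : (M.cov⁻¹ * Matrix.of V).trace = ∑ a, ∑ b, M.cov⁻¹ a b * V a b := by
    rw [Finset.sum_comm]
    simp only [Matrix.trace, Matrix.diag, Matrix.mul_apply, Matrix.of_apply]
    refine Finset.sum_congr rfl fun b _ => Finset.sum_congr rfl fun a _ => by rw [hsymm]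
  rw [h1]
  simp only [gradPairing, gradMean, gradCov, dotProduct, Finset.mul_sum, Finset.sum_div]
  congr 1
  · exact Finset.sum_congr rfl fun i _ => by ring
  · exact Finset.sum_congr rfl fun i _ => Finset.sum_congr rfl fun j _ => by ring

theorem gradPairing_VV (M : Moments d) (u : Fin d → ℝ) (V : Fin d → Fin d → ℝ) :
    gradPairing .VV M u V = -2 * M.cov.trace * (M.mean ⬝ᵥ u) / (M.mean ⬝ᵥ M.mean) ^ 2
      + (Matrix.of V).trace / (M.mean ⬝ᵥ M.mean) := by
  simp only [gradPairing, gradMean, gradCov]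
  congr 1
  · simp only [dotProduct, Finset.mul_sum, Finset.sum_div]
    exact Finset.sum_congr rfl fun i _ => by ring
  · simp only [Matrix.trace, Matrix.diag, Matrix.of_apply, Finset.sum_div]
    refine Finset.sum_congr rfl fun a _ => ?_
    rw [Finset.sum_eq_single a]
    · simp; ring
    · intro b _ hb
      simp [Matrix.one_apply_ne hb.symm]
    · simp

theorem gradPairing_VN {M : Moments d} (h : Regular .VN M) (u : Fin d → ℝ)
    (V : Fin d → Fin d → ℝ) :
    gradPairing .VN M u V = 2 * (M.mean ᵥ* M.cov⁻¹ ⬝ᵥ u)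
      - M.mean ᵥ* M.cov⁻¹ ⬝ᵥ Matrix.of V *ᵥ (M.cov⁻¹ *ᵥ M.mean) := by
  have h1 : M.cov⁻¹ *ᵥ M.mean = M.mean ᵥ* M.cov⁻¹ := by
    rw [← Matrix.mulVec_transpose, Matrix.transpose_nonsing_inv, h.cov_transpose]
  rw [h1]
  simp only [gradPairing, gradMean, gradCov]
  rw [sub_eq_add_neg]
  congr 1
  · simp only [dotProduct, Finset.mul_sum]
    exact Finset.sum_congr rfl fun i _ => by ring
  · simp only [dotProduct, Matrix.mulVec, Matrix.of_apply, Finset.mul_sum,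
      ← Finset.sum_neg_distrib]
    exact Finset.sum_congr rfl fun i _ => Finset.sum_congr rfl fun j _ => by ring

theorem gradPairing_AZ (M : Moments d) (u : Fin d → ℝ) (V : Fin d → Fin d → ℝ) :
    gradPairing .AZ M u V =
      -4 * (M.mean ⬝ᵥ M.cov *ᵥ M.mean) * (M.mean ⬝ᵥ u) / (M.mean ⬝ᵥ M.mean) ^ 3
      + 2 * (M.mean ᵥ* M.cov ⬝ᵥ u) / (M.mean ⬝ᵥ M.mean) ^ 2
      + (M.mean ⬝ᵥ Matrix.of V *ᵥ M.mean) / (M.mean ⬝ᵥ M.mean) ^ 2 := by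
  simp only [gradPairing, gradMean, gradCov]
  congr 1
  · generalize M.mean ⬝ᵥ M.cov *ᵥ M.mean = q
    generalize M.mean ⬝ᵥ M.mean = w
    generalize M.mean ᵥ* M.cov = z
    simp only [dotProduct, Finset.mul_sum, Finset.sum_div, ← Finset.sum_add_distrib]
    exact Finset.sum_congr rfl fun i _ => by ring
  · generalize M.mean ⬝ᵥ M.mean = w
    simp only [dotProduct, Matrix.mulVec, Matrix.of_apply, Finset.mul_sum, Finset.sum_div]
    exact Finset.sum_congr rfl fun i _ => Finset.sum_congr rfl fun j _ => by ring

/-- The coefficient of variation as a function of mean vector and covariance matrix. -/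
def mcvFun (v : Variant) (x : (Fin d → ℝ) × (Fin d → Fin d → ℝ)) : ℝ :=
  mcv v ⟨x.1, Matrix.of x.2, 0, 0⟩

theorem mcvFun_eq (v : Variant) (M : Moments d) : mcvFun v (M.mean, M.cov) = mcv v M := by
  cases v <;> rfl

theorem hasDerivAt_mcv_line {v : Variant} {M : Moments d} (h : Regular v M) (u : Fin d → ℝ)
    (V : Fin d → Fin d → ℝ) :
    HasDerivAt (fun t : ℝ => mcv v ⟨M.mean + t • u, M.cov + t • Matrix.of V, 0, 0⟩)
      (outerDeriv v M * gradPairing v M u V) 0 := by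
  have hC := h.mcv_pos.ne'
  have hr := h.radicand_pos
  have hm := h.mean_pos
  have hn := h.nondegenerate
  have hsq : mcv v M ^ 2 = radicand v M := by
    rw [mcv_eq_sqrt_radicand, Real.sq_sqrt hr.le]
  have hC' := mcv_eq_sqrt_radicand v M
  have h1 := hasDerivAt_dotProduct_line M.mean u
  cases v with
  | RR =>
    have h2 := hasDerivAt_det_line hn (Matrix.of V)
    have hd : (d : ℝ) ≠ 0 := by exact_mod_cast h.dim_pos.ne'
    have hdet := (posDef_of_isUnit h.posSemidef hn).det_pos
    have h3 := ((h2.rpow_const (p := 1 / (d : ℝ)) (Or.inl (by simpa using hdet.ne'))).fun_div h1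
      (by simpa using hm.ne')).sqrt (by simpa [radicand] using hr.ne')
    refine h3.congr_deriv ?_
    simp only [zero_smul, add_zero]
    change _ / (2 * √(radicand .RR M)) = _
    rw [← hC', gradPairing_RR h, outerDeriv]
    -- The derivative just computed is that of the root of `det ^ (1/d) / μᵀμ`, while `A_RR` is the
    -- gradient of `det / (μᵀμ) ^ d`. Expressing the determinant and its powers through `C` and
    -- `μᵀμ` reconciles the two.
    have hp : M.cov.det ^ (1 / (d : ℝ)) = mcv .RR M ^ 2 * (M.mean ⬝ᵥ M.mean) := by
      rw [hsq, radicand, div_mul_cancel₀ _ hm.ne']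
    have hp1 : M.cov.det ^ (1 / (d : ℝ) - 1) =
        mcv .RR M ^ 2 * (M.mean ⬝ᵥ M.mean) / M.cov.det := by
      rw [Real.rpow_sub hdet, Real.rpow_one, hp]
    have hpd : M.cov.det = (mcv .RR M ^ d) ^ 2 * (M.mean ⬝ᵥ M.mean) ^ d := by
      rw [← pow_mul, mul_comm d 2, pow_mul, ← mul_pow, ← hp, ← Real.rpow_natCast,
        ← Real.rpow_mul hdet.le, one_div_mul_cancel hd, Real.rpow_one]
    have hz : mcv .RR M ^ (1 - 2 * (d : ℤ)) = mcv .RR M / (mcv .RR M ^ d) ^ 2 := by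
      rw [zpow_sub₀ hC, zpow_one, mul_comm, zpow_mul]
      norm_cast
    rw [hp1, hp, hz]
    have hCd : mcv .RR M ^ d ≠ 0 := pow_ne_zero _ hC
    have hmd : (M.mean ⬝ᵥ M.mean) ^ d ≠ 0 := pow_ne_zero _ hm.ne'
    rw [pow_succ (M.mean ⬝ᵥ M.mean) d]
    have hdet0 := hdet.ne'
    generalize M.cov.det = D at *
    subst hpd
    field_simp
    ring
  | VV =>
    have h3 := ((hasDerivAt_trace_line M.cov (Matrix.of V)).fun_div h1
      (by simpa using hm.ne')).sqrt (by simpa [radicand] using hr.ne')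
    refine h3.congr_deriv ?_
    simp only [zero_smul, add_zero]
    change _ / (2 * √(radicand .VV M)) = _
    rw [← hC', gradPairing_VV, outerDeriv]
    field_simp
    ring
  | VN =>
    have hq := PosDef.quadraticForm_pos (posDef_of_isUnit h.posSemidef hn).inv h.mean_ne
    have h3 := ((hasDerivAt_inv_quadraticForm_line hn h.cov_transpose (Matrix.of V)
      M.mean u).fun_inv (by simpa using hq.ne')).sqrt
      (by simpa [radicand] using hr.ne')
    simp only [mcv, one_div]
    refine h3.congr_deriv ?_
    simp only [zero_smul, add_zero]
    have h5 : √(M.mean ⬝ᵥ M.cov⁻¹ *ᵥ M.mean)⁻¹ = mcv .VN M := by simp [mcv]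
    have h6 : (M.mean ⬝ᵥ M.cov⁻¹ *ᵥ M.mean) = (mcv .VN M ^ 2)⁻¹ := by
      rw [hsq]; simp [radicand]
    rw [h5, h6, gradPairing_VN h, outerDeriv]
    field_simp
  | AZ =>
    have h3 := ((hasDerivAt_quadraticForm_line h.cov_transpose (Matrix.of V) M.mean u).fun_div
      (h1.fun_pow 2) (by simpa using hm.ne')).sqrt (by simpa [radicand] using hr.ne')
    refine h3.congr_deriv ?_
    simp only [zero_smul, add_zero]
    change _ / (2 * √(radicand .AZ M)) = _
    rw [← hC', gradPairing_AZ, outerDeriv]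
    field_simp
    ring

end Regular

/-! ### Total derivative of the effects and the variance formula. -/

section Differentiability

variable {d : ℕ}

theorem differentiableAt_det {E : Type*} [NormedAddCommGroup E] [NormedSpace ℝ E] {m : Type*}
    [Fintype m] [DecidableEq m] {A : E → Matrix m m ℝ} {x : E}
    (hA : ∀ i j, DifferentiableAt ℝ (fun y => A y i j) x) :
    DifferentiableAt ℝ (fun y => (A y).det) x := by
  simp only [Matrix.det_apply]
  refine DifferentiableAt.fun_sum fun σ _ => ?_
  exact (HasFDerivAt.finsetProd fun i _ => (hA _ _).hasFDerivAt).differentiableAt.const_smul _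

theorem differentiableAt_real_div {E : Type*} [NormedAddCommGroup E] [NormedSpace ℝ E]
    {f g : E → ℝ} {x : E} (hf : DifferentiableAt ℝ f x) (hg : DifferentiableAt ℝ g x)
    (h0 : g x ≠ 0) : DifferentiableAt ℝ (fun y => f y / g y) x := by
  simp only [div_eq_mul_inv]
  exact hf.mul (hg.inv h0)

theorem differentiableAt_inv_apply {E : Type*} [NormedAddCommGroup E] [NormedSpace ℝ E]
    {m : Type*} [Fintype m] [DecidableEq m] {A : E → Matrix m m ℝ} {x : E}
    (hA : ∀ i j, DifferentiableAt ℝ (fun y => A y i j) x) (hx : IsUnit (A x)) (a b : m) :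
    DifferentiableAt ℝ (fun y => (A y)⁻¹ a b) x := by
  have hdet : (A x).det ≠ 0 := ((Matrix.isUnit_iff_isUnit_det _).1 hx).ne_zero
  simp only [Matrix.inv_def, Ring.inverse_eq_inv', Matrix.smul_apply, Matrix.adjugate_apply,
    smul_eq_mul]
  refine ((differentiableAt_det hA).inv hdet).mul (differentiableAt_det fun i j => ?_)
  by_cases h : i = b
  · subst h
    simp
  · simpa [Matrix.updateRow_ne h] using hA i j

theorem differentiableAt_mcvFun {v : Variant} {M : Moments d} (h : Regular v M) :
    DifferentiableAt ℝ (mcvFun v) (M.mean, M.cov) := by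
  have hr := h.radicand_pos
  have hm := h.mean_pos
  have hn := h.nondegenerate
  have hmean : DifferentiableAt ℝ (fun x : (Fin d → ℝ) × (Fin d → Fin d → ℝ) => x.1 ⬝ᵥ x.1)
      (M.mean, M.cov) := by
    simp only [dotProduct]
    fun_prop
  have hcov : ∀ a b, DifferentiableAt ℝ
      (fun x : (Fin d → ℝ) × (Fin d → Fin d → ℝ) => Matrix.of x.2 a b) (M.mean, M.cov) := by
    intro a b
    simp only [Matrix.of_apply]
    fun_prop
  cases v with
  | RR =>
    have hdet := (posDef_of_isUnit h.posSemidef hn).det_pos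
    have h1 := differentiableAt_real_div ((differentiableAt_det hcov).rpow_const
      (p := 1 / (d : ℝ)) (Or.inl (by exact hdet.ne'))) hmean hm.ne'
    exact h1.sqrt (by exact hr.ne')
  | VV =>
    have ht : DifferentiableAt ℝ
        (fun x : (Fin d → ℝ) × (Fin d → Fin d → ℝ) => (Matrix.of x.2).trace) (M.mean, M.cov) := by
      simp only [Matrix.trace, Matrix.diag]
      exact DifferentiableAt.fun_sum fun i _ => hcov i i
    have h1 := differentiableAt_real_div ht hmean hm.ne'
    exact h1.sqrt (by exact hr.ne')
  | VN =>
    have hq := PosDef.quadraticForm_pos (posDef_of_isUnit h.posSemidef hn).inv h.mean_ne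
    have ht : DifferentiableAt ℝ (fun x : (Fin d → ℝ) × (Fin d → Fin d → ℝ) =>
        x.1 ⬝ᵥ (Matrix.of x.2)⁻¹ *ᵥ x.1) (M.mean, M.cov) := by
      simp only [dotProduct, Matrix.mulVec]
      refine DifferentiableAt.fun_sum fun i _ => ?_
      refine DifferentiableAt.mul (by fun_prop) (DifferentiableAt.fun_sum fun j _ => ?_)
      exact (differentiableAt_inv_apply hcov hn i j).mul (by fun_prop)
    have h1 := differentiableAt_real_div (differentiableAt_const (1 : ℝ)) ht hq.ne'
    exact h1.sqrt (by exact hr.ne')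
  | AZ =>
    have ht : DifferentiableAt ℝ (fun x : (Fin d → ℝ) × (Fin d → Fin d → ℝ) =>
        x.1 ⬝ᵥ Matrix.of x.2 *ᵥ x.1) (M.mean, M.cov) := by
      simp only [dotProduct, Matrix.mulVec]
      refine DifferentiableAt.fun_sum fun i _ => ?_
      refine DifferentiableAt.mul (by fun_prop) (DifferentiableAt.fun_sum fun j _ => ?_)
      exact (hcov i j).mul (by fun_prop)
    have h1 := differentiableAt_real_div ht (hmean.fun_pow 2) (pow_ne_zero 2 hm.ne')
    exact h1.sqrt (by exact hr.ne')

/-- The total derivative of the inner function. -/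
def gradCLM (v : Variant) (M : Moments d) : ((Fin d → ℝ) × (Fin d → Fin d → ℝ)) →L[ℝ] ℝ :=
  LinearMap.toContinuousLinearMap
    { toFun := fun x => gradPairing v M x.1 x.2
      map_add' := by
        intro x y
        simp only [gradPairing, Prod.fst_add, Prod.snd_add, Pi.add_apply, dotProduct_add, mul_add,
          Finset.sum_add_distrib]
        ring
      map_smul' := by
        intro c x
        simp only [gradPairing, Prod.smul_fst, Prod.smul_snd, Pi.smul_apply, dotProduct_smul,
          smul_eq_mul, mul_add, Finset.mul_sum, RingHom.id_apply]
        congr 1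
        exact Finset.sum_congr rfl fun i _ => Finset.sum_congr rfl fun j _ => by ring }

theorem hasFDerivAt_mcvFun {v : Variant} {M : Moments d} (h : Regular v M) :
    HasFDerivAt (mcvFun v) (outerDeriv v M • gradCLM v M) (M.mean, M.cov) :=
  hasFDerivAt_of_hasDerivAt_lines (differentiableAt_mcvFun h)
    fun w => hasDerivAt_mcv_line h w.1 w.2

/-- The effect as a function of mean vector and covariance matrix. -/
def effectFun (e : Effect) (v : Variant) (x : (Fin d → ℝ) × (Fin d → Fin d → ℝ)) : ℝ :=
  effect e v ⟨x.1, Matrix.of x.2, 0, 0⟩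

theorem effectFun_eq (e : Effect) (v : Variant) (M : Moments d) :
    effectFun e v (M.mean, M.cov) = effect e v M := by
  cases e <;> cases v <;> rfl

/-- The scalar factor in the derivative of an effect. -/
def effectScale (e : Effect) (v : Variant) (M : Moments d) : ℝ :=
  match e with
  | .C => outerDeriv v M
  | .B => -(mcv v M ^ 2)⁻¹ * outerDeriv v M

theorem hasFDerivAt_effectFun (e : Effect) {v : Variant} {M : Moments d} (h : Regular v M) :
    HasFDerivAt (effectFun e v) (effectScale e v M • gradCLM v M) (M.mean, M.cov) := by
  cases e with
  | C => exact hasFDerivAt_mcvFun h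
  | B =>
    have h0 : mcvFun v (M.mean, M.cov) ≠ 0 := by
      rw [mcvFun_eq]
      exact h.mcv_pos.ne'
    have h1 := (hasDerivAt_inv h0).comp_hasFDerivAt _ (hasFDerivAt_mcvFun h)
    have h2 : effectFun .B v = (fun y => y⁻¹) ∘ mcvFun (d := d) v := by
      funext x
      simp [effectFun, effect, mcvFun]
    rw [h2]
    refine h1.congr_fderiv ?_
    rw [mcvFun_eq, smul_smul]
    rfl

/-- The quadratic form `A_v (Σ, Ψ₃ᵀ; Ψ₃, Ψ₄) A_vᵀ`. -/
def gradQuadratic (v : Variant) (M : Moments d) : ℝ :=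
  gradVec v M ⬝ᵥ Matrix.fromBlocks M.cov M.psi3ᵀ M.psi3 M.psi4 *ᵥ gradVec v M

/-- The factor `C⁻⁴` in the variance of `B` is the square of the derivative `-C⁻²` of the
reciprocal. -/
theorem varEffect_eq (e : Effect) {v : Variant} {M : Moments d} (h : Regular v M) :
    varEffect e v M = effectScale e v M ^ 2 * gradQuadratic v M := by
  have hC := h.mcv_pos.ne'
  cases e with
  | C => simp only [varEffect, effectScale, outerDeriv_sq h, varC, gradQuadratic]
  | B =>
    simp only [varEffect, effectScale, mul_pow, outerDeriv_sq h, varC, gradQuadratic, zpow_neg]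
    norm_cast
    field_simp

theorem effectScale_ne_zero (e : Effect) {v : Variant} {M : Moments d} (h : Regular v M) :
    effectScale e v M ≠ 0 := by
  have hC := h.mcv_pos.ne'
  have ho := outerDeriv_ne_zero h
  cases e with
  | C => exact ho
  | B => simp only [effectScale]; exact mul_ne_zero (by simpa using hC) ho

/-! ### Continuity of the variance formula at regular moments. -/

section Continuity

variable {X : Type*} {l : Filter X} {N : X → Moments d} {v : Variant} {M : Moments d}

/-- This and the following limits are taken along an arbitrary filter, so that they apply verbatim
to convergence in probability. -/
theorem tendsto_mcv (h : Regular v M) (hmean : Tendsto (fun p => (N p).mean) l (𝓝 M.mean))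
    (hcov : Tendsto (fun p => (N p).cov) l (𝓝 M.cov)) :
    Tendsto (fun p => mcv v (N p)) l (𝓝 (mcv v M)) := by
  have h1 := (differentiableAt_mcvFun h).continuousAt.tendsto.comp (hmean.prodMk_nhds hcov)
  rw [mcvFun_eq] at h1
  exact h1.congr fun p => mcvFun_eq v (N p)

theorem tendsto_vecMul_matrix {m n : Type*} [Fintype m] {x : X → m → ℝ} {a : m → ℝ}
    {A : X → Matrix m n ℝ} {B : Matrix m n ℝ} (hx : Tendsto x l (𝓝 a))
    (hA : Tendsto A l (𝓝 B)) : Tendsto (fun p => x p ᵥ* A p) l (𝓝 (a ᵥ* B)) := by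
  have h : Continuous fun q : (m → ℝ) × Matrix m n ℝ => q.1 ᵥ* q.2 :=
    continuous_fst.matrix_vecMul continuous_snd
  exact (h.tendsto (a, B)).comp (hx.prodMk_nhds hA)

theorem tendsto_quadraticForm {m : Type*} [Fintype m] {x : X → m → ℝ} {a : m → ℝ}
    {A : X → Matrix m m ℝ} {B : Matrix m m ℝ} (hx : Tendsto x l (𝓝 a))
    (hA : Tendsto A l (𝓝 B)) : Tendsto (fun p => x p ⬝ᵥ A p *ᵥ x p) l (𝓝 (a ⬝ᵥ B *ᵥ a)) := by
  have h : Continuous fun q : (m → ℝ) × Matrix m m ℝ => q.1 ⬝ᵥ q.2 *ᵥ q.1 :=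
    continuous_fst.dotProduct (continuous_snd.matrix_mulVec continuous_fst)
  exact (h.tendsto (a, B)).comp (hx.prodMk_nhds hA)

theorem tendsto_det {A : X → Matrix (Fin d) (Fin d) ℝ} {B : Matrix (Fin d) (Fin d) ℝ}
    (hA : Tendsto A l (𝓝 B)) : Tendsto (fun p => (A p).det) l (𝓝 B.det) :=
  (continuous_id.matrix_det.tendsto B).comp hA

theorem tendsto_trace {A : X → Matrix (Fin d) (Fin d) ℝ} {B : Matrix (Fin d) (Fin d) ℝ}
    (hA : Tendsto A l (𝓝 B)) : Tendsto (fun p => (A p).trace) l (𝓝 B.trace) :=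
  (continuous_id.matrix_trace.tendsto B).comp hA

theorem tendsto_matrix_inv {A : X → Matrix (Fin d) (Fin d) ℝ} {B : Matrix (Fin d) (Fin d) ℝ}
    (hA : Tendsto A l (𝓝 B)) (hB : IsUnit B) : Tendsto (fun p => (A p)⁻¹) l (𝓝 B⁻¹) :=
  (continuousAt_matrix_inv (A := id) continuousAt_id hB).tendsto.comp hA

theorem tendsto_gradCov (h : Regular v M) (hmean : Tendsto (fun p => (N p).mean) l (𝓝 M.mean))
    (hcov : Tendsto (fun p => (N p).cov) l (𝓝 M.cov)) :
    Tendsto (fun p => gradCov v (N p)) l (𝓝 (gradCov v M)) := by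
  have hm := h.mean_pos.ne'
  have hn := h.nondegenerate
  have hmm := tendsto_dotProduct hmean hmean
  rw [tendsto_pi_nhds]
  intro q
  cases v with
  | RR =>
    have hi := tendsto_pi_nhds.1 (tendsto_pi_nhds.1 (tendsto_matrix_inv hcov hn) q.1) q.2
    exact ((tendsto_det hcov).mul hi).div (hmm.pow d) (pow_ne_zero _ hm)
  | VV => exact tendsto_const_nhds.div hmm hm
  | VN =>
    have hi := tendsto_vecMul_matrix hmean (tendsto_matrix_inv hcov hn)
    exact ((tendsto_pi_nhds.1 hi q.1).mul (tendsto_pi_nhds.1 hi q.2)).neg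
  | AZ =>
    exact ((tendsto_pi_nhds.1 hmean q.1).mul (tendsto_pi_nhds.1 hmean q.2)).div (hmm.pow 2)
      (pow_ne_zero _ hm)

theorem tendsto_gradMean (h : Regular v M) (hmean : Tendsto (fun p => (N p).mean) l (𝓝 M.mean))
    (hcov : Tendsto (fun p => (N p).cov) l (𝓝 M.cov)) :
    Tendsto (fun p => gradMean v (N p)) l (𝓝 (gradMean v M)) := by
  have hm := h.mean_pos.ne'
  have hn := h.nondegenerate
  have hmm := tendsto_dotProduct hmean hmean
  rw [tendsto_pi_nhds]
  intro s
  have hs := tendsto_pi_nhds.1 hmean s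
  cases v with
  | RR =>
    exact (tendsto_const_nhds.mul (tendsto_det hcov)).mul
      (hs.div (hmm.pow (d + 1)) (pow_ne_zero _ hm))
  | VV =>
    exact (tendsto_const_nhds.mul (tendsto_trace hcov)).mul
      (hs.div (hmm.pow 2) (pow_ne_zero _ hm))
  | VN =>
    have hi := tendsto_vecMul_matrix hmean (tendsto_matrix_inv hcov hn)
    exact tendsto_const_nhds.mul (tendsto_pi_nhds.1 hi s)
  | AZ =>
    have hi := tendsto_vecMul_matrix hmean hcov
    exact ((tendsto_const_nhds.mul (tendsto_quadraticForm hmean hcov)).mul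
      (hs.div (hmm.pow 3) (pow_ne_zero _ hm))).add
      (tendsto_const_nhds.mul ((tendsto_pi_nhds.1 hi s).div (hmm.pow 2) (pow_ne_zero _ hm)))

theorem continuous_dTilde : Continuous (dTilde : (Fin d → ℝ) → _) := by
  refine continuous_pi fun p => continuous_pi fun s => ?_
  simp only [dTilde, Matrix.of_apply]
  split_ifs <;> fun_prop

theorem tendsto_gradVec (h : Regular v M) (hmean : Tendsto (fun p => (N p).mean) l (𝓝 M.mean))
    (hcov : Tendsto (fun p => (N p).cov) l (𝓝 M.cov)) :
    Tendsto (fun p => gradVec v (N p)) l (𝓝 (gradVec v M)) := by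
  have h1 := tendsto_gradCov h hmean hcov
  have h2 := (tendsto_gradMean h hmean hcov).add
    (tendsto_vecMul_matrix h1 ((continuous_dTilde.tendsto _).comp hmean))
  rw [tendsto_pi_nhds]
  rintro (s | q)
  · exact tendsto_pi_nhds.1 h2 s
  · exact tendsto_pi_nhds.1 h1 q

theorem tendsto_scaleFactor (h : Regular v M)
    (hmean : Tendsto (fun p => (N p).mean) l (𝓝 M.mean))
    (hcov : Tendsto (fun p => (N p).cov) l (𝓝 M.cov)) :
    Tendsto (fun p => scaleFactor v (N p)) l (𝓝 (scaleFactor v M)) := by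
  have hC := tendsto_mcv h hmean hcov
  have hC0 := h.mcv_pos.ne'
  cases v with
  | RR => exact tendsto_const_nhds.mul (hC.zpow₀ _ (Or.inl hC0))
  | VV => exact hC.zpow₀ _ (Or.inl hC0)
  | VN => exact hC.pow 6
  | AZ => exact hC.zpow₀ _ (Or.inl hC0)

theorem tendsto_varEffect (e : Effect) (h : Regular v M)
    (hmean : Tendsto (fun p => (N p).mean) l (𝓝 M.mean))
    (hcov : Tendsto (fun p => (N p).cov) l (𝓝 M.cov))
    (hpsi3 : Tendsto (fun p => (N p).psi3) l (𝓝 M.psi3))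
    (hpsi4 : Tendsto (fun p => (N p).psi4) l (𝓝 M.psi4)) :
    Tendsto (fun p => varEffect e v (N p)) l (𝓝 (varEffect e v M)) := by
  have hblocks : Tendsto (fun p => Matrix.fromBlocks (N p).cov (N p).psi3ᵀ (N p).psi3 (N p).psi4) l
      (𝓝 (Matrix.fromBlocks M.cov M.psi3ᵀ M.psi3 M.psi4)) := by
    refine tendsto_pi_nhds.2 fun i => tendsto_pi_nhds.2 fun j => ?_
    rcases i with i | i <;> rcases j with j | j
    · exact tendsto_pi_nhds.1 (tendsto_pi_nhds.1 hcov i) j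
    · exact tendsto_pi_nhds.1 (tendsto_pi_nhds.1 hpsi3 j) i
    · exact tendsto_pi_nhds.1 (tendsto_pi_nhds.1 hpsi3 i) j
    · exact tendsto_pi_nhds.1 (tendsto_pi_nhds.1 hpsi4 i) j
  have hvar : Tendsto (fun p => varC v (N p)) l (𝓝 (varC v M)) :=
    ((tendsto_scaleFactor h hmean hcov).div_const 4).mul
      (tendsto_quadraticForm (tendsto_gradVec h hmean hcov) hblocks)
  cases e with
  | C => exact hvar
  | B => exact ((tendsto_mcv h hmean hcov).zpow₀ _ (Or.inl h.mcv_pos.ne')).mul hvar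

end Continuity

end Differentiability

/-! ### The asymptotic variance as the variance of the influence function, and its positivity. -/

section PopulationVariance

variable {d : ℕ}

theorem variance_dotProduct {Ω ι : Type*} [Fintype ι] [MeasurableSpace Ω] {P : Measure Ω}
    [IsProbabilityMeasure P] {Z : ι → Ω → ℝ} (hZ : ∀ i, MemLp (Z i) 2 P) (a : ι → ℝ) :
    a ⬝ᵥ (Matrix.of fun i j => covariance (Z i) (Z j) P) *ᵥ a
      = variance (fun ω => a ⬝ᵥ fun i => Z i ω) P := by
  simp only [dotProduct, Matrix.mulVec, Matrix.of_apply]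
  rw [variance_fun_sum fun i => (hZ i).const_mul (a i)]
  refine Finset.sum_congr rfl fun i _ => ?_
  rw [Finset.mul_sum]
  refine Finset.sum_congr rfl fun j _ => ?_
  rw [covariance_const_mul_left, covariance_const_mul_right]
  ring

theorem memLp_four_of_integrable_pow {ν : Measure (Fin d → ℝ)} {l : Fin d}
    (h : Integrable (fun x => x l ^ 4) ν) : MemLp (fun x : Fin d → ℝ => x l) 4 ν := by
  have hm : AEStronglyMeasurable (fun x : Fin d → ℝ => x l) ν :=
    (measurable_pi_apply l).aestronglyMeasurable
  rw [← integrable_norm_rpow_iff hm (by simp) (by simp)]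
  refine h.congr (ae_of_all _ fun x => ?_)
  have : ENNReal.toReal 4 = ((4 : ℕ) : ℝ) := by simp
  simp only [this, Real.rpow_natCast, Real.norm_eq_abs]
  exact ((by decide : Even 4).pow_abs _).symm

/-- The vector of all coordinates and all products of two coordinates. -/
def momentVec (x : Fin d → ℝ) : Fin d ⊕ (Fin d × Fin d) → ℝ :=
  Sum.elim x fun p => x p.1 * x p.2

theorem measurable_momentVec_apply (c : Fin d ⊕ (Fin d × Fin d)) :
    Measurable fun x : Fin d → ℝ => momentVec x c := by
  rcases c with s | p <;> simp only [momentVec, Sum.elim_inl, Sum.elim_inr] <;> fun_prop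

theorem memLp_momentVec {ν : Measure (Fin d → ℝ)} [IsProbabilityMeasure ν]
    (h : ∀ l, Integrable (fun x => x l ^ 4) ν) (c : Fin d ⊕ (Fin d × Fin d)) :
    MemLp (fun x : Fin d → ℝ => momentVec x c) 2 ν := by
  have h4 := fun l => memLp_four_of_integrable_pow (h l)
  rcases c with s | p
  · exact (h4 s).mono_exponent (by norm_num)
  -- Hölder with `1/4 + 1/4 = 1/2`: a product of two coordinates is square integrable under fourth
  -- moments.
  · have : ENNReal.HolderTriple 4 4 2 := ⟨by
      have : (4 : ENNReal) = 2 * 2 := by norm_num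
      rw [this, ENNReal.mul_inv (by simp) (by simp), ← two_mul, ← mul_assoc,
        ENNReal.mul_inv_cancel (by simp) (by simp), one_mul]⟩
    exact (h4 p.2).mul (h4 p.1)

theorem fromBlocks_populationMoments {ν : Measure (Fin d → ℝ)} [IsProbabilityMeasure ν]
    (h : ∀ l, Integrable (fun x => x l ^ 4) ν) :
    Matrix.fromBlocks (populationMoments ν).cov (populationMoments ν).psi3ᵀ
      (populationMoments ν).psi3 (populationMoments ν).psi4
    = Matrix.of fun c c' =>
        covariance (fun x => momentVec x c) (fun x => momentVec x c') ν := by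
  have hL := memLp_momentVec h
  ext (s | p) (s' | p')
  · rfl
  · simp only [Matrix.fromBlocks_apply₁₂, Matrix.transpose_apply, Matrix.of_apply]
    rw [covariance_comm, covariance_eq_sub (hL _) (hL _)]
    rfl
  · simp only [Matrix.fromBlocks_apply₂₁, Matrix.of_apply]
    rw [covariance_eq_sub (hL _) (hL _)]
    rfl
  · simp only [Matrix.fromBlocks_apply₂₂, Matrix.of_apply]
    rw [covariance_eq_sub (hL _) (hL _)]
    simp only [populationMoments, momentVec, Matrix.of_apply, Pi.mul_apply, Sum.elim_inr,
      ← mul_assoc]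

theorem gradQuadratic_populationMoments (v : Variant) {ν : Measure (Fin d → ℝ)}
    [IsProbabilityMeasure ν] (h : ∀ l, Integrable (fun x => x l ^ 4) ν) :
    gradQuadratic v (populationMoments ν) =
      variance (fun x => gradVec v (populationMoments ν) ⬝ᵥ momentVec x) ν := by
  rw [gradQuadratic, fromBlocks_populationMoments h, variance_dotProduct (memLp_momentVec h)]

theorem regular_of_wellDefined {v : Variant} {ν : Measure (Fin d → ℝ)} [IsProbabilityMeasure ν]
    (h : WellDefined v ν) : Regular v (populationMoments ν) where
  mean_ne := h.1
  posSemidef := by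
    refine Matrix.PosSemidef.of_dotProduct_mulVec_nonneg ?_ fun x => ?_
    · ext a b
      simp [populationMoments, covariance_comm]
    · have := variance_dotProduct (P := ν) (Z := fun l x => x l)
        (fun l => memLp_momentVec h.2.1 (Sum.inl l)) x
      simp only [star_trivial]
      exact this ▸ variance_nonneg _ _
  nondegenerate := h.2.2

/-- The first-order expansion of the estimator at a single observation. -/
def influence (v : Variant) (M : Moments d) (x : Fin d → ℝ) : ℝ :=
  gradPairing v M (x - M.mean) fun a b => (x a - M.mean a) * (x b - M.mean b) - M.cov a b

/-- At a diagonal position `(a, a)` both indicators apply, which is the separate term with factor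
two in the definition. The result is minus the linear part of the centring of `x xᵀ` at `m`. -/
theorem dTilde_mulVec (m x : Fin d → ℝ) (p : Fin d × Fin d) :
    (dTilde m *ᵥ x) p = -(m p.2 * x p.1 + m p.1 * x p.2) := by
  have h : ∀ s, dTilde m p s = -((if s = p.1 then m p.2 else 0) + if s = p.2 then m p.1 else 0) := by
    intro s
    obtain ⟨a, b⟩ := p
    simp only [dTilde, Matrix.of_apply]
    by_cases h1 : s = a
    · by_cases h2 : s = b
      · subst h1; subst h2; simp; ring
      · subst h1; simp [h2, Ne.symm h2]
    · by_cases h2 : s = b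
      · subst h2; simp [h1]
      · simp [h1, h2, Ne.symm h2]
  simp only [Matrix.mulVec, dotProduct, h, neg_mul, add_mul, ite_mul, zero_mul,
    Finset.sum_neg_distrib, Finset.sum_add_distrib, Finset.sum_ite_eq', Finset.mem_univ, if_true]

theorem gradVec_dotProduct_momentVec (v : Variant) (M : Moments d) (x : Fin d → ℝ) :
    gradVec v M ⬝ᵥ momentVec x = gradMean v M ⬝ᵥ x
      + ∑ a, ∑ b, gradCov v M (a, b) *
        (x a * x b - (M.mean b * x a + M.mean a * x b)) := by
  have h1 : gradVec v M ⬝ᵥ momentVec x =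
      (gradMean v M + gradCov v M ᵥ* dTilde M.mean) ⬝ᵥ x
        + ∑ p : Fin d × Fin d, gradCov v M p * (x p.1 * x p.2) := by
    simp only [gradVec, momentVec, dotProduct, Fintype.sum_sum_type, Sum.elim_inl, Sum.elim_inr]
  rw [h1, add_dotProduct, ← Matrix.dotProduct_mulVec, add_assoc, ← Fintype.sum_prod_type']
  congr 1
  simp only [dotProduct, dTilde_mulVec]
  rw [← Finset.sum_add_distrib]
  exact Finset.sum_congr rfl fun p _ => by ring

/-- Expanding `(x - μ)(x - μ)ᵀ` gives `x xᵀ`, a linear part and a constant. The `D̃(μ)` term in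
`A_v` is exactly that linear part, so the two sides differ by a constant and have equal variance. -/
theorem influence_eq (v : Variant) (M : Moments d) (x : Fin d → ℝ) :
    influence v M x = gradVec v M ⬝ᵥ momentVec x + influence v M 0 := by
  rw [gradVec_dotProduct_momentVec]
  simp only [influence, gradPairing, dotProduct_sub, Pi.zero_apply, dotProduct_zero]
  rw [show ∀ a b c e f : ℝ, a + b + (c - e + f) = (a - e) + (b + f) + c from
    fun a b c e f => by ring, add_zero, ← Finset.sum_add_distrib]
  congr 1
  refine Finset.sum_congr rfl fun a _ => ?_
  rw [← Finset.sum_add_distrib]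
  exact Finset.sum_congr rfl fun b _ => by ring

theorem memLp_influence (v : Variant) (M : Moments d) {ν : Measure (Fin d → ℝ)}
    [IsProbabilityMeasure ν] (h : ∀ l, Integrable (fun x => x l ^ 4) ν) :
    MemLp (influence v M) 2 ν := by
  have h1 : influence v M = fun x => gradVec v M ⬝ᵥ momentVec x + influence v M 0 :=
    funext (influence_eq v M)
  rw [h1]
  refine MemLp.add ?_ (memLp_const _)
  simp only [dotProduct]
  exact memLp_finsetSum _ fun c _ => (memLp_momentVec h c).const_mul _

theorem measurable_gradVec_momentVec (v : Variant) (M : Moments d) :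
    Measurable fun x : Fin d → ℝ => gradVec v M ⬝ᵥ momentVec x := by
  simp only [dotProduct]
  exact Finset.measurable_sum _ fun c _ => (measurable_momentVec_apply c).const_mul _

theorem measurable_influence (v : Variant) (M : Moments d) : Measurable (influence v M) := by
  have h1 : influence v M = fun x => gradVec v M ⬝ᵥ momentVec x + influence v M 0 :=
    funext (influence_eq v M)
  rw [h1]
  exact (measurable_gradVec_momentVec v M).add_const _

theorem variance_influence (v : Variant) {ν : Measure (Fin d → ℝ)}
    [IsProbabilityMeasure ν] (h : ∀ l, Integrable (fun x => x l ^ 4) ν) :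
    variance (influence v (populationMoments ν)) ν = gradQuadratic v (populationMoments ν) := by
  have h1 : influence v (populationMoments ν) = fun x =>
      gradVec v (populationMoments ν) ⬝ᵥ momentVec x + influence v (populationMoments ν) 0 :=
    funext (influence_eq v _)
  rw [gradQuadratic_populationMoments v h, h1, variance_add_const]
  exact (measurable_gradVec_momentVec v _).aestronglyMeasurable

theorem exists_roots_of_quadratic {a : ℝ} (ha : a ≠ 0) (b c : ℝ) :
    ∃ r s : ℝ, ∀ y, a * y ^ 2 + b * y + c = 0 → y = r ∨ y = s := by
  by_cases h : ∃ r, a * r ^ 2 + b * r + c = 0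
  · obtain ⟨r, hr⟩ := h
    -- The second root by Vieta.
    refine ⟨r, -b / a - r, fun y hy => ?_⟩
    have h1 : (y - r) * (a * (y + r) + b) = 0 := by linear_combination hy - hr
    rcases mul_eq_zero.1 h1 with h2 | h2
    · exact Or.inl (sub_eq_zero.1 h2)
    · right
      field_simp
      linear_combination h2
  · push Not at h
    exact ⟨0, 0, fun y hy => absurd hy (h y)⟩

theorem gradVec_momentVec_line (v : Variant) (M : Moments d) (z : Fin d → ℝ) (l : Fin d) :
    ∃ b c : ℝ, ∀ y : ℝ, gradVec v M ⬝ᵥ momentVec (z + y • Pi.single l 1) =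
      gradCov v M (l, l) * y ^ 2 + b * y + c := by
  set e : Fin d → ℝ := Pi.single l 1 with he
  refine ⟨gradMean v M ⬝ᵥ e + ∑ a, ∑ b, gradCov v M (a, b) *
      (z a * e b + e a * z b - (M.mean b * e a + M.mean a * e b)),
    gradMean v M ⬝ᵥ z + ∑ a, ∑ b, gradCov v M (a, b) *
      (z a * z b - (M.mean b * z a + M.mean a * z b)), fun y => ?_⟩
  have h1 : ∑ a, ∑ b, gradCov v M (a, b) * (e a * e b) = gradCov v M (l, l) := by
    simp [he, Pi.single_apply]
  rw [gradVec_dotProduct_momentVec, ← h1, dotProduct_add, dotProduct_smul, smul_eq_mul]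
  have h2 : ∑ a, ∑ b, gradCov v M (a, b) * ((z + y • e) a * (z + y • e) b -
      (M.mean b * (z + y • e) a + M.mean a * (z + y • e) b)) =
      (∑ a, ∑ b, gradCov v M (a, b) * (e a * e b)) * y ^ 2
      + (∑ a, ∑ b, gradCov v M (a, b) *
      (z a * e b + e a * z b - (M.mean b * e a + M.mean a * e b))) * y
      + ∑ a, ∑ b, gradCov v M (a, b) *
      (z a * z b - (M.mean b * z a + M.mean a * z b)) := by
    simp only [Finset.sum_mul, ← Finset.sum_add_distrib]
    refine Finset.sum_congr rfl fun a _ => Finset.sum_congr rfl fun b _ => ?_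
    simp only [Pi.add_apply, Pi.smul_apply, smul_eq_mul]
    ring
  rw [h2]
  ring

/-- Given the other coordinates, `x l` almost surely solves a quadratic equation with leading
coefficient `gradCov v M (l, l) ≠ 0`, hence takes at most two values. Disintegrating `ν` with
respect to the other coordinates makes this precise. -/
theorem isCondTwoPoint_of_ae_eq_const {v : Variant} {M : Moments d} {ν : Measure (Fin d → ℝ)}
    [IsProbabilityMeasure ν] {l : Fin d} (hl : gradCov v M (l, l) ≠ 0) {c : ℝ}
    (hc : ∀ᵐ x ∂ν, gradVec v M ⬝ᵥ momentVec x = c) : IsCondTwoPoint ν l := by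
  set glue : ({s : Fin d // s ≠ l} → ℝ) × ℝ → Fin d → ℝ :=
    fun q => (fun s => if h : s = l then 0 else q.1 ⟨s, h⟩) + q.2 • Pi.single l 1 with hglue
  have hglue_meas : Measurable glue := by
    refine measurable_pi_lambda _ fun s => ?_
    by_cases h : s = l
    · subst h
      simp only [hglue, Pi.add_apply, Pi.smul_apply, dif_pos]
      fun_prop
    · simp only [hglue, Pi.add_apply, Pi.smul_apply, dif_neg h]
      fun_prop
  have hid : ∀ x : Fin d → ℝ, glue (fun s => x s, x l) = x := by
    intro x
    funext s
    by_cases h : s = l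
    · subst h; simp [hglue]
    · simp [hglue, h]
  have hjoint : ∀ᵐ q ∂(ν.map fun x : Fin d → ℝ =>
      ((fun s : {s : Fin d // s ≠ l} => x s), x l)), gradVec v M ⬝ᵥ momentVec (glue q) = c := by
    rw [ae_map_iff (by fun_prop) ]
    · simpa only [hid] using hc
    · exact (measurable_gradVec_momentVec v M).comp hglue_meas (measurableSet_singleton c)
  -- Almost sure constancy under the joint law becomes almost sure constancy under almost every
  -- conditional law.
  rw [← compProd_map_condDistrib (measurable_pi_apply l).aemeasurable] at hjoint
  filter_upwards [Measure.ae_ae_of_ae_compProd hjoint] with y hy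
  obtain ⟨b, c', hline⟩ := gradVec_momentVec_line v M
    (fun s => if h : s = l then 0 else y ⟨s, h⟩) l
  obtain ⟨r, s, hrs⟩ := exists_roots_of_quadratic hl b (c' - c)
  refine ⟨r, s, ?_⟩
  rw [← Set.ofPred_mem_eq (s := ({r, s} : Set ℝ)ᶜ)]
  rw [ae_iff] at hy
  refine measure_mono_null (fun w hw => ?_) hy
  intro hw'
  refine hw (hrs w ?_)
  have := hline w
  simp only [hglue] at hw'
  rw [hw'] at this
  linarith

/-- For RR and VV any diagonal entry works, coming from a positive definite matrix or the identity.
For VN and AZ the diagonal consists, up to a nonzero factor, of the squares of the entries of a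
nonzero vector. -/
theorem exists_gradCov_diag_ne_zero {v : Variant} {M : Moments d} (h : Regular v M) :
    ∃ l, gradCov v M (l, l) ≠ 0 := by
  have hm := h.mean_pos
  have hn := h.nondegenerate
  cases v with
  | RR =>
    have hpd := posDef_of_isUnit h.posSemidef hn
    exact ⟨⟨0, h.dim_pos⟩, div_ne_zero (mul_ne_zero hpd.det_pos.ne' hpd.inv.diag_pos.ne')
      (pow_ne_zero _ hm.ne')⟩
  | VV => exact ⟨⟨0, h.dim_pos⟩, by simp [gradCov, hm.ne']⟩
  | VN =>
    have hne : M.mean ᵥ* M.cov⁻¹ ≠ 0 := by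
      intro h0
      have := PosDef.quadraticForm_pos (posDef_of_isUnit h.posSemidef hn).inv h.mean_ne
      rw [Matrix.dotProduct_mulVec, h0, zero_dotProduct] at this
      exact lt_irrefl _ this
    obtain ⟨l, hl⟩ := Function.ne_iff.1 hne
    exact ⟨l, neg_ne_zero.2 (mul_ne_zero hl hl)⟩
  | AZ =>
    obtain ⟨l, hl⟩ := Function.ne_iff.1 h.mean_ne
    exact ⟨l, div_ne_zero (mul_ne_zero hl hl) (pow_ne_zero _ hm.ne')⟩

theorem varEffect_pos (e : Effect) {v : Variant} {ν : Measure (Fin d → ℝ)}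
    [IsProbabilityMeasure ν] (hwd : WellDefined v ν) (htp : ∀ l, ¬ IsCondTwoPoint ν l) :
    0 < varEffect e v (populationMoments ν) := by
  have hreg := regular_of_wellDefined hwd
  rw [varEffect_eq e hreg, gradQuadratic_populationMoments v hwd.2.1]
  refine mul_pos (by have := effectScale_ne_zero e hreg; positivity) ?_
  refine lt_of_le_of_ne (variance_nonneg _ _) fun h0 => ?_
  obtain ⟨l, hl⟩ := exists_gradCov_diag_ne_zero hreg
  refine htp l (isCondTwoPoint_of_ae_eq_const hl (ae_eq_integral_of_variance_eq_zero ?_ h0.symm))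
  simp only [dotProduct]
  exact memLp_finsetSum _ fun c _ => (memLp_momentVec hwd.2.1 c).const_mul _

end PopulationVariance

/-! ### Convergence in probability as a filter, and stochastic boundedness. -/

section ProbFilter

variable {Ω : Type*} [MeasurableSpace Ω]

/-- The filter of those sets of pairs `(m, ω)` whose `m`-th section has a (outer) probability
tending to one. Convergence along it is convergence in probability. -/
def probFilter (P : Measure Ω) : Filter (ℕ × Ω) where
  sets := {S | Tendsto (fun m => P {ω | (m, ω) ∉ S}) atTop (𝓝 0)}
  univ_sets := by simp
  sets_of_superset := by
    intro S T hS hST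
    exact tendsto_of_tendsto_of_tendsto_of_le_of_le tendsto_const_nhds hS (fun _ => zero_le)
      fun m => measure_mono fun ω hω h => hω (hST h)
  inter_sets := by
    intro S T hS hT
    have h := Tendsto.add hS hT
    rw [add_zero] at h
    refine tendsto_of_tendsto_of_tendsto_of_le_of_le tendsto_const_nhds h (fun _ => zero_le)
      fun m => (measure_mono fun ω hω => ?_).trans (measure_union_le _ _)
    by_contra hcon
    simp only [Set.mem_union, Set.mem_ofPred_eq, not_or, not_not] at hcon
    exact hω hcon

variable {P : Measure Ω}

theorem eventually_probFilter {p : ℕ × Ω → Prop} :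
    (∀ᶠ q in probFilter P, p q) ↔ Tendsto (fun m => P {ω | ¬ p (m, ω)}) atTop (𝓝 0) := Iff.rfl

theorem tendsto_fst_probFilter : Tendsto Prod.fst (probFilter P) (atTop : Filter ℕ) := by
  intro S hS
  rw [mem_map]
  change Tendsto (fun m => P {ω | (m, ω) ∉ Prod.fst ⁻¹' S}) atTop (𝓝 0)
  refine Tendsto.congr' ?_ tendsto_const_nhds
  filter_upwards [hS] with m hm
  simp [hm]

theorem tendsto_probFilter_of_ae [IsFiniteMeasure P] {f : ℕ → Ω → ℝ} {c : ℝ}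
    (hf : ∀ m, AEStronglyMeasurable (f m) P)
    (h : ∀ᵐ ω ∂P, Tendsto (fun m => f m ω) atTop (𝓝 c)) :
    Tendsto (fun q : ℕ × Ω => f q.1 q.2) (probFilter P) (𝓝 c) := by
  have h1 := tendstoInMeasure_of_tendsto_ae (g := fun _ => c) hf h
  rw [tendstoInMeasure_iff_dist] at h1
  refine Metric.tendsto_nhds.2 fun ε hε => eventually_probFilter.2 ?_
  simpa only [not_lt] using h1 ε hε

theorem tendsto_real_zero_of_eventually [IsFiniteMeasure P] {p : ℕ × Ω → Prop}
    (h : ∀ᶠ q in probFilter P, p q) :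
    Tendsto (fun m => P.real {ω | ¬ p (m, ω)}) atTop (𝓝 0) := by
  have := (ENNReal.tendsto_toReal ENNReal.zero_ne_top).comp (eventually_probFilter.1 h)
  simpa [Measure.real, Function.comp_def] using this

/-- Without measurability the complement rule fails; subadditivity still gives the lower bound
needed. -/
theorem tendsto_real_one_of_eventually [IsProbabilityMeasure P] {p : ℕ × Ω → Prop}
    (h : ∀ᶠ q in probFilter P, p q) :
    Tendsto (fun m => P.real {ω | p (m, ω)}) atTop (𝓝 1) := by
  have h0 := (tendsto_real_zero_of_eventually h).const_sub 1
  rw [sub_zero] at h0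
  refine tendsto_of_tendsto_of_tendsto_of_le_of_le h0 tendsto_const_nhds (fun m => ?_)
    fun m => measureReal_le_one
  have h1 : P.real Set.univ ≤ P.real {ω | p (m, ω)} + P.real {ω | ¬ p (m, ω)} :=
    (measureReal_mono fun ω _ => em (p (m, ω))).trans (measureReal_union_le _ _)
  simp only [probReal_univ] at h1
  simp only
  linarith

theorem tendsto_real_of_eventually_iff [IsFiniteMeasure P] {p p' : ℕ × Ω → Prop} {a : ℝ}
    (h : ∀ᶠ q in probFilter P, (p q ↔ p' q))
    (hp : Tendsto (fun m => P.real {ω | p (m, ω)}) atTop (𝓝 a)) :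
    Tendsto (fun m => P.real {ω | p' (m, ω)}) atTop (𝓝 a) := by
  have h0 := tendsto_real_zero_of_eventually h
  have h1 := hp.sub h0
  have h2 := hp.add h0
  rw [sub_zero] at h1
  rw [add_zero] at h2
  refine tendsto_of_tendsto_of_tendsto_of_le_of_le h1 h2 (fun m => ?_) fun m => ?_
  · have : P.real {ω | p (m, ω)} ≤ P.real {ω | p' (m, ω)} + P.real {ω | ¬ (p (m, ω) ↔ p' (m, ω))} :=
      (measureReal_mono fun ω hω => by
        by_cases h : p' (m, ω)
        · exact Or.inl h
        · exact Or.inr fun h' => h (h'.1 hω)).trans (measureReal_union_le _ _)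
    simp only
    linarith
  · refine (measureReal_mono fun ω hω => ?_).trans (measureReal_union_le _ _)
    by_cases h : p (m, ω)
    · exact Or.inl h
    · exact Or.inr fun h' => h (h'.2 hω)

/-- Stochastic boundedness: the product with anything that vanishes in probability vanishes in
probability. -/
def StochBounded (P : Measure Ω) (Y : ℕ × Ω → ℝ) : Prop :=
  ∀ f : ℕ × Ω → ℝ, Tendsto f (probFilter P) (𝓝 0) →
    Tendsto (fun q => f q * Y q) (probFilter P) (𝓝 0)

theorem StochBounded.add {Y Z : ℕ × Ω → ℝ} (hY : StochBounded P Y) (hZ : StochBounded P Z) :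
    StochBounded P fun q => Y q + Z q := by
  intro f hf
  simpa only [mul_add, add_zero] using (hY f hf).add (hZ f hf)

theorem StochBounded.abs {Y : ℕ × Ω → ℝ} (hY : StochBounded P Y) :
    StochBounded P fun q => |Y q| := by
  intro f hf
  have h := (hY f hf).abs
  rw [abs_zero] at h
  refine squeeze_zero_norm (fun q => ?_) h
  simp [abs_mul]

theorem StochBounded.sum {ι : Type*} (s : Finset ι) {Y : ι → ℕ × Ω → ℝ}
    (hY : ∀ i ∈ s, StochBounded P (Y i)) : StochBounded P fun q => ∑ i ∈ s, Y i q := by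
  intro f hf
  simp only [Finset.mul_sum]
  simpa using tendsto_finsetSum s fun i hi => hY i hi f hf

theorem StochBounded.mul_tendsto {Y a : ℕ × Ω → ℝ} (hY : StochBounded P Y) {c : ℝ}
    (ha : Tendsto a (probFilter P) (𝓝 c)) : StochBounded P fun q => a q * Y q := by
  intro f hf
  have h := hY (fun q => f q * a q) (by simpa using hf.mul ha)
  simpa only [mul_assoc] using h

theorem StochBounded.of_tendsto {Y : ℕ × Ω → ℝ} {c : ℝ}
    (hY : Tendsto Y (probFilter P) (𝓝 c)) : StochBounded P Y := by
  intro f hf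
  simpa using hf.mul hY

theorem StochBounded.congr' {Y Z : ℕ × Ω → ℝ} (hY : StochBounded P Y)
    (h : Tendsto (fun q => Z q - Y q) (probFilter P) (𝓝 0)) : StochBounded P Z := by
  have := hY.add (StochBounded.of_tendsto h)
  simpa using this

theorem StochBounded.mono {Y Z : ℕ × Ω → ℝ} (hY : StochBounded P Y) (h : ∀ q, |Z q| ≤ |Y q|) :
    StochBounded P Z := by
  intro f hf
  have h1 := (hY f hf).abs
  rw [abs_zero] at h1
  refine squeeze_zero_norm (fun q => ?_) h1
  rw [Real.norm_eq_abs, abs_mul, abs_mul]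
  exact mul_le_mul_of_nonneg_left (h q) (abs_nonneg _)

/-- By Chebyshev's inequality `|Y|` exceeds a large level `B` only with small probability, uniformly
in `m`; below that level `|f * Y|` is at most `|f| * B`. -/
theorem StochBounded.of_second_moment [IsProbabilityMeasure P] {Y : ℕ → Ω → ℝ} {K : ℝ}
    (hY : ∀ m, MemLp (Y m) 2 P) (hK : ∀ m, ∫ ω, Y m ω ^ 2 ∂P ≤ K) :
    StochBounded P fun q => Y q.1 q.2 := by
  intro f hf
  have hK0 : 0 ≤ K := (integral_nonneg fun ω => sq_nonneg _).trans (hK 0)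
  refine Metric.tendsto_nhds.2 fun ε hε => eventually_probFilter.2 ?_
  rw [ENNReal.tendsto_nhds_zero]
  intro η hη
  -- A real bound is needed because `η` may be infinite.
  obtain ⟨η', hη', hη'2⟩ : ∃ η' : ℝ, 0 < η' ∧ ENNReal.ofReal η' ≤ η / 2 := by
    by_cases h : η = ⊤
    · exact ⟨1, one_pos, by simp [h, ENNReal.top_div_of_ne_top]⟩
    · refine ⟨(η / 2).toReal, ENNReal.toReal_pos (by simpa using hη.ne') ?_, ?_⟩
      · exact (ENNReal.div_lt_top h (by simp)).ne
      · rw [ENNReal.ofReal_toReal (ENNReal.div_lt_top h (by simp)).ne]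
  -- Chosen so that `(K + 1) / B² = η'`; the added one keeps `B` positive when `K = 0`.
  set B : ℝ := √((K + 1) / η') with hB
  have hBpos : 0 < B := Real.sqrt_pos.2 (by positivity)
  have hBsq : B ^ 2 = (K + 1) / η' := Real.sq_sqrt (by positivity)
  have h1 : ∀ m, P {ω | B ≤ |Y m ω|} ≤ η / 2 := by
    intro m
    have hmk := mul_meas_ge_le_integral_of_nonneg (μ := P) (f := fun ω => Y m ω ^ 2)
      (ae_of_all _ fun ω => sq_nonneg _) (hY m).integrable_sq (B ^ 2)
    have hset : {ω | B ^ 2 ≤ Y m ω ^ 2} = {ω | B ≤ |Y m ω|} := by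
      ext ω
      simp only [Set.mem_ofPred_eq]
      rw [sq_le_sq, abs_of_pos hBpos]
    rw [hset, hBsq] at hmk
    have h2 : P.real {ω | B ≤ |Y m ω|} ≤ η' := by
      have h3 : (K + 1) / η' * P.real {ω | B ≤ |Y m ω|} ≤ K + 1 := by linarith [hK m]
      rw [div_mul_eq_mul_div, div_le_iff₀ hη'] at h3
      exact le_of_mul_le_mul_left h3 (by positivity)
    calc P {ω | B ≤ |Y m ω|} = ENNReal.ofReal (P.real {ω | B ≤ |Y m ω|}) := by
          rw [Measure.real, ENNReal.ofReal_toReal (measure_ne_top _ _)]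
      _ ≤ _ := (ENNReal.ofReal_le_ofReal h2).trans hη'2
  have h2 := eventually_probFilter.1 (Metric.tendsto_nhds.1 hf (ε / B) (by positivity))
  rw [ENNReal.tendsto_nhds_zero] at h2
  filter_upwards [h2 (η / 2) (ENNReal.half_pos hη.ne')] with m hm
  calc P {ω | ¬ dist (f (m, ω) * Y m ω) 0 < ε}
      ≤ P ({ω | ¬ dist (f (m, ω)) 0 < ε / B} ∪ {ω | B ≤ |Y m ω|}) := by
        refine measure_mono fun ω hω => ?_
        by_contra hcon
        simp only [Set.mem_union, Set.mem_ofPred_eq, not_or, not_not, not_le, Real.dist_eq,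
          sub_zero] at hcon hω
        refine hω ?_
        rw [abs_mul]
        calc |f (m, ω)| * |Y m ω| ≤ |f (m, ω)| * B :=
              mul_le_mul_of_nonneg_left hcon.2.le (abs_nonneg _)
          _ < ε / B * B := mul_lt_mul_of_pos_right hcon.1 hBpos
          _ = ε := by field_simp
    _ ≤ η / 2 + η / 2 := (measure_union_le _ _).trans (add_le_add hm (h1 m))
    _ = η := ENNReal.add_halves η

/-- Convergence of distribution functions is not affected by perturbations that vanish in
probability, which need not be measurable. -/
theorem tendsto_real_of_perturbation [IsProbabilityMeasure P] {N : ℕ → Ω → ℝ} {V : ℕ × Ω → ℝ}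
    {F : ℝ → ℝ} {t : ℝ} (hN : ∀ m, AEMeasurable (N m) P)
    (hF : ∀ s, Tendsto (fun m => P.real {ω | N m ω ≤ s}) atTop (𝓝 (F s))) (hFt : ContinuousAt F t)
    (hV : Tendsto (fun q => V q - N q.1 q.2) (probFilter P) (𝓝 0)) :
    Tendsto (fun m => P.real {ω | V (m, ω) ≤ t}) atTop (𝓝 (F t)) ∧
      Tendsto (fun m => P.real {ω | t < V (m, ω)}) atTop (𝓝 (1 - F t)) := by
  have hcompl : ∀ m s, P.real {ω | s < N m ω} = 1 - P.real {ω | N m ω ≤ s} := by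
    intro m s
    have : {ω | s < N m ω} = {ω | N m ω ≤ s}ᶜ := by ext; simp
    rw [this, probReal_compl_eq_one_sub₀]
    exact nullMeasurableSet_le (hN m) aemeasurable_const
  have hclose : ∀ ε > 0, Tendsto (fun m => P.real {ω | ¬ |V (m, ω) - N m ω| < ε}) atTop (𝓝 0) := by
    intro ε hε
    have := Metric.tendsto_nhds.1 hV ε hε
    simp only [Real.dist_eq, sub_zero] at this
    exact tendsto_real_zero_of_eventually this
  constructor
  · rw [Metric.tendsto_nhds]
    intro η hη
    obtain ⟨ε, hε, hFε⟩ := Metric.continuousAt_iff.1 hFt (η / 3) (by positivity)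
    have hup := hF (t + ε / 2)
    have hlo := hF (t - ε / 2)
    have e1 := hFε (x := t + ε / 2)
      (by rw [Real.dist_eq, add_sub_cancel_left, abs_of_pos] <;> linarith)
    have e2 := hFε (x := t - ε / 2)
      (by rw [Real.dist_eq, sub_sub_cancel_left, abs_neg, abs_of_pos] <;> linarith)
    filter_upwards [Metric.tendsto_nhds.1 hup (η / 3) (by positivity),
      Metric.tendsto_nhds.1 hlo (η / 3) (by positivity),
      Metric.tendsto_nhds.1 (hclose (ε / 2) (by positivity)) (η / 3) (by positivity)]
      with m h1 h2 h3
    -- Outside the event `|V - N| ≥ ε / 2`, the event `V ≤ t` lies between `N ≤ t - ε / 2` and `N ≤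
    -- t + ε / 2`.
    have u1 : P.real {ω | V (m, ω) ≤ t} ≤ P.real {ω | N m ω ≤ t + ε / 2}
        + P.real {ω | ¬ |V (m, ω) - N m ω| < ε / 2} := by
      refine (measureReal_mono fun ω hω => ?_).trans (measureReal_union_le _ _)
      by_contra hcon
      simp only [Set.mem_union, Set.mem_ofPred_eq, not_or, not_not, not_le] at hcon hω
      linarith [(abs_lt.1 hcon.2).1]
    have u2 : P.real {ω | N m ω ≤ t - ε / 2} ≤ P.real {ω | V (m, ω) ≤ t}
        + P.real {ω | ¬ |V (m, ω) - N m ω| < ε / 2} := by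
      refine (measureReal_mono fun ω hω => ?_).trans (measureReal_union_le _ _)
      by_contra hcon
      simp only [Set.mem_union, Set.mem_ofPred_eq, not_or, not_not, not_le] at hcon hω
      linarith [(abs_lt.1 hcon.2).2]
    rw [Real.dist_eq, abs_lt] at *
    constructor <;> linarith [e1.1, e1.2, e2.1, e2.2, h1.1, h1.2, h2.1, h2.2, h3.1, h3.2]
  -- The upper tail needs its own sandwich: `{V ≤ t}` may be non-measurable, so the first limit
  -- cannot be complemented. Only the events of the measurable `N` are.
  · rw [Metric.tendsto_nhds]
    intro η hη
    obtain ⟨ε, hε, hFε⟩ := Metric.continuousAt_iff.1 hFt (η / 3) (by positivity)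
    have hup := hF (t + ε / 2)
    have hlo := hF (t - ε / 2)
    have e1 := hFε (x := t + ε / 2)
      (by rw [Real.dist_eq, add_sub_cancel_left, abs_of_pos] <;> linarith)
    have e2 := hFε (x := t - ε / 2)
      (by rw [Real.dist_eq, sub_sub_cancel_left, abs_neg, abs_of_pos] <;> linarith)
    filter_upwards [Metric.tendsto_nhds.1 hup (η / 3) (by positivity),
      Metric.tendsto_nhds.1 hlo (η / 3) (by positivity),
      Metric.tendsto_nhds.1 (hclose (ε / 2) (by positivity)) (η / 3) (by positivity)]
      with m h1 h2 h3
    have u1 : P.real {ω | t < V (m, ω)} ≤ P.real {ω | t - ε / 2 < N m ω}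
        + P.real {ω | ¬ |V (m, ω) - N m ω| < ε / 2} := by
      refine (measureReal_mono fun ω hω => ?_).trans (measureReal_union_le _ _)
      by_contra hcon
      simp only [Set.mem_union, Set.mem_ofPred_eq, not_or, not_lt, not_le] at hcon hω
      linarith [(abs_lt.1 hcon.2).2]
    have u2 : P.real {ω | t + ε / 2 < N m ω} ≤ P.real {ω | t < V (m, ω)}
        + P.real {ω | ¬ |V (m, ω) - N m ω| < ε / 2} := by
      refine (measureReal_mono fun ω hω => ?_).trans (measureReal_union_le _ _)
      by_contra hcon
      simp only [Set.mem_union, Set.mem_ofPred_eq, not_or, not_lt, not_le] at hcon hω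
      linarith [(abs_lt.1 hcon.2).1]
    rw [hcompl] at u1 u2
    rw [Real.dist_eq, abs_lt] at *
    constructor <;> linarith [e1.1, e1.2, e2.1, e2.2, h1.1, h1.2, h2.1, h2.2, h3.1, h3.2]

end ProbFilter

/-! ### The law of the maximum of a possibly degenerate Gaussian vector, and its quantiles. -/

section GaussianQuantile

variable {k r : ℕ}

/-- The standard Gaussian measure on `ℝ^k`. -/
def stdNormal (k : ℕ) : Measure (Fin k → ℝ) := Measure.pi fun _ => gaussianReal 0 1

instance : IsProbabilityMeasure (stdNormal k) :=
  inferInstanceAs (IsProbabilityMeasure (Measure.pi _))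

instance : (gaussianReal 0 1).IsOpenPosMeasure :=
  (gaussianReal_absolutelyContinuous' 0 one_ne_zero).isOpenPosMeasure

instance : (stdNormal k).IsOpenPosMeasure :=
  inferInstanceAs (Measure.pi _).IsOpenPosMeasure

/-- The linear form `a ⬝ᵥ g` is normal with variance `|a|² > 0` and hence has no atoms. -/
theorem stdNormal_hyperplane {a : Fin k → ℝ} (ha : a ≠ 0) (c : ℝ) :
    stdNormal k {g | a ⬝ᵥ g = c} = 0 := by
  set L := innerSL ℝ (WithLp.toLp 2 a : EuclideanSpace ℝ (Fin k)) with hL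
  have hset : {g : Fin k → ℝ | a ⬝ᵥ g = c} = (WithLp.toLp 2) ⁻¹' (L ⁻¹' {c}) := by
    ext g
    simp [hL, PiLp.inner_apply, dotProduct, mul_comm]
  have hm : MeasurableSet (L ⁻¹' {c}) := L.continuous.measurable (measurableSet_singleton c)
  have hvar : (Var[L; stdGaussian (EuclideanSpace ℝ (Fin k))]).toNNReal ≠ 0 := by
    rw [variance_dual_stdGaussian, hL, innerSL_apply_norm]
    have : WithLp.toLp 2 a ≠ 0 := by simpa using ha
    simpa using this
  rw [hset, stdNormal, ← Measure.map_apply (by fun_prop) hm, map_pi_eq_stdGaussian,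
    ← Measure.map_apply (by fun_prop) (measurableSet_singleton c),
    IsGaussian.map_eq_gaussianReal L]
  have := nullSingletonClass_gaussianReal (μ := ∫ x, L x ∂(stdGaussian (EuclideanSpace ℝ (Fin k)))) hvar
  exact measure_singleton c

-- Characteristic functions agree because `⟨A g, t⟩ = ⟨g, Aᵀ t⟩`. Any factor `A` may be used, so
-- singular covariance matrices need no separate treatment and all Gaussian laws live on one
-- probability space.
open Complex in
theorem multivariateGaussian_mul_transpose (A : Matrix (Fin r) (Fin k) ℝ) :
    multivariateGaussian 0 (A * Aᵀ) =
      (stdNormal k).map fun g => (WithLp.toLp 2 (A *ᵥ g) : EuclideanSpace ℝ (Fin r)) := by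
  have hps : (A * Aᵀ).PosSemidef := by
    have := Matrix.posSemidef_self_mul_conjTranspose A
    rwa [Matrix.conjTranspose_eq_transpose_of_trivial] at this
  have hmeas : Measurable fun g : Fin k → ℝ =>
      (WithLp.toLp 2 (A *ᵥ g) : EuclideanSpace ℝ (Fin r)) := by
    have : Continuous fun g : Fin k → ℝ => A *ᵥ g := by fun_prop
    exact ((PiLp.continuous_toLp 2 _).comp this).measurable
  have : IsProbabilityMeasure ((stdNormal k).map fun g =>
      (WithLp.toLp 2 (A *ᵥ g) : EuclideanSpace ℝ (Fin r))) :=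
    Measure.isProbabilityMeasure_map hmeas.aemeasurable
  refine Measure.ext_of_charFun (funext fun t => ?_)
  have hstd := charFun_stdGaussian (E := EuclideanSpace ℝ (Fin k))
    (WithLp.toLp 2 (Aᵀ *ᵥ t.ofLp))
  rw [← map_pi_eq_stdGaussian, charFun_apply, integral_map (by fun_prop) (by fun_prop)] at hstd
  rw [charFun_multivariateGaussian hps, charFun_apply, integral_map hmeas.aemeasurable
    (by fun_prop)]
  have hinner : ∀ g : Fin k → ℝ, inner ℝ (WithLp.toLp 2 (A *ᵥ g) : EuclideanSpace ℝ (Fin r)) t =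
      inner ℝ (WithLp.toLp 2 g : EuclideanSpace ℝ (Fin k)) (WithLp.toLp 2 (Aᵀ *ᵥ t.ofLp)) := by
    intro g
    have h1 : ∀ (m : ℕ) (x y : EuclideanSpace ℝ (Fin m)),
        inner ℝ x y = x.ofLp ⬝ᵥ y.ofLp := by
      intro m x y
      simp [PiLp.inner_apply, dotProduct, mul_comm]
    rw [h1, h1, Matrix.mulVec_transpose, dotProduct_comm g, ← Matrix.dotProduct_mulVec,
      dotProduct_comm]
  simp only [hinner]
  refine Eq.trans ?_ hstd.symm
  congr 1
  have h2 : ‖(WithLp.toLp 2 (Aᵀ *ᵥ t.ofLp) : EuclideanSpace ℝ (Fin k))‖ ^ 2 =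
      t.ofLp ⬝ᵥ (A * Aᵀ) *ᵥ t.ofLp := by
    rw [EuclideanSpace.norm_sq_eq, ← Matrix.mulVec_mulVec, Matrix.dotProduct_mulVec,
      ← Matrix.mulVec_transpose]
    simp [dotProduct, sq]
  rw [← h2]
  simp
  ring

/-- The distribution function of `max |A g|` for a standard Gaussian vector `g`. -/
def maxNormCdf (A : Matrix (Fin r) (Fin k) ℝ) (t : ℝ) : ℝ :=
  (stdNormal k).real {g | ‖A *ᵥ g‖ ≤ t}

theorem continuous_norm_mulVec (A : Matrix (Fin r) (Fin k) ℝ) :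
    Continuous fun g : Fin k → ℝ => ‖A *ᵥ g‖ := by fun_prop

theorem measurableSet_norm_mulVec_le (A : Matrix (Fin r) (Fin k) ℝ) (t : ℝ) :
    MeasurableSet {g : Fin k → ℝ | ‖A *ᵥ g‖ ≤ t} :=
  (isClosed_le (continuous_norm_mulVec A) continuous_const).measurableSet

/-- The box `|z l| ≤ t` is a sup-norm ball. Nonemptiness of `Fin r` matters for negative `t`, where
the box has to be empty. -/
theorem equiQuantile_mul_transpose (hr : 0 < r) (p : ℝ) (A : Matrix (Fin r) (Fin k) ℝ) :
    equiQuantile p (A * Aᵀ) = sInf {t | p ≤ maxNormCdf A t} := by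
  have : Nonempty (Fin r) := ⟨⟨0, hr⟩⟩
  have h : ∀ t, (multivariateGaussian 0 (A * Aᵀ)).real {z | ∀ l : Fin r, |z l| ≤ t} =
      maxNormCdf A t := by
    intro t
    have hm : MeasurableSet {z : EuclideanSpace ℝ (Fin r) | ∀ l : Fin r, |z l| ≤ t} := by
      have : {z : EuclideanSpace ℝ (Fin r) | ∀ l : Fin r, |z l| ≤ t} =
          ⋂ l, {z | |z l| ≤ t} := by ext; simp
      rw [this]
      exact MeasurableSet.iInter fun l => measurableSet_le (by fun_prop) measurable_const
    have hc : Continuous fun g : Fin k → ℝ => A *ᵥ g := by fun_prop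
    have hc' : Measurable fun g : Fin k → ℝ =>
        (WithLp.toLp 2 (A *ᵥ g) : EuclideanSpace ℝ (Fin r)) :=
      ((PiLp.continuous_toLp 2 _).comp hc).measurable
    rw [multivariateGaussian_mul_transpose, map_measureReal_apply hc' hm, maxNormCdf]
    congr 1
    ext g
    simp [pi_norm_le_iff_of_nonempty]
  simp only [equiQuantile, h]

/-- The maximum is attained by some coordinate, so the level set is covered by finitely many
hyperplanes with nonzero normals. -/
theorem stdNormal_norm_mulVec_eq (hr : 0 < r) {A : Matrix (Fin r) (Fin k) ℝ}
    (hA : ∀ l, A l ≠ 0) (t : ℝ) : stdNormal k {g | ‖A *ᵥ g‖ = t} = 0 := by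
  have : Nonempty (Fin r) := ⟨⟨0, hr⟩⟩
  refine measure_mono_null (t := ⋃ l, ({g | A l ⬝ᵥ g = t} ∪ {g | A l ⬝ᵥ g = -t})) ?_ ?_
  · intro g hg
    obtain ⟨l, hmax⟩ := Finite.exists_max fun l => ‖(A *ᵥ g) l‖
    have hl : ‖(A *ᵥ g) l‖ = ‖A *ᵥ g‖ :=
      le_antisymm (norm_le_pi_norm _ l) ((pi_norm_le_iff_of_nonempty _).2 hmax)
    have hg : ‖A *ᵥ g‖ = t := hg
    rw [hg, Real.norm_eq_abs] at hl
    refine Set.mem_iUnion.2 ⟨l, ?_⟩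
    exact (eq_or_eq_neg_of_abs_eq hl)
  · rw [measure_iUnion_null_iff]
    exact fun l => measure_union_null (stdNormal_hyperplane (hA l) t)
      (stdNormal_hyperplane (hA l) (-t))

/-- Off the null set `‖A g‖ = t` the indicators converge pointwise, and dominated convergence gives
joint continuity in the matrix and the threshold. -/
theorem tendsto_maxNormCdf (hr : 0 < r) {A : Matrix (Fin r) (Fin k) ℝ} (hA : ∀ l, A l ≠ 0)
    (t : ℝ) {X : Type*} {l : Filter X} [l.IsCountablyGenerated] {B : X → Matrix (Fin r) (Fin k) ℝ}
    {s : X → ℝ} (hB : Tendsto B l (𝓝 A)) (hs : Tendsto s l (𝓝 t)) :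
    Tendsto (fun x => maxNormCdf (B x) (s x)) l (𝓝 (maxNormCdf A t)) := by
  refine (ENNReal.tendsto_toReal (measure_ne_top _ _)).comp
    (tendsto_measure_of_ae_tendsto_indicator_of_isFiniteMeasure l
      (measurableSet_norm_mulVec_le A t) (fun x => measurableSet_norm_mulVec_le (B x) (s x)) ?_)
  have hae : ∀ᵐ g ∂(stdNormal k), ‖A *ᵥ g‖ ≠ t := by
    rw [ae_iff]
    simpa using stdNormal_norm_mulVec_eq hr hA t
  filter_upwards [hae] with g hg
  have hlim : Tendsto (fun x => ‖B x *ᵥ g‖) l (𝓝 ‖A *ᵥ g‖) := by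
    have hc : Continuous fun C : Matrix (Fin r) (Fin k) ℝ => ‖C *ᵥ g‖ := by fun_prop
    exact (hc.tendsto A).comp hB
  change ∀ᶠ x in l, (‖B x *ᵥ g‖ ≤ s x ↔ ‖A *ᵥ g‖ ≤ t)
  rcases lt_or_gt_of_ne hg with h | h
  · filter_upwards [hlim.eventually_lt hs h] with x hx
    exact ⟨fun _ => h.le, fun _ => hx.le⟩
  · filter_upwards [hs.eventually_lt hlim h] with x hx
    exact ⟨fun h' => absurd h' hx.not_ge, fun h' => absurd h' h.not_ge⟩

theorem maxNormCdf_mono (A : Matrix (Fin r) (Fin k) ℝ) : Monotone (maxNormCdf A) :=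
  fun _ _ hst => measureReal_mono fun _ hg => le_trans hg hst

theorem continuous_maxNormCdf (hr : 0 < r) {A : Matrix (Fin r) (Fin k) ℝ} (hA : ∀ l, A l ≠ 0) :
    Continuous (maxNormCdf A) :=
  continuous_iff_continuousAt.2 fun t => tendsto_maxNormCdf hr hA t tendsto_const_nhds tendsto_id

theorem maxNormCdf_nonpos (hr : 0 < r) {A : Matrix (Fin r) (Fin k) ℝ} (hA : ∀ l, A l ≠ 0)
    {t : ℝ} (ht : t ≤ 0) : maxNormCdf A t = 0 := by
  have h : stdNormal k {g | ‖A *ᵥ g‖ ≤ t} = 0 := by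
    refine measure_mono_null (fun g hg => ?_) (stdNormal_norm_mulVec_eq hr hA 0)
    exact le_antisymm (le_trans hg ht) (norm_nonneg _)
  simp [maxNormCdf, Measure.real, h]

theorem tendsto_maxNormCdf_atTop (A : Matrix (Fin r) (Fin k) ℝ) :
    Tendsto (fun n : ℕ => maxNormCdf A n) atTop (𝓝 1) := by
  have hU : ⋃ n : ℕ, {g : Fin k → ℝ | ‖A *ᵥ g‖ ≤ n} = Set.univ := by
    refine Set.eq_univ_of_forall fun g => Set.mem_iUnion.2 ?_
    exact exists_nat_ge ‖A *ᵥ g‖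
  have h := tendsto_measure_iUnion_atTop (μ := stdNormal k)
    (s := fun n : ℕ => {g : Fin k → ℝ | ‖A *ᵥ g‖ ≤ n})
    fun m n hmn g hg => le_trans (show _ ≤ (m : ℝ) from hg) (Nat.cast_le.2 hmn)
  rw [hU, measure_univ] at h
  simpa [maxNormCdf, Measure.real, Function.comp_def] using
    (ENNReal.tendsto_toReal ENNReal.one_ne_top).comp h

/-- The shell `s < ‖A g‖ < t` is open and nonempty, and the standard Gaussian measure charges every
nonempty open set. -/
theorem maxNormCdf_strictMono (hr : 0 < r) {A : Matrix (Fin r) (Fin k) ℝ} (hA : ∀ l, A l ≠ 0)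
    {s t : ℝ} (hs : 0 ≤ s) (hst : s < t) : maxNormCdf A s < maxNormCdf A t := by
  have hopen : IsOpen {g : Fin k → ℝ | s < ‖A *ᵥ g‖ ∧ ‖A *ᵥ g‖ < t} :=
    (isOpen_lt continuous_const (continuous_norm_mulVec A)).inter
      (isOpen_lt (continuous_norm_mulVec A) continuous_const)
  have hne : {g : Fin k → ℝ | s < ‖A *ᵥ g‖ ∧ ‖A *ᵥ g‖ < t}.Nonempty := by
    -- The first row `a` of `A` is not in the kernel, since the first entry of `A a` is `a ⬝ᵥ a >
    -- 0`. Rescaling it reaches the middle of the shell.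
    have hg : 0 < ‖A *ᵥ A ⟨0, hr⟩‖ := by
      rw [norm_pos_iff]
      intro h0
      have h1 := congrFun h0 ⟨0, hr⟩
      exact (dotProduct_self_pos_of_ne (hA ⟨0, hr⟩)).ne' h1
    refine ⟨((s + t) / 2 / ‖A *ᵥ A ⟨0, hr⟩‖) • A ⟨0, hr⟩, ?_⟩
    have : ‖A *ᵥ (((s + t) / 2 / ‖A *ᵥ A ⟨0, hr⟩‖) • A ⟨0, hr⟩)‖ = (s + t) / 2 := by
      rw [Matrix.mulVec_smul, norm_smul, Real.norm_eq_abs, abs_div, abs_norm,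
        div_mul_cancel₀ _ hg.ne', abs_of_nonneg (by linarith)]
    simp only [Set.mem_ofPred_eq, this]
    constructor <;> linarith
  have hpos : 0 < (stdNormal k).real {g : Fin k → ℝ | s < ‖A *ᵥ g‖ ∧ ‖A *ᵥ g‖ < t} :=
    ENNReal.toReal_pos (hopen.measure_pos _ hne).ne' (measure_ne_top _ _)
  have hdisj : Disjoint {g : Fin k → ℝ | ‖A *ᵥ g‖ ≤ s}
      {g : Fin k → ℝ | s < ‖A *ᵥ g‖ ∧ ‖A *ᵥ g‖ < t} :=
    Set.disjoint_left.2 fun g hg hg' => absurd hg hg'.1.not_ge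
  calc maxNormCdf A s < maxNormCdf A s +
        (stdNormal k).real {g : Fin k → ℝ | s < ‖A *ᵥ g‖ ∧ ‖A *ᵥ g‖ < t} := by linarith
    _ = (stdNormal k).real ({g : Fin k → ℝ | ‖A *ᵥ g‖ ≤ s} ∪
        {g : Fin k → ℝ | s < ‖A *ᵥ g‖ ∧ ‖A *ᵥ g‖ < t}) :=
        (measureReal_union hdisj hopen.measurableSet).symm
    _ ≤ maxNormCdf A t := by
        refine measureReal_mono ?_
        rintro g (hg | hg)
        · exact le_trans hg hst.le
        · exact hg.2.le

theorem exists_maxNormCdf_eq (hr : 0 < r) {A : Matrix (Fin r) (Fin k) ℝ} (hA : ∀ l, A l ≠ 0)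
    {p : ℝ} (hp : p ∈ Set.Ioo (0 : ℝ) 1) : ∃ q, 0 < q ∧ maxNormCdf A q = p := by
  obtain ⟨n, hn⟩ := ((tendsto_maxNormCdf_atTop A).eventually_const_lt hp.2).exists
  obtain ⟨q, hq, hqp⟩ := intermediate_value_Icc (Nat.cast_nonneg (α := ℝ) n)
    (continuous_maxNormCdf hr hA).continuousOn
    (⟨(maxNormCdf_nonpos hr hA le_rfl).trans_le hp.1.le, hn.le⟩ : p ∈ Set.Icc _ _)
  refine ⟨q, lt_of_le_of_ne hq.1 ?_, hqp⟩
  rintro rfl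
  rw [maxNormCdf_nonpos hr hA le_rfl] at hqp
  exact hp.1.ne hqp

/-- By strict monotonicity the limit distribution function is below `p` at `q - ε / 2` and above `p`
at `q + ε / 2`. Both strict inequalities persist for nearby matrices and trap their quantile. -/
theorem tendsto_equiQuantile (hr : 0 < r) {A : Matrix (Fin r) (Fin k) ℝ} (hA : ∀ l, A l ≠ 0)
    {p q : ℝ} (hq : 0 < q) (hqp : maxNormCdf A q = p) (hp : 0 < p) {X : Type*} {l : Filter X}
    {B : X → Matrix (Fin r) (Fin k) ℝ} (hB : Tendsto B l (𝓝 A)) :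
    Tendsto (fun x => equiQuantile p (B x * (B x)ᵀ)) l (𝓝 q) := by
  -- Dominated convergence needs a countably generated filter, so the limit is taken along `𝓝 A` and
  -- then composed with `B`.
  suffices h : Tendsto (fun C : Matrix (Fin r) (Fin k) ℝ => equiQuantile p (C * Cᵀ)) (𝓝 A) (𝓝 q)
    from h.comp hB
  have : FirstCountableTopology (Matrix (Fin r) (Fin k) ℝ) :=
    inferInstanceAs (FirstCountableTopology (Fin r → Fin k → ℝ))
  rw [Metric.tendsto_nhds]
  intro ε hε
  have hup : p < maxNormCdf A (q + ε / 2) :=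
    hqp ▸ maxNormCdf_strictMono hr hA hq.le (by linarith)
  have hlo : maxNormCdf A (q - ε / 2) < p := by
    rcases le_total (q - ε / 2) 0 with h0 | h0
    · rwa [maxNormCdf_nonpos hr hA h0]
    · exact hqp ▸ maxNormCdf_strictMono hr hA h0 (by linarith)
  filter_upwards [(tendsto_maxNormCdf hr hA _ tendsto_id tendsto_const_nhds).eventually_const_lt hup,
    (tendsto_maxNormCdf hr hA _ tendsto_id tendsto_const_nhds).eventually_lt_const hlo] with C h1 h2
  rw [equiQuantile_mul_transpose hr]
  have hlb : ∀ t ∈ {t | p ≤ maxNormCdf C t}, q - ε / 2 ≤ t := by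
    intro t ht
    by_contra hcon
    exact absurd (le_trans ht (maxNormCdf_mono C (not_le.1 hcon).le)) (not_le.2 h2)
  have hmem : q + ε / 2 ∈ {t | p ≤ maxNormCdf C t} := h1.le
  have h3 := csInf_le ⟨q - ε / 2, hlb⟩ hmem
  have h4 := le_csInf ⟨_, hmem⟩ hlb
  rw [Real.dist_eq, abs_lt]
  constructor <;> linarith

/-- The factor of the correlation matrix of the contrasts under a diagonal covariance matrix. -/
def contrastFactor (H : Matrix (Fin r) (Fin k) ℝ) (s : Fin k → ℝ) : Matrix (Fin r) (Fin k) ℝ :=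
  Matrix.of fun l i => H l i * √(s i) / √(H l ⬝ᵥ Matrix.diagonal s *ᵥ H l)

theorem dotProduct_diagonal_mulVec (a b s : Fin k → ℝ) :
    a ⬝ᵥ Matrix.diagonal s *ᵥ b = ∑ i, a i * s i * b i := by
  simp [dotProduct, Matrix.mulVec_diagonal, mul_assoc]

theorem dotProduct_diagonal_mulVec_pos {a s : Fin k → ℝ} (ha : a ≠ 0) (hs : ∀ i, 0 < s i) :
    0 < a ⬝ᵥ Matrix.diagonal s *ᵥ a := by
  rw [dotProduct_diagonal_mulVec]
  obtain ⟨i, hi⟩ := Function.ne_iff.1 ha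
  have h : ∀ j, a j * s j * a j = a j ^ 2 * s j := fun j => by ring
  simp only [h]
  exact Finset.sum_pos' (fun j _ => mul_nonneg (sq_nonneg _) (hs j).le)
    ⟨i, Finset.mem_univ i, mul_pos (by have : a i ≠ 0 := hi; positivity) (hs i)⟩

/-- An explicit factor, continuous in the variances, takes the place of a matrix square root of the
correlation matrix. -/
theorem contrastCorr_diagonal (H : Matrix (Fin r) (Fin k) ℝ) {s : Fin k → ℝ}
    (hs : ∀ i, 0 < s i) :
    contrastCorr H (Matrix.diagonal s) = contrastFactor H s * (contrastFactor H s)ᵀ := by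
  ext l m
  simp only [contrastCorr, contrastFactor, Matrix.of_apply, Matrix.mul_apply,
    Matrix.transpose_apply]
  generalize √(H l ⬝ᵥ Matrix.diagonal s *ᵥ H l) = x
  generalize √(H m ⬝ᵥ Matrix.diagonal s *ᵥ H m) = y
  rw [dotProduct_diagonal_mulVec, Finset.sum_div]
  refine Finset.sum_congr rfl fun i _ => ?_
  rw [div_mul_div_comm]
  congr 1
  linear_combination (-(H l i * H m i)) * Real.mul_self_sqrt (hs i).le

theorem contrastFactor_ne_zero {H : Matrix (Fin r) (Fin k) ℝ} (hH : ∀ l, H l ≠ 0)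
    {s : Fin k → ℝ} (hs : ∀ i, 0 < s i) (l : Fin r) : contrastFactor H s l ≠ 0 := by
  obtain ⟨i, hi⟩ := Function.ne_iff.1 (hH l)
  refine Function.ne_iff.2 ⟨i, ?_⟩
  exact div_ne_zero (mul_ne_zero hi (Real.sqrt_pos.2 (hs i)).ne')
    (Real.sqrt_pos.2 (dotProduct_diagonal_mulVec_pos (hH l) hs)).ne'

theorem tendsto_contrastFactor {H : Matrix (Fin r) (Fin k) ℝ} (hH : ∀ l, H l ≠ 0)
    {s : Fin k → ℝ} (hs : ∀ i, 0 < s i) {X : Type*} {F : Filter X} {t : X → Fin k → ℝ}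
    (ht : ∀ i, Tendsto (fun x => t x i) F (𝓝 (s i))) :
    Tendsto (fun x => contrastFactor H (t x)) F (𝓝 (contrastFactor H s)) := by
  refine tendsto_pi_nhds.2 fun l => tendsto_pi_nhds.2 fun i => ?_
  simp only [contrastFactor, Matrix.of_apply, dotProduct_diagonal_mulVec]
  refine Tendsto.div ((ht i).sqrt.const_mul _)
    (tendsto_finsetSum _ fun j _ => ((ht j).const_mul _).mul_const _).sqrt ?_
  rw [← dotProduct_diagonal_mulVec]
  exact (Real.sqrt_pos.2 (dotProduct_diagonal_mulVec_pos (hH l) hs)).ne'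

end GaussianQuantile

/-! ### Consistency and stochastic order of the sample moments. -/

section Sample

variable {Ω : Type*} [MeasurableSpace Ω] {P : Measure Ω} {d : ℕ}
  {ν : Measure (Fin d → ℝ)} {X : ℕ → Ω → Fin d → ℝ} {N : ℕ → ℕ}

/-- Independent observations with law `ν`, all of whose coordinates have a fourth moment. -/
structure IsSample (P : Measure Ω) (ν : Measure (Fin d → ℝ)) (X : ℕ → Ω → Fin d → ℝ) : Prop where
  hasLaw : ∀ j, HasLaw (X j) ν P
  iIndepFun : iIndepFun X P
  integrable_pow : ∀ l, Integrable (fun x => x l ^ 4) ν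

theorem IsSample.memLp_coord [IsProbabilityMeasure ν] (h : IsSample P ν X)
    (a : Fin d) :
    MemLp (fun x : Fin d → ℝ => x a) 2 ν :=
  memLp_momentVec h.integrable_pow (Sum.inl a)

theorem IsSample.memLp_mul [IsProbabilityMeasure ν] (h : IsSample P ν X)
    (a b : Fin d) :
    MemLp (fun x : Fin d → ℝ => x a * x b) 2 ν :=
  memLp_momentVec h.integrable_pow (Sum.inr (a, b))

variable [IsProbabilityMeasure P]

theorem tendsto_sampleAverage (h : IsSample P ν X)
    (hN : Tendsto N atTop atTop) {g : (Fin d → ℝ) → ℝ} (hg : Measurable g)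
    (hgi : Integrable g ν) :
    Tendsto (fun q : ℕ × Ω => sampleAverage (N q.1) (fun j => X j q.2) g) (probFilter P)
      (𝓝 (∫ x, g x ∂ν)) := by
  have hlaw := h.hasLaw
  have hind := h.iIndepFun
  have hlaw' : ∀ j, IdentDistrib (fun ω => g (X j ω)) (fun ω => g (X 0 ω)) P P := fun j =>
    ((hlaw j).identDistrib (hlaw 0)).comp hg
  have hint : Integrable (fun ω => g (X 0 ω)) P := by
    have hi := hgi
    rw [← (hlaw 0).map_eq] at hi
    exact hi.comp_aemeasurable (hlaw 0).aemeasurable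
  have hmean : ∫ ω, g (X 0 ω) ∂P = ∫ x, g x ∂ν := by
    rw [← (hlaw 0).map_eq, integral_map (hlaw 0).aemeasurable hg.aestronglyMeasurable]
  have hslln := strong_law_ae (fun j ω => g (X j ω)) hint
    (fun i j hij => (hind.indepFun hij).comp hg hg) hlaw'
  refine tendsto_probFilter_of_ae (f := fun m ω => sampleAverage (N m) (fun j => X j ω) g)
    (fun m => ?_) ?_
  · simp only [sampleAverage]
    have : AEMeasurable (fun ω => (∑ j ∈ Finset.range (N m), g (X j ω)) / (N m : ℝ)) P :=
      (Finset.aemeasurable_fun_sum _ fun j _ =>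
        hg.comp_aemeasurable (hlaw j).aemeasurable).div_const _
    exact this.aestronglyMeasurable
  · filter_upwards [hslln] with ω hω
    have h2 := hω.comp hN
    rw [hmean] at h2
    refine h2.congr fun m => ?_
    simp [sampleAverage, div_eq_inv_mul]

/-- The second moment of the scaled error is exactly the variance of `g`, whatever the positive
sample size. -/
theorem stochBounded_sampleAverage (h : IsSample P ν X)
    (N : ℕ → ℕ) {g : (Fin d → ℝ) → ℝ} (hg : Measurable g) (hg2 : MemLp g 2 ν) :
    StochBounded P fun q : ℕ × Ω =>
      √(N q.1) * (sampleAverage (N q.1) (fun j => X j q.2) g - ∫ x, g x ∂ν) := by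
  have hlaw := h.hasLaw
  have hind := h.iIndepFun
  have hL : ∀ j, MemLp (fun ω => g (X j ω)) 2 P := fun j => by
    have hi := hg2
    rw [← (hlaw j).map_eq] at hi
    exact hi.comp_of_map (hlaw j).aemeasurable
  have hmean : ∀ j, ∫ ω, g (X j ω) ∂P = ∫ x, g x ∂ν := fun j => by
    rw [← (hlaw j).map_eq, integral_map (hlaw j).aemeasurable hg.aestronglyMeasurable]
  have hvar : ∀ j, variance (fun ω => g (X j ω)) P = variance g ν := fun j => by
    rw [← (hlaw j).map_eq, variance_map hg.aemeasurable (hlaw j).aemeasurable]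
    rfl
  have hLS : ∀ m, MemLp (fun ω => ∑ j ∈ Finset.range (N m), g (X j ω)) 2 P := fun m =>
    memLp_finsetSum _ fun j _ => hL j
  have hL2 : ∀ m, MemLp (fun ω => √(N m) *
      (sampleAverage (N m) (fun j => X j ω) g - ∫ x, g x ∂ν)) 2 P := fun m => by
    simp only [sampleAverage, div_eq_mul_inv]
    exact (((hLS m).mul_const _).sub (memLp_const _)).const_mul _
  refine StochBounded.of_second_moment (Y := fun m ω => √(N m) *
    (sampleAverage (N m) (fun j => X j ω) g - ∫ x, g x ∂ν)) (K := variance g ν) hL2 fun m => ?_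
  -- For an empty sample the factor `√0` makes the expression vanish.
  rcases Nat.eq_zero_or_pos (N m) with h0 | hpos
  · simp [h0, variance_nonneg]
  have hNpos : (0 : ℝ) < N m := by exact_mod_cast hpos
  have hES : ∫ ω, ∑ j ∈ Finset.range (N m), g (X j ω) ∂P = N m * ∫ x, g x ∂ν := by
    rw [integral_finsetSum _ fun j _ => (hL j).integrable (by norm_num)]
    simp [hmean]
  have hVS : variance (fun ω => ∑ j ∈ Finset.range (N m), g (X j ω)) P = N m * variance g ν := by
    have := IndepFun.variance_sum (μ := P) (X := fun j ω => g (X j ω)) (s := Finset.range (N m))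
      (fun j _ => hL j) (fun i _ j _ hij => (hind.indepFun hij).comp hg hg)
    have h2 : (∑ j ∈ Finset.range (N m), fun ω => g (X j ω)) =
        fun ω => ∑ j ∈ Finset.range (N m), g (X j ω) := by
      funext ω; simp
    rw [h2] at this
    rw [this]
    simp [hvar]
  rw [variance_eq_integral (hLS m).aestronglyMeasurable.aemeasurable, hES] at hVS
  have hpt : ∀ ω, (√(N m) * (sampleAverage (N m) (fun j => X j ω) g - ∫ x, g x ∂ν)) ^ 2 =
      (N m : ℝ)⁻¹ * (∑ j ∈ Finset.range (N m), g (X j ω) - N m * ∫ x, g x ∂ν) ^ 2 := by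
    intro ω
    rw [mul_pow, Real.sq_sqrt hNpos.le, sampleAverage]
    field_simp
  simp only [hpt]
  rw [integral_const_mul, hVS, inv_mul_cancel_left₀ hNpos.ne']

theorem sampleAverage_sub_const {N : ℕ} (hN : 0 < N) (x : ℕ → Fin d → ℝ)
    (f : (Fin d → ℝ) → ℝ) (c : ℝ) :
    sampleAverage N x (fun y => f y - c) = sampleAverage N x f - c := by
  have : (N : ℝ) ≠ 0 := by exact_mod_cast hN.ne'
  simp only [sampleAverage, Finset.sum_sub_distrib, Finset.sum_const, Finset.card_range,
    nsmul_eq_mul]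
  field_simp

/-- The product of two centred coordinates. -/
def centredProduct (μ : Fin d → ℝ) (a b : Fin d) (x : Fin d → ℝ) : ℝ :=
  (x a - μ a) * (x b - μ b)

/-- Moving the centring from the sample mean to a fixed `μ` costs only a product of two mean errors.
Taken at the true mean, this replaces dependent summands by an average of i.i.d. ones. -/
theorem sampleMoments_cov_apply (δ : ℕ) {N : ℕ} (hN : 0 < N) (x : ℕ → Fin d → ℝ) (μ : Fin d → ℝ)
    (a b : Fin d) :
    (sampleMoments δ N x).cov a b = N / ((N : ℝ) - δ) *
      (sampleAverage N x (centredProduct μ a b) -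
        ((sampleMoments δ N x).mean a - μ a) * ((sampleMoments δ N x).mean b - μ b)) := by
  have hN' : (N : ℝ) ≠ 0 := by exact_mod_cast hN.ne'
  have h1 : ∀ a, ∑ j ∈ Finset.range N, x j a = N * sampleAverage N x fun y => y a := by
    intro a
    rw [sampleAverage]
    field_simp
  simp only [sampleMoments, Matrix.of_apply]
  set A := sampleAverage N x fun y => y a with hA
  set B := sampleAverage N x fun y => y b with hB
  have h2 : ∑ j ∈ Finset.range N, (x j a - A) * (x j b - B) =
      ∑ j ∈ Finset.range N, (x j a - μ a) * (x j b - μ b) - N * ((A - μ a) * (B - μ b)) := by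
    have h3 : ∀ j, (x j a - A) * (x j b - B) = (x j a - μ a) * (x j b - μ b)
        - (B - μ b) * x j a - (A - μ a) * x j b + (A * B - μ a * μ b) := fun j => by ring
    simp only [h3, Finset.sum_add_distrib, Finset.sum_sub_distrib, ← Finset.mul_sum, h1,
      Finset.sum_const, Finset.card_range, nsmul_eq_mul]
    rw [← hA, ← hB]
    ring
  rw [h2]
  simp only [sampleAverage, centredProduct]
  rw [div_mul_eq_mul_div]
  congr 1
  field_simp

theorem measurable_centredProduct (μ : Fin d → ℝ) (a b : Fin d) :
    Measurable (centredProduct μ a b) := by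
  unfold centredProduct
  fun_prop

theorem memLp_centredProduct [IsProbabilityMeasure ν] (hmom : ∀ l, Integrable (fun x => x l ^ 4) ν) (μ : Fin d → ℝ)
    (a b : Fin d) : MemLp (centredProduct μ a b) 2 ν := by
  have h : centredProduct μ a b = fun x => momentVec x (Sum.inr (a, b)) - μ b * momentVec x
      (Sum.inl a) - μ a * momentVec x (Sum.inl b) + μ a * μ b := by
    funext x
    simp only [centredProduct, momentVec, Sum.elim_inl, Sum.elim_inr]
    ring
  rw [h]
  exact ((((memLp_momentVec hmom _).sub ((memLp_momentVec hmom _).const_mul _)).sub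
    ((memLp_momentVec hmom _).const_mul _)).add (memLp_const _))

/-- The excess `δ / (N - δ)` is of order `1 / N`, so the choice of divisor is invisible even after
multiplication by `√N`. -/
theorem tendsto_divisor (hN : Tendsto N atTop atTop) (δ : ℕ) :
    Tendsto (fun m => (N m : ℝ) / ((N m : ℝ) - δ)) atTop (𝓝 1) ∧
    Tendsto (fun m => √(N m) * ((N m : ℝ) / ((N m : ℝ) - δ) - 1)) atTop (𝓝 0) := by
  have hx : Tendsto (fun m => (N m : ℝ)) atTop atTop := tendsto_natCast_atTop_atTop.comp hN
  have h1 : Tendsto (fun x : ℝ => x / (x - δ)) atTop (𝓝 1) := by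
    have h2 : Tendsto (fun x : ℝ => 1 + δ / (x - δ)) atTop (𝓝 (1 + 0)) :=
      tendsto_const_nhds.add ((tendsto_atTop_add_const_right _ (-(δ : ℝ))
        tendsto_id).const_div_atTop (δ : ℝ))
    rw [add_zero] at h2
    refine h2.congr' ?_
    filter_upwards [eventually_gt_atTop (δ : ℝ)] with x hx
    have : x - δ ≠ 0 := by linarith
    field_simp
    ring
  have h3 : Tendsto (fun x : ℝ => √x * (x / (x - δ) - 1)) atTop (𝓝 0) := by
    have h4 : Tendsto (fun x : ℝ => δ * (x / (x - δ)) * (√x)⁻¹) atTop (𝓝 (δ * 1 * 0)) :=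
      (h1.const_mul _).mul (tendsto_inv_atTop_zero.comp Real.tendsto_sqrt_atTop)
    rw [mul_zero] at h4
    refine h4.congr' ?_
    filter_upwards [eventually_gt_atTop (δ : ℝ), eventually_gt_atTop 0] with x hx hx0
    have : x - δ ≠ 0 := by linarith
    have h5 : √x ≠ 0 := (Real.sqrt_pos.2 hx0).ne'
    have h6 : √x * √x = x := Real.mul_self_sqrt hx0.le
    rw [div_sub_one this]
    field_simp
    linear_combination (-(δ : ℝ)) * h6
  exact ⟨h1.comp hx, h3.comp hx⟩

theorem eventually_pos_probFilter (P : Measure Ω) (hN : Tendsto N atTop atTop) :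
    ∀ᶠ q : ℕ × Ω in probFilter P, 0 < N q.1 :=
  tendsto_fst_probFilter.eventually (hN.eventually_gt_atTop 0)

variable [IsProbabilityMeasure ν]

theorem tendsto_sample_mean (h : IsSample P ν X) (hN : Tendsto N atTop atTop) (δ : ℕ) : Tendsto
    (fun q : ℕ × Ω => (sampleMoments δ (N q.1) fun j => X j q.2).mean) (probFilter P)
    (𝓝 (populationMoments ν).mean) := by
  rw [tendsto_pi_nhds]
  intro a
  have h1 := tendsto_sampleAverage h hN (measurable_pi_apply a)
    ((h.memLp_coord a).integrable (by norm_num))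
  exact h1

theorem tendsto_sample_cov (h : IsSample P ν X) (hN : Tendsto N atTop atTop) (δ : ℕ) : Tendsto
    (fun q : ℕ × Ω => (sampleMoments δ (N q.1) fun j => X j q.2).cov) (probFilter P)
    (𝓝 (populationMoments ν).cov) := by
  have hmean := tendsto_pi_nhds.1 (tendsto_sample_mean h hN δ)
  refine tendsto_pi_nhds.2 fun a => tendsto_pi_nhds.2 fun b => ?_
  have h1 := tendsto_sampleAverage h hN
    (measurable_centredProduct (populationMoments ν).mean a b)
    ((memLp_centredProduct h.integrable_pow _ a b).integrable (by norm_num))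
  have h2 := ((tendsto_divisor hN δ).1.comp (tendsto_fst_probFilter (P := P))).mul
    (h1.sub (((hmean a).sub_const ((populationMoments ν).mean a)).mul
      ((hmean b).sub_const ((populationMoments ν).mean b))))
  rw [sub_self, zero_mul, sub_zero, one_mul] at h2
  refine h2.congr' ?_
  filter_upwards [eventually_pos_probFilter P hN] with q hq
  exact (sampleMoments_cov_apply δ hq _ _ a b).symm

theorem tendsto_sample_psi3 (h : IsSample P ν X) (hN : Tendsto N atTop atTop) (δ : ℕ) : Tendsto
    (fun q : ℕ × Ω => (sampleMoments δ (N q.1) fun j => X j q.2).psi3) (probFilter P)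
    (𝓝 (populationMoments ν).psi3) := by
  refine tendsto_pi_nhds.2 fun p => tendsto_pi_nhds.2 fun s => ?_
  have h3 : Integrable (fun x : Fin d → ℝ => x p.1 * x p.2 * x s) ν :=
    (h.memLp_mul p.1 p.2).integrable_mul (h.memLp_coord s)
  have e1 := tendsto_sampleAverage h hN (by fun_prop) h3
  have e2 := tendsto_sampleAverage h hN (by fun_prop)
    ((h.memLp_mul p.1 p.2).integrable (by norm_num))
  have e3 := tendsto_sampleAverage h hN (by fun_prop) ((h.memLp_coord s).integrable (by norm_num))
  exact e1.sub (e2.mul e3)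

theorem tendsto_sample_psi4 (h : IsSample P ν X) (hN : Tendsto N atTop atTop) (δ : ℕ) : Tendsto
    (fun q : ℕ × Ω => (sampleMoments δ (N q.1) fun j => X j q.2).psi4) (probFilter P)
    (𝓝 (populationMoments ν).psi4) := by
  refine tendsto_pi_nhds.2 fun p => tendsto_pi_nhds.2 fun p' => ?_
  have h4 : Integrable (fun x : Fin d → ℝ => x p.1 * x p.2 * x p'.1 * x p'.2) ν := by
    have := (h.memLp_mul p.1 p.2).integrable_mul (h.memLp_mul p'.1 p'.2)
    refine this.congr (ae_of_all _ fun x => ?_)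
    simp [mul_assoc]
  have e1 := tendsto_sampleAverage h hN (by fun_prop) h4
  have e2 := tendsto_sampleAverage h hN (by fun_prop)
    ((h.memLp_mul p.1 p.2).integrable (by norm_num))
  have e3 := tendsto_sampleAverage h hN (by fun_prop)
    ((h.memLp_mul p'.1 p'.2).integrable (by norm_num))
  exact e1.sub (e2.mul e3)

theorem tendsto_sample_varEffect (h : IsSample P ν X) (hN : Tendsto N atTop atTop) (δ : ℕ)
    (e : Effect) {v : Variant} (hreg : Regular v (populationMoments ν)) : Tendsto
    (fun q : ℕ × Ω => varEffect e v (sampleMoments δ (N q.1) fun j => X j q.2)) (probFilter P)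
    (𝓝 (varEffect e v (populationMoments ν))) :=
  tendsto_varEffect e hreg (tendsto_sample_mean h hN δ)
    (tendsto_sample_cov h hN δ) (tendsto_sample_psi3 h hN δ)
    (tendsto_sample_psi4 h hN δ)

theorem stochBounded_sample_mean (h : IsSample P ν X) (N : ℕ → ℕ) (δ : ℕ) (a : Fin d) :
    StochBounded P fun q : ℕ × Ω =>
      √(N q.1) * ((sampleMoments δ (N q.1) fun j => X j q.2).mean a
        - (populationMoments ν).mean a) := by
  have h1 := stochBounded_sampleAverage h N (measurable_pi_apply a) (h.memLp_coord a)
  exact h1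

/-- Two errors have to vanish: the divisor correction, and the product of two mean errors, where
`√N` is absorbed by one factor while the other tends to zero. -/
theorem tendsto_sample_cov_linear (h : IsSample P ν X) (hN : Tendsto N atTop atTop) (δ : ℕ)
    (a b : Fin d) : Tendsto (fun q : ℕ × Ω =>
    √(N q.1) * ((sampleMoments δ (N q.1) fun j => X j q.2).cov a b
      - (populationMoments ν).cov a b)
    - √(N q.1) * (sampleAverage (N q.1) (fun j => X j q.2)
      (centredProduct (populationMoments ν).mean a b) - (populationMoments ν).cov a b))
    (probFilter P) (𝓝 0) := by
  have hmean := tendsto_pi_nhds.1 (tendsto_sample_mean h hN δ)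
  have hmb : Tendsto (fun q : ℕ × Ω => (sampleMoments δ (N q.1) fun j => X j q.2).mean b -
      (populationMoments ν).mean b) (probFilter P) (𝓝 0) := by
    simpa using (hmean b).sub_const ((populationMoments ν).mean b)
  have h1 := tendsto_sampleAverage h hN
    (measurable_centredProduct (populationMoments ν).mean a b)
    ((memLp_centredProduct h.integrable_pow _ a b).integrable (by norm_num))
  have hd1 := (tendsto_divisor hN δ).1.comp (tendsto_fst_probFilter (P := P))
  have hd2 := (tendsto_divisor hN δ).2.comp (tendsto_fst_probFilter (P := P))
  have h2 := stochBounded_sample_mean h N δ a _ hmb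
  have h3 := (hd2.mul h1).sub (hd1.mul h2)
  rw [zero_mul, mul_zero, sub_zero] at h3
  refine h3.congr' ?_
  filter_upwards [eventually_pos_probFilter P hN] with q hq
  rw [sampleMoments_cov_apply δ hq _ (populationMoments ν).mean a b]
  simp only [Function.comp]
  ring

theorem stochBounded_sample_cov (h : IsSample P ν X) (hN : Tendsto N atTop atTop) (δ : ℕ)
    (a b : Fin d) : StochBounded P fun q : ℕ × Ω =>
    √(N q.1) * ((sampleMoments δ (N q.1) fun j => X j q.2).cov a b
      - (populationMoments ν).cov a b) :=
  (stochBounded_sampleAverage h N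
    (measurable_centredProduct (populationMoments ν).mean a b)
    (memLp_centredProduct h.integrable_pow _ a b)).congr' (tendsto_sample_cov_linear h hN δ a b)

end Sample

/-! ### The delta method for one group. -/

section DeltaMethod

variable {Ω : Type*} [MeasurableSpace Ω] {P : Measure Ω} {d : ℕ}
  {ν : Measure (Fin d → ℝ)} {X : ℕ → Ω → Fin d → ℝ} {N : ℕ → ℕ}

theorem sampleAverage_influence (v : Variant) (M : Moments d) {n : ℕ} (hn : 0 < n)
    (x : ℕ → Fin d → ℝ) (δ : ℕ) :
    sampleAverage n x (influence v M) =
      gradPairing v M ((sampleMoments δ n x).mean - M.mean)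
        fun a b => sampleAverage n x (centredProduct M.mean a b) - M.cov a b := by
  have hn' : (n : ℝ) ≠ 0 := by exact_mod_cast hn.ne'
  have h1 : ∀ a b, sampleAverage n x (centredProduct M.mean a b) - M.cov a b =
      (∑ j ∈ Finset.range n,
        ((x j a - M.mean a) * (x j b - M.mean b) - M.cov a b)) / (n : ℝ) := by
    intro a b
    rw [← sampleAverage_sub_const hn]
    rfl
  have h2 : ∀ a, (sampleMoments δ n x).mean a - M.mean a =
      (∑ j ∈ Finset.range n, (x j a - M.mean a)) / (n : ℝ) := by
    intro a
    change sampleAverage n x (fun y => y a) - M.mean a = _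
    rw [← sampleAverage_sub_const hn]
    rfl
  simp only [gradPairing, h1, dotProduct, Pi.sub_apply, h2]
  rw [sampleAverage, div_eq_iff hn', add_mul, Finset.sum_mul]
  simp only [influence, gradPairing, dotProduct, Finset.sum_add_distrib, Pi.sub_apply]
  congr 1
  · rw [Finset.sum_comm]
    refine Finset.sum_congr rfl fun a _ => ?_
    rw [mul_assoc, div_mul_cancel₀ _ hn', Finset.mul_sum]
  · rw [Finset.sum_comm, Finset.sum_mul]
    refine Finset.sum_congr rfl fun a _ => ?_
    rw [Finset.sum_comm, Finset.sum_mul]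
    refine Finset.sum_congr rfl fun b _ => ?_
    rw [mul_assoc, div_mul_cancel₀ _ hn', Finset.mul_sum]

theorem integral_influence [IsProbabilityMeasure ν] (v : Variant)
    (hmom : ∀ l, Integrable (fun x => x l ^ 4) ν) :
    ∫ x, influence v (populationMoments ν) x ∂ν = 0 := by
  have h1 : ∀ a, Integrable (fun x : Fin d → ℝ => x a - (populationMoments ν).mean a) ν :=
    fun a => ((memLp_momentVec hmom (Sum.inl a)).integrable (by norm_num)).sub
      (integrable_const _)
  have h2 : ∀ a b, Integrable (fun x : Fin d → ℝ =>
      centredProduct (populationMoments ν).mean a b x - (populationMoments ν).cov a b) ν :=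
    fun a b => ((memLp_centredProduct hmom _ a b).integrable (by norm_num)).sub
      (integrable_const _)
  have e1 : ∀ a, ∫ x : Fin d → ℝ, (x a - (populationMoments ν).mean a) ∂ν = 0 := by
    intro a
    have h3 : Integrable (fun x : Fin d → ℝ => x a) ν :=
      (memLp_momentVec hmom (Sum.inl a)).integrable (by norm_num)
    rw [integral_sub h3 (integrable_const _)]
    simp [populationMoments]
  have e2 : ∀ a b, ∫ x : Fin d → ℝ, (centredProduct (populationMoments ν).mean a b x
      - (populationMoments ν).cov a b) ∂ν = 0 := by
    intro a b
    rw [integral_sub ((memLp_centredProduct hmom _ a b).integrable (by norm_num))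
      (integrable_const _), sub_eq_zero, integral_const, probReal_univ, one_smul]
    rfl
  simp only [influence, gradPairing, dotProduct, Pi.sub_apply]
  simp only [centredProduct] at h2 e2
  rw [integral_add, integral_finsetSum, integral_finsetSum]
  · simp only [integral_const_mul, e1, mul_zero, Finset.sum_const_zero, zero_add]
    refine Finset.sum_eq_zero fun a _ => ?_
    rw [integral_finsetSum _ fun b _ => (h2 a b).const_mul _]
    simp only [integral_const_mul, e2, mul_zero, Finset.sum_const_zero]
  · exact fun a _ => integrable_finsetSum _ fun b _ => (h2 a b).const_mul _
  · exact fun a _ => (h1 a).const_mul _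
  · exact integrable_finsetSum _ fun a _ => (h1 a).const_mul _
  · exact integrable_finsetSum _ fun a _ =>
      integrable_finsetSum _ fun b _ => (h2 a b).const_mul _

/-- Mean vector and covariance matrix as a point of a normed space. -/
def meanCov (M : Moments d) : (Fin d → ℝ) × (Fin d → Fin d → ℝ) := (M.mean, fun a b => M.cov a b)

variable [IsProbabilityMeasure P] [IsProbabilityMeasure ν]

theorem stochBounded_sample_dist (h : IsSample P ν X) (hN : Tendsto N atTop atTop) (δ : ℕ) :
    StochBounded P fun q : ℕ × Ω => √(N q.1) *
      ‖meanCov (sampleMoments δ (N q.1) fun j => X j q.2) - meanCov (populationMoments ν)‖ := by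
  have h1 := StochBounded.sum Finset.univ fun a _ => (stochBounded_sample_mean h N δ a).abs
  have h2 := StochBounded.sum Finset.univ fun a _ => StochBounded.sum Finset.univ fun b _ =>
    (stochBounded_sample_cov h hN δ a b).abs
  refine (h1.add h2).mono fun q => ?_
  set M := sampleMoments δ (N q.1) fun j => X j q.2
  have n1 : 0 ≤ ∑ a, |√(N q.1) * (M.mean a - (populationMoments ν).mean a)| :=
    Finset.sum_nonneg fun a _ => abs_nonneg _
  have n2 : 0 ≤ ∑ a, ∑ b, |√(N q.1) * (M.cov a b - (populationMoments ν).cov a b)| :=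
    Finset.sum_nonneg fun a _ => Finset.sum_nonneg fun b _ => abs_nonneg _
  rw [abs_of_nonneg (add_nonneg n1 n2), abs_mul, abs_norm]
  have hs : |√(N q.1 : ℝ)| = ‖√(N q.1 : ℝ)‖ := rfl
  rw [hs, ← norm_smul, Prod.norm_def, max_le_iff]
  constructor
  · rw [pi_norm_le_iff_of_nonneg (add_nonneg n1 n2)]
    intro a
    have := Finset.single_le_sum (f := fun a =>
      |√(N q.1) * (M.mean a - (populationMoments ν).mean a)|) (fun a _ => abs_nonneg _)
      (Finset.mem_univ a)
    exact this.trans (le_add_of_nonneg_right n2)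
  · rw [pi_norm_le_iff_of_nonneg (add_nonneg n1 n2)]
    intro a
    rw [pi_norm_le_iff_of_nonneg (add_nonneg n1 n2)]
    intro b
    have h3 := Finset.single_le_sum (f := fun b =>
      |√(N q.1) * (M.cov a b - (populationMoments ν).cov a b)|) (fun a _ => abs_nonneg _)
      (Finset.mem_univ b)
    have h4 := Finset.single_le_sum (f := fun a => ∑ b,
      |√(N q.1) * (M.cov a b - (populationMoments ν).cov a b)|)
      (fun a _ => Finset.sum_nonneg fun b _ => abs_nonneg _) (Finset.mem_univ a)
    exact (h3.trans h4).trans (le_add_of_nonneg_left n1)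

/-- The Taylor remainder is of smaller order than the distance of the sample moments from the
population moments, and `√N` times that distance is stochastically bounded. The linear term becomes
an average of `influence` once the sample covariance is replaced by centred products. -/
theorem tendsto_effect_linear (h : IsSample P ν X) (hN : Tendsto N atTop atTop) (δ : ℕ)
    (e : Effect) {v : Variant} (hreg : Regular v (populationMoments ν)) :
    Tendsto (fun q : ℕ × Ω =>
      √(N q.1) * (effect e v (sampleMoments δ (N q.1) fun j => X j q.2)
        - effect e v (populationMoments ν))
      - effectScale e v (populationMoments ν) * (√(N q.1) *
        sampleAverage (N q.1) (fun j => X j q.2) (influence v (populationMoments ν))))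
      (probFilter P) (𝓝 0) := by
  set M := populationMoments ν with hM
  set x : ℕ × Ω → (Fin d → ℝ) × (Fin d → Fin d → ℝ) := fun q =>
    meanCov (sampleMoments δ (N q.1) fun j => X j q.2) with hx
  set x₀ : (Fin d → ℝ) × (Fin d → Fin d → ℝ) := meanCov M with hx₀
  have hxlim : Tendsto x (probFilter P) (𝓝 x₀) :=
    (tendsto_sample_mean h hN δ).prodMk_nhds (tendsto_sample_cov h hN δ)
  have hder0 : HasFDerivAt (effectFun e v) (effectScale e v M • gradCLM v M) x₀ :=
    hasFDerivAt_effectFun e hreg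
  have hder := (hasFDerivAt_iff_tendsto.1 hder0).comp hxlim
  have h1 := stochBounded_sample_dist h hN δ _ hder
  set R : ℕ × Ω → ℝ := fun q => effectFun e v (x q) - effectFun e v x₀
    - (effectScale e v M • gradCLM v M) (x q - x₀) with hR
  have h2 : Tendsto (fun q => √(N q.1) * R q) (probFilter P) (𝓝 0) := by
    refine squeeze_zero_norm (fun q => ?_) h1
    rw [norm_mul, Real.norm_of_nonneg (Real.sqrt_nonneg _)]
    simp only [Function.comp]
    change √(N q.1) * ‖R q‖ ≤ ‖x q - x₀‖⁻¹ * ‖R q‖ * (√(N q.1) * ‖x q - x₀‖)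
    -- If the distance is zero its inverse is zero by convention, but then the remainder vanishes as
    -- well.
    rcases eq_or_ne (x q - x₀) 0 with h0 | h0
    · have : R q = 0 := by
        have hxx : x q = x₀ := sub_eq_zero.1 h0
        simp [hR, hxx]
      simp [this]
    · have : ‖x q - x₀‖ ≠ 0 := norm_ne_zero_iff.2 h0
      refine le_of_eq ?_
      field_simp
  have h3 : Tendsto (fun q : ℕ × Ω => ∑ a, ∑ b, gradCov v M (a, b) *
      (√(N q.1) * ((sampleMoments δ (N q.1) fun j => X j q.2).cov a b - M.cov a b)
        - √(N q.1) * (sampleAverage (N q.1) (fun j => X j q.2) (centredProduct M.mean a b)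
          - M.cov a b))) (probFilter P) (𝓝 0) := by
    have := tendsto_finsetSum Finset.univ fun a (_ : a ∈ Finset.univ) =>
      tendsto_finsetSum Finset.univ fun b (_ : b ∈ Finset.univ) =>
        (tendsto_sample_cov_linear h hN δ a b).const_mul (gradCov v M (a, b))
    simpa using this
  have h4 := h2.add (h3.const_mul (effectScale e v M))
  rw [mul_zero, add_zero] at h4
  refine h4.congr' ?_
  filter_upwards [eventually_pos_probFilter P hN] with q hq
  rw [sampleAverage_influence v M hq _ δ]
  set M' := sampleMoments δ (N q.1) fun j => X j q.2
  have hRq : R q = effect e v M' - effect e v M - effectScale e v M *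
      (gradMean v M ⬝ᵥ (M'.mean - M.mean)
        + ∑ a, ∑ b, gradCov v M (a, b) * (M'.cov a b - M.cov a b)) := by
    rw [← effectFun_eq e v M', ← effectFun_eq e v M]
    rfl
  rw [hRq, gradPairing]
  generalize gradMean v M ⬝ᵥ (M'.mean - M.mean) = G
  have hsum : ∑ a, ∑ b, gradCov v M (a, b) * (√(N q.1) * (M'.cov a b - M.cov a b)
        - √(N q.1) * (sampleAverage (N q.1) (fun j => X j q.2) (centredProduct M.mean a b)
          - M.cov a b)) =
      √(N q.1) * (∑ a, ∑ b, gradCov v M (a, b) * (M'.cov a b - M.cov a b))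
      - √(N q.1) * ∑ a, ∑ b, gradCov v M (a, b) *
        (sampleAverage (N q.1) (fun j => X j q.2) (centredProduct M.mean a b) - M.cov a b) := by
    simp only [Finset.mul_sum, ← Finset.sum_sub_distrib]
    exact Finset.sum_congr rfl fun a _ => Finset.sum_congr rfl fun b _ => by ring
  rw [hsum]
  ring

end DeltaMethod

/-! ### Joint central limit theorem for independent groups of different sizes. -/

section JointCLT

variable {Ω : Type*} [MeasurableSpace Ω] {P : Measure Ω} {k : ℕ}

theorem measurable_euclideanSpace_single (i : Fin k) :
    Measurable fun x : ℝ => (EuclideanSpace.single i x : EuclideanSpace ℝ (Fin k)) := by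
  have h : Continuous fun x : ℝ => (Pi.single i x : Fin k → ℝ) :=
    continuous_single (A := fun _ => ℝ) i
  exact ((PiLp.continuous_toLp 2 _).comp h).measurable

theorem charFun_map_single {f : Ω → ℝ} (hf : AEMeasurable f P) (i : Fin k)
    (t : EuclideanSpace ℝ (Fin k)) :
    charFun (P.map fun ω => EuclideanSpace.single i (f ω)) t = charFun (P.map f) (t i) := by
  have hm : AEMeasurable (fun ω => (EuclideanSpace.single i (f ω) : EuclideanSpace ℝ (Fin k))) P :=
    (measurable_euclideanSpace_single i).comp_aemeasurable hf
  rw [charFun_apply, charFun_apply, integral_map hm (by fun_prop), integral_map hf (by fun_prop)]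
  simp [EuclideanSpace.inner_single_left, mul_comm]

variable [IsProbabilityMeasure P]

/-- Put each summand on the axis of its group: the vector of group sums is then a sum of independent
vectors. Its characteristic function factors over all pairs `(i, j)`, and regrouping by `i` gives
the product of the marginal ones. -/
theorem iIndepFun_groupSum {Y : Fin k → ℕ → Ω → ℝ} (hY : ∀ i j, AEMeasurable (Y i j) P)
    (hind : iIndepFun (fun p : Fin k × ℕ => Y p.1 p.2) P) (N : Fin k → ℕ) :
    iIndepFun (fun i ω => ∑ j ∈ Finset.range (N i), Y i j ω) P := by
  have hsum : ∀ i, AEMeasurable (fun ω => ∑ j ∈ Finset.range (N i), Y i j ω) P := fun i =>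
    Finset.aemeasurable_fun_sum _ fun j _ => hY i j
  refine (iIndepFun_iff_charFun_pi hsum).2 fun t => ?_
  let Z : (Σ _ : Fin k, ℕ) → Ω → EuclideanSpace ℝ (Fin k) :=
    fun p ω => EuclideanSpace.single p.1 (Y p.1 p.2 ω)
  have hZ : iIndepFun Z P :=
    (hind.precomp (g := Equiv.sigmaEquivProd (Fin k) ℕ) (Equiv.injective _)).comp
      (fun p x => EuclideanSpace.single p.1 x) fun p => measurable_euclideanSpace_single p.1
  have hZm : ∀ p, AEMeasurable (Z p) P := fun p =>
    (measurable_euclideanSpace_single p.1).comp_aemeasurable (hY p.1 p.2)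
  have hvec : (fun ω => WithLp.toLp 2 fun i => ∑ j ∈ Finset.range (N i), Y i j ω) =
      fun ω => ∑ p ∈ Finset.univ.sigma fun i => Finset.range (N i), Z p ω := by
    funext ω
    ext i
    simp [Finset.sum_sigma, Z, WithLp.ofLp_sum, Finset.sum_apply, Pi.single_apply]
  rw [hvec, (hZ.restrict _).charFun_map_fun_finsetSum_eq_prod fun p _ => hZm p,
    Finset.prod_apply, Finset.prod_sigma]
  refine Finset.prod_congr rfl fun i _ => ?_
  have hi : iIndepFun (Y i) P := hind.precomp (g := Prod.mk i) (Prod.mk_right_injective i)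
  rw [(hi.restrict _).charFun_map_fun_finsetSum_eq_prod fun j _ => hY i j, Finset.prod_apply]
  exact Finset.prod_congr rfl fun j _ => charFun_map_single (hY i j) i t

variable {d : ℕ} {ν : Fin k → Measure (Fin d → ℝ)} {X : Fin k → ℕ → Ω → Fin d → ℝ}

/-- The central limit theorem for the joint distribution of the normalized group sums of `φ i`,
in the form needed for max-type statistics. -/
theorem tendsto_real_norm_mulVec_groupSum {r : ℕ} (hr : 0 < r)
    (hlaw : ∀ i j, HasLaw (X i j) (ν i) P)
    (hind : iIndepFun (fun p : Fin k × ℕ => X p.1 p.2) P)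
    {φ : Fin k → (Fin d → ℝ) → ℝ} (hφ : ∀ i, Measurable (φ i))
    (hφ0 : ∀ i, ∫ x, φ i x ∂(ν i) = 0) (hφ1 : ∀ i, ∫ x, φ i x ^ 2 ∂(ν i) = 1)
    {N : ℕ → Fin k → ℕ} (hN : ∀ i, Tendsto (fun m => N m i) atTop atTop)
    {A : Matrix (Fin r) (Fin k) ℝ} (hA : ∀ l, A l ≠ 0) (t : ℝ) :
    Tendsto (fun m => P.real {ω |
        ‖A *ᵥ fun i => (√(N m i))⁻¹ * ∑ j ∈ Finset.range (N m i), φ i (X i j ω)‖ ≤ t})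
      atTop (𝓝 (maxNormCdf A t)) := by
  have hY : ∀ i j, AEMeasurable (fun ω => φ i (X i j ω)) P := fun i j =>
    (hφ i).comp_aemeasurable (hlaw i j).aemeasurable
  have hYind : iIndepFun (fun (p : Fin k × ℕ) ω => φ p.1 (X p.1 p.2 ω)) P :=
    hind.comp (fun p => φ p.1) fun p => hφ p.1
  have hclt : ∀ i, TendstoInDistribution
      (fun (n : ℕ) ω => (√n)⁻¹ * ∑ j ∈ Finset.range n, φ i (X i j ω)) atTop id
      (fun _ => P) (gaussianReal 0 1) := fun i => by
    refine tendstoInDistribution_inv_sqrt_mul_sum (X := fun j ω => φ i (X i j ω))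
      HasLaw.id ?_ ?_
      (hYind.precomp (g := Prod.mk i) (Prod.mk_right_injective i))
      (fun j => ((hlaw i j).identDistrib (hlaw i 0)).comp (hφ i))
    · rw [← hφ0 i, ← (hlaw i 0).map_eq,
        integral_map (hlaw i 0).aemeasurable (hφ i).aestronglyMeasurable]
    · rw [← hφ1 i, ← (hlaw i 0).map_eq, integral_map (hlaw i 0).aemeasurable
        ((hφ i).pow_const 2).aestronglyMeasurable]
      rfl
  let W : ℕ → Fin k → Ω → ℝ :=
    fun m i ω => (√(N m i))⁻¹ * ∑ j ∈ Finset.range (N m i), φ i (X i j ω)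
  have hW : ∀ m i, AEMeasurable (W m i) P := fun m i => (hclt i).forall_aemeasurable (N m i)
  have hWind : ∀ m, iIndepFun (W m) P := fun m =>
    (iIndepFun_groupSum hY hYind (N m)).comp (fun i x => (√(N m i))⁻¹ * x)
      fun i => measurable_const_mul _
  let μ : ℕ → Fin k → ProbabilityMeasure ℝ :=
    fun m i => ⟨P.map (W m i), Measure.isProbabilityMeasure_map (hW m i)⟩
  have hμ : Tendsto μ atTop (𝓝 fun _ => ⟨gaussianReal 0 1, inferInstance⟩) := by
    refine tendsto_pi_nhds.2 fun i => ?_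
    have h := (hclt i).tendsto.comp (hN i)
    simp only [Measure.map_id] at h
    exact h
  -- By independence the joint laws are product measures, and forming products is weakly continuous.
  have hpi :=
    (ProbabilityMeasure.continuous_pi (ι := Fin k) (α := fun _ => ℝ)).continuousAt.tendsto.comp hμ
  -- The frontier of the sup-norm event lies in the level set `‖A g‖ = t`, a null set, so weak
  -- convergence yields convergence of its probability.
  have hnull : (ProbabilityMeasure.pi fun _ : Fin k =>
      (⟨gaussianReal 0 1, inferInstance⟩ : ProbabilityMeasure ℝ) : Measure (Fin k → ℝ))
      (frontier {g | ‖A *ᵥ g‖ ≤ t}) = 0 :=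
    measure_mono_null (frontier_le_subset_eq (continuous_norm_mulVec A) continuous_const)
      (stdNormal_norm_mulVec_eq hr hA t)
  have h := ProbabilityMeasure.tendsto_measure_of_null_frontier_of_tendsto' hpi hnull
  have h' := (ENNReal.tendsto_toReal (measure_ne_top _ _)).comp h
  refine h'.congr fun m => ?_
  have hlawW : P.map (fun ω i => W m i ω) = Measure.pi fun i => P.map (W m i) :=
    (hWind m).map_fun_eq_pi_map (hW m)
  change (Measure.pi fun i => P.map (W m i)).real _ = P.real _
  rw [← hlawW, map_measureReal_apply_of_aemeasurable (aemeasurable_pi_lambda _ (hW m))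
    (measurableSet_norm_mulVec_le A t)]
  rfl

end JointCLT

/-! ### Studentized contrasts and critical value in the multi-sample problem. -/

/-- The studentized contrasts, centred at the contrasts of the vector `c`. -/
def centredContrast {d k r : ℕ} (e : Effect) (v : Variant) (δ : ℕ) (H : Matrix (Fin r) (Fin k) ℝ)
    (c : Fin k → ℝ) (n : Fin k → ℕ) (x : Fin k → ℕ → Fin d → ℝ) (l : Fin r) : ℝ :=
  √(total n : ℝ) *
    ((H l ⬝ᵥ (effectsHat e v δ n x - c)) / √(H l ⬝ᵥ sigmaHat e v δ n x *ᵥ H l))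

/-- Independent samples from `k` distributions that satisfy the assumptions for the variant `v`,
with sample sizes of the same order. -/
structure IsMultiSample {Ω : Type*} [MeasurableSpace Ω] (P : Measure Ω) {d k : ℕ} (v : Variant)
    (ν : Fin k → Measure (Fin d → ℝ)) [∀ i, IsProbabilityMeasure (ν i)]
    (X : Fin k → ℕ → Ω → Fin d → ℝ) (n : ℕ → Fin k → ℕ) (κ : Fin k → ℝ) : Prop where
  wellDefined : ∀ i, WellDefined v (ν i)
  not_isCondTwoPoint : ∀ i l, ¬ IsCondTwoPoint (ν i) l
  hasLaw : ∀ i j, HasLaw (X i j) (ν i) P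
  iIndepFun : iIndepFun (fun p : Fin k × ℕ => X p.1 p.2) P
  tendsto_total : Tendsto (fun m => total (n m)) atTop atTop
  pos : ∀ i, 0 < κ i
  tendsto_ratio : ∀ i, Tendsto (fun m => (n m i : ℝ) / (total (n m) : ℝ)) atTop (𝓝 (κ i))

/-- The limits of the diagonal entries of `sigmaHat`. -/
def limitVar {d k : ℕ} (e : Effect) (v : Variant) (ν : Fin k → Measure (Fin d → ℝ))
    (κ : Fin k → ℝ) (i : Fin k) : ℝ :=
  (κ i)⁻¹ * varEffect e v (populationMoments (ν i))

/-- The influence function of the effect, standardized to unit variance. -/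
def stdInfluence {d : ℕ} (e : Effect) (v : Variant) (ν : Measure (Fin d → ℝ))
    (x : Fin d → ℝ) : ℝ :=
  effectScale e v (populationMoments ν) / √(varEffect e v (populationMoments ν)) *
    influence v (populationMoments ν) x

theorem integral_stdInfluence {d : ℕ} (e : Effect) {v : Variant} {ν : Measure (Fin d → ℝ)}
    [IsProbabilityMeasure ν] (hwd : WellDefined v ν) : ∫ x, stdInfluence e v ν x ∂ν = 0 := by
  simp only [stdInfluence]
  rw [integral_const_mul, integral_influence v hwd.2.1, mul_zero]

theorem integral_stdInfluence_sq {d : ℕ} (e : Effect) {v : Variant} {ν : Measure (Fin d → ℝ)}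
    [IsProbabilityMeasure ν] (hwd : WellDefined v ν) (htp : ∀ l, ¬ IsCondTwoPoint ν l) :
    ∫ x, stdInfluence e v ν x ^ 2 ∂ν = 1 := by
  have hpos := varEffect_pos e hwd htp
  have hvar := variance_influence v hwd.2.1
  rw [variance_of_integral_eq_zero (measurable_influence v _).aemeasurable
    (integral_influence v hwd.2.1)] at hvar
  simp only [stdInfluence, mul_pow, div_pow, Real.sq_sqrt hpos.le]
  rw [integral_const_mul, hvar, div_mul_eq_mul_div, ← varEffect_eq e (regular_of_wellDefined hwd),
    div_self hpos.ne']

namespace IsMultiSample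

variable {Ω : Type*} [MeasurableSpace Ω] {P : Measure Ω} {d k r : ℕ}
  {v : Variant} {ν : Fin k → Measure (Fin d → ℝ)} [∀ i, IsProbabilityMeasure (ν i)]
  {X : Fin k → ℕ → Ω → Fin d → ℝ} {n : ℕ → Fin k → ℕ} {κ : Fin k → ℝ}
  {H : Matrix (Fin r) (Fin k) ℝ}

theorem isSample (h : IsMultiSample P v ν X n κ) (i : Fin k) : IsSample P (ν i) (X i) where
  hasLaw := h.hasLaw i
  iIndepFun := h.iIndepFun.precomp (g := Prod.mk i) (Prod.mk_right_injective i)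
  integrable_pow := (h.wellDefined i).2.1

theorem tendsto_size (h : IsMultiSample P v ν X n κ) (i : Fin k) :
    Tendsto (fun m => n m i) atTop atTop := by
  have hT : Tendsto (fun m => (total (n m) : ℝ)) atTop atTop :=
    tendsto_natCast_atTop_atTop.comp h.tendsto_total
  refine tendsto_natCast_atTop_iff (R := ℝ).1 ?_
  refine ((h.tendsto_ratio i).pos_mul_atTop (h.pos i) hT).congr' ?_
  filter_upwards [hT.eventually_gt_atTop 0] with m hm
  exact div_mul_cancel₀ _ hm.ne'

theorem tendsto_inv_ratio (h : IsMultiSample P v ν X n κ) (i : Fin k) :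
    Tendsto (fun q : ℕ × Ω => (total (n q.1) : ℝ) / (n q.1 i : ℝ)) (probFilter P)
      (𝓝 (κ i)⁻¹) := by
  have h1 := ((h.tendsto_ratio i).inv₀ (h.pos i).ne').comp
    (tendsto_fst_probFilter (P := P))
  simpa only [Function.comp_def, inv_div] using h1

theorem limitVar_pos (h : IsMultiSample P v ν X n κ) (e : Effect) (i : Fin k) :
    0 < limitVar e v ν κ i :=
  mul_pos (inv_pos.2 (h.pos i)) (varEffect_pos e (h.wellDefined i) (h.not_isCondTwoPoint i))

theorem sqrt_contrastVar_pos (h : IsMultiSample P v ν X n κ) (e : Effect) (hH : ∀ l, H l ≠ 0)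
    (l : Fin r) : 0 < √(H l ⬝ᵥ Matrix.diagonal (limitVar e v ν κ) *ᵥ H l) :=
  Real.sqrt_pos.2 (dotProduct_diagonal_mulVec_pos (hH l) (h.limitVar_pos e))

variable [IsProbabilityMeasure P]

theorem tendsto_varHat (h : IsMultiSample P v ν X n κ) (δ : ℕ) (e : Effect) (i : Fin k) :
    Tendsto (fun q : ℕ × Ω => ((total (n q.1) : ℝ) / (n q.1 i : ℝ)) *
        varEffect e v (sampleMoments δ (n q.1 i) fun j => X i j q.2)) (probFilter P)
      (𝓝 (limitVar e v ν κ i)) :=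
  (h.tendsto_inv_ratio i).mul (tendsto_sample_varEffect (h.isSample i) (h.tendsto_size i) δ e
    (regular_of_wellDefined (h.wellDefined i)))

theorem tendsto_contrastVar (h : IsMultiSample P v ν X n κ) (δ : ℕ) (e : Effect)
    (H : Matrix (Fin r) (Fin k) ℝ) (l : Fin r) :
    Tendsto (fun q : ℕ × Ω => √(H l ⬝ᵥ sigmaHat e v δ (n q.1) (fun i j => X i j q.2) *ᵥ H l))
      (probFilter P) (𝓝 √(H l ⬝ᵥ Matrix.diagonal (limitVar e v ν κ) *ᵥ H l)) := by
  simp only [sigmaHat, dotProduct_diagonal_mulVec]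
  exact (tendsto_finsetSum _ fun i _ =>
    ((h.tendsto_varHat δ e i).const_mul _).mul_const _).sqrt

theorem tendsto_critValue (h : IsMultiSample P v ν X n κ) (δ : ℕ) (e : Effect) (hr : 0 < r)
    (hH : ∀ l, H l ≠ 0) {α : ℝ} (hα : α < 1) {q₀ : ℝ} (hq₀ : 0 < q₀)
    (hq : maxNormCdf (contrastFactor H (limitVar e v ν κ)) q₀ = 1 - α) :
    Tendsto (fun q : ℕ × Ω => critValue e v δ α H (n q.1) fun i j => X i j q.2) (probFilter P)
      (𝓝 q₀) := by
  have hs := h.limitVar_pos e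
  refine (tendsto_equiQuantile hr (contrastFactor_ne_zero hH hs) hq₀ hq (by linarith)
    (tendsto_contrastFactor hH hs (h.tendsto_varHat δ e))).congr' ?_
  -- The factorization of the estimated correlation matrix requires positive estimated variances,
  -- which hold with probability tending to one.
  filter_upwards [eventually_all.2 fun i =>
    (h.tendsto_varHat δ e i).eventually_const_lt (hs i)] with q hpos
  rw [critValue, sigmaHat, contrastCorr_diagonal H hpos]

theorem tendsto_effect_sub_influence (h : IsMultiSample P v ν X n κ) (δ : ℕ) (e : Effect)
    (i : Fin k) :
    Tendsto (fun q : ℕ × Ω =>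
      √(n q.1 i) * (effectsHat e v δ (n q.1) (fun i j => X i j q.2) i - effects e v ν i)
        - √(varEffect e v (populationMoments (ν i))) * ((√(n q.1 i))⁻¹ *
          ∑ j ∈ Finset.range (n q.1 i), stdInfluence e v (ν i) (X i j q.2)))
      (probFilter P) (𝓝 0) := by
  refine (tendsto_effect_linear (h.isSample i) (h.tendsto_size i) δ e
    (regular_of_wellDefined (h.wellDefined i))).congr fun q => ?_
  have hσ := (Real.sqrt_pos.2 (varEffect_pos e (h.wellDefined i) (h.not_isCondTwoPoint i))).ne'
  simp only [stdInfluence, effectsHat, effects, sampleAverage, ← Finset.mul_sum]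
  generalize ∑ j ∈ Finset.range (n q.1 i), influence v (populationMoments (ν i)) (X i j q.2) = S
  have hN : √(n q.1 i : ℝ) * (S / (n q.1 i : ℝ)) = (√(n q.1 i : ℝ))⁻¹ * S := by
    rw [mul_div_left_comm, Real.sqrt_div_self', mul_comm, one_div]
  rw [hN]
  field_simp

theorem stochBounded_effect (h : IsMultiSample P v ν X n κ) (δ : ℕ) (e : Effect) (i : Fin k) :
    StochBounded P fun q : ℕ × Ω =>
      √(n q.1 i) * (effectsHat e v δ (n q.1) (fun i j => X i j q.2) i - effects e v ν i) := by
  have h1 := stochBounded_sampleAverage (h.isSample i) (fun m => n m i)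
    (measurable_influence v (populationMoments (ν i)))
    (memLp_influence v _ (h.wellDefined i).2.1)
  simp only [integral_influence v (h.wellDefined i).2.1, sub_zero] at h1
  exact (h1.mul_tendsto (tendsto_const_nhds (x := effectScale e v _))).congr'
    (tendsto_effect_linear (h.isSample i) (h.tendsto_size i) δ e
      (regular_of_wellDefined (h.wellDefined i)))

theorem tendsto_effectsHat (h : IsMultiSample P v ν X n κ) (δ : ℕ) (e : Effect) (i : Fin k) :
    Tendsto (fun q : ℕ × Ω => effectsHat e v δ (n q.1) (fun i j => X i j q.2) i) (probFilter P)
      (𝓝 (effects e v ν i)) := by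
  have hN : Tendsto (fun q : ℕ × Ω => (√(n q.1 i : ℝ))⁻¹) (probFilter P) (𝓝 0) :=
    tendsto_inv_atTop_zero.comp (Real.tendsto_sqrt_atTop.comp
      (tendsto_natCast_atTop_atTop.comp ((h.tendsto_size i).comp tendsto_fst_probFilter)))
  refine tendsto_sub_nhds_zero_iff.1 ((h.stochBounded_effect δ e i _ hN).congr' ?_)
  filter_upwards [eventually_pos_probFilter P (h.tendsto_size i)] with q hq
  exact inv_mul_cancel_left₀ (Real.sqrt_pos.2 (Nat.cast_pos.2 hq)).ne' _

/-- Slutsky's argument, coordinate by coordinate: the random coefficients of the scaled effect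
errors converge, and those errors are stochastically bounded and linear up to a vanishing term. -/
theorem tendsto_centredContrast_sub (h : IsMultiSample P v ν X n κ) (δ : ℕ) (e : Effect)
    (hH : ∀ l, H l ≠ 0) :
    Tendsto (fun q : ℕ × Ω =>
      centredContrast e v δ H (effects e v ν) (n q.1) (fun i j => X i j q.2)
        - contrastFactor H (limitVar e v ν κ) *ᵥ fun i => (√(n q.1 i))⁻¹ *
          ∑ j ∈ Finset.range (n q.1 i), stdInfluence e v (ν i) (X i j q.2))
      (probFilter P) (𝓝 0) := by
  refine tendsto_pi_nhds.2 fun l => ?_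
  have hM : ∀ i, Tendsto (fun q : ℕ × Ω =>
      H l i * √((total (n q.1) : ℝ) / (n q.1 i : ℝ)) /
        √(H l ⬝ᵥ sigmaHat e v δ (n q.1) (fun i j => X i j q.2) *ᵥ H l)) (probFilter P)
      (𝓝 (H l i * √(κ i)⁻¹ / √(H l ⬝ᵥ Matrix.diagonal (limitVar e v ν κ) *ᵥ H l))) := fun i =>
    ((h.tendsto_inv_ratio i).sqrt.const_mul _).div (h.tendsto_contrastVar δ e H l)
      (h.sqrt_contrastVar_pos e hH l).ne'
  -- First term: coefficient error times scaled effect error. Second term: limiting coefficient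
  -- times linearization error. Their sum is the contribution of group `i`.
  have hi : ∀ i, Tendsto _ (probFilter P) (𝓝 _) := fun i =>
    ((h.stochBounded_effect δ e i) _ (tendsto_sub_nhds_zero_iff.2 (hM i))).add
      ((h.tendsto_effect_sub_influence δ e i).const_mul
        (H l i * √(κ i)⁻¹ / √(H l ⬝ᵥ Matrix.diagonal (limitVar e v ν κ) *ᵥ H l)))
  have hsum := tendsto_finsetSum Finset.univ fun i _ => hi i
  simp only [mul_zero, add_zero, Finset.sum_const_zero] at hsum
  refine hsum.congr' ?_
  filter_upwards [eventually_all.2 fun i =>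
    eventually_pos_probFilter P (h.tendsto_size i)] with q hq
  simp only [Pi.sub_apply, Matrix.mulVec, dotProduct, centredContrast, contrastFactor,
    Matrix.of_apply]
  rw [Finset.sum_div, Finset.mul_sum, ← Finset.sum_sub_distrib]
  refine Finset.sum_congr rfl fun i _ => ?_
  have h1 : √(limitVar e v ν κ i) = √(κ i)⁻¹ * √(varEffect e v (populationMoments (ν i))) :=
    Real.sqrt_mul (inv_pos.2 (h.pos i)).le _
  have h2 : √(total (n q.1) : ℝ) = √((total (n q.1) : ℝ) / (n q.1 i : ℝ)) * √(n q.1 i : ℝ) := by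
    rw [← Real.sqrt_mul (by positivity), div_mul_cancel₀ _ (Nat.cast_pos.2 (hq i)).ne']
  rw [h1, h2]
  ring

theorem tendsto_real_norm_centredContrast (h : IsMultiSample P v ν X n κ) (δ : ℕ) (e : Effect)
    (hr : 0 < r) (hH : ∀ l, H l ≠ 0) {α : ℝ} (hα : α ∈ Set.Ioo (0 : ℝ) 1) :
    Tendsto (fun m => P.real {ω |
        ‖centredContrast e v δ H (effects e v ν) (n m) (fun i j => X i j ω)‖
          ≤ critValue e v δ α H (n m) (fun i j => X i j ω)}) atTop (𝓝 (1 - α)) ∧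
    Tendsto (fun m => P.real {ω | critValue e v δ α H (n m) (fun i j => X i j ω)
        < ‖centredContrast e v δ H (effects e v ν) (n m) (fun i j => X i j ω)‖})
      atTop (𝓝 α) := by
  have hA := contrastFactor_ne_zero hH (h.limitVar_pos e)
  obtain ⟨q₀, hq₀, hq⟩ := exists_maxNormCdf_eq hr hA
    (p := 1 - α) ⟨by linarith [hα.2], by linarith [hα.1]⟩
  have hcrit := h.tendsto_critValue δ e hr hH hα.2 hq₀ hq
  have hφ : ∀ i, Measurable (stdInfluence e v (ν i)) := fun i =>
    (measurable_influence v _).const_mul _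
  have hclt := tendsto_real_norm_mulVec_groupSum hr h.hasLaw h.iIndepFun hφ
    (fun i => integral_stdInfluence e (h.wellDefined i))
    (fun i => integral_stdInfluence_sq e (h.wellDefined i) (h.not_isCondTwoPoint i))
    h.tendsto_size hA
  have hW : ∀ m, AEMeasurable (fun ω i => (√(n m i : ℝ))⁻¹ *
      ∑ j ∈ Finset.range (n m i), stdInfluence e v (ν i) (X i j ω)) P := fun m =>
    aemeasurable_pi_lambda _ fun i => AEMeasurable.const_mul (Finset.aemeasurable_fun_sum _
      fun j _ => (hφ i).comp_aemeasurable (h.hasLaw i j).aemeasurable) _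
  -- The random threshold is moved to the other side: the norm is at most the critical value exactly
  -- when this perturbed norm is at most the constant `q₀`.
  have hV : Tendsto (fun q : ℕ × Ω =>
      (‖centredContrast e v δ H (effects e v ν) (n q.1) (fun i j => X i j q.2)‖
        - critValue e v δ α H (n q.1) (fun i j => X i j q.2) + q₀)
      - ‖contrastFactor H (limitVar e v ν κ) *ᵥ fun i => (√(n q.1 i))⁻¹ *
          ∑ j ∈ Finset.range (n q.1 i), stdInfluence e v (ν i) (X i j q.2)‖)
      (probFilter P) (𝓝 0) := by
    have h1 := squeeze_zero_norm (fun q => (Real.norm_eq_abs _).trans_le (abs_norm_sub_norm_le _ _))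
      (tendsto_zero_iff_norm_tendsto_zero.1 (h.tendsto_centredContrast_sub δ e hH))
    have h2 := h1.sub (hcrit.sub_const q₀)
    simp only [sub_self] at h2
    exact h2.congr fun q => by ring
  have key := tendsto_real_of_perturbation
    (fun m => (continuous_norm_mulVec _).measurable.comp_aemeasurable (hW m)) hclt
    (continuous_maxNormCdf hr hA).continuousAt hV (t := q₀)
  rw [hq, sub_sub_cancel] at key
  refine ⟨key.1.congr fun m => ?_, key.2.congr fun m => ?_⟩
  · congr 2 with ω
    dsimp only
    constructor <;> intro h <;> linarith
  · congr 2 with ω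
    dsimp only
    constructor <;> intro h <;> linarith

/-- The statistic is `√n` times a ratio with a nonzero limit. -/
theorem tendsto_abs_studentized (h : IsMultiSample P v ν X n κ) (δ : ℕ) (e : Effect)
    (hH : ∀ l, H l ≠ 0) {l : Fin r} (hl : H l ⬝ᵥ effects e v ν ≠ 0) :
    Tendsto (fun q : ℕ × Ω => |studentized e v δ H (n q.1) (fun i j => X i j q.2) l|)
      (probFilter P) atTop := by
  have hnum : Tendsto (fun q : ℕ × Ω =>
      H l ⬝ᵥ effectsHat e v δ (n q.1) (fun i j => X i j q.2)) (probFilter P)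
      (𝓝 (H l ⬝ᵥ effects e v ν)) :=
    tendsto_finsetSum _ fun i _ => (h.tendsto_effectsHat δ e i).const_mul _
  have hpos := h.sqrt_contrastVar_pos e hH l
  have hratio := (hnum.div (h.tendsto_contrastVar δ e H l) hpos.ne').abs
  have hT : Tendsto (fun q : ℕ × Ω => √(total (n q.1) : ℝ)) (probFilter P) atTop :=
    Real.tendsto_sqrt_atTop.comp (tendsto_natCast_atTop_atTop.comp
      (h.tendsto_total.comp tendsto_fst_probFilter))
  refine (hT.atTop_mul_pos (abs_pos.2 (div_ne_zero hl hpos.ne')) hratio).congr fun q => ?_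
  rw [studentized, abs_mul, abs_of_nonneg (Real.sqrt_nonneg _)]
  rfl

end IsMultiSample

/-! ### From the centred contrasts to tests and confidence intervals. -/

theorem studentized_eq_centredContrast {d k r : ℕ} (e : Effect) (v : Variant) (δ : ℕ)
    {H : Matrix (Fin r) (Fin k) ℝ} {c : Fin k → ℝ} (n : Fin k → ℕ) (x : Fin k → ℕ → Fin d → ℝ)
    {l : Fin r} (hl : H l ⬝ᵥ c = 0) :
    studentized e v δ H n x l = centredContrast e v δ H c n x l := by
  rw [studentized, centredContrast, dotProduct_sub, hl, sub_zero]

theorem iSup_abs_eq_norm {r : ℕ} (hr : 0 < r) (y : Fin r → ℝ) : ⨆ l, |y l| = ‖y‖ := by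
  have : Nonempty (Fin r) := ⟨⟨0, hr⟩⟩
  exact le_antisymm (ciSup_le fun l => norm_le_pi_norm y l)
    ((pi_norm_le_iff_of_nonempty _).2 fun l => le_ciSup (f := fun l => |y l|)
      (Set.finite_range _).bddAbove l)

theorem mem_Icc_iff_abs_centredContrast_le {d k r : ℕ} (e : Effect) (v : Variant) (δ : ℕ)
    {H : Matrix (Fin r) (Fin k) ℝ} {c : Fin k → ℝ} {n : Fin k → ℕ} {x : Fin k → ℕ → Fin d → ℝ}
    {l : Fin r} (hn : 0 < total n) (hs : 0 < √(H l ⬝ᵥ sigmaHat e v δ n x *ᵥ H l)) (q : ℝ) :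
    H l ⬝ᵥ c ∈ Set.Icc (H l ⬝ᵥ effectsHat e v δ n x - contrastSE e v δ H n x l * q)
        (H l ⬝ᵥ effectsHat e v δ n x + contrastSE e v δ H n x l * q) ↔
      |centredContrast e v δ H c n x l| ≤ q := by
  have hT : 0 < √(total n : ℝ) := Real.sqrt_pos.2 (Nat.cast_pos.2 hn)
  have hse : 0 < contrastSE e v δ H n x l := div_pos hs hT
  have heq : centredContrast e v δ H c n x l =
      (H l ⬝ᵥ effectsHat e v δ n x - H l ⬝ᵥ c) / contrastSE e v δ H n x l := by
    rw [centredContrast, contrastSE, dotProduct_sub]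
    field_simp
  rw [heq, abs_div, abs_of_pos hse, div_le_iff₀' hse, abs_le, Set.mem_Icc]
  constructor <;> rintro ⟨h1, h2⟩ <;> constructor <;> linarith

end MCV

end

theorem theorem4 {Ω : Type*} [MeasurableSpace Ω] (P : Measure Ω) [IsProbabilityMeasure P]
    {d k r : ℕ} (hr : 0 < r) (v : MCV.Variant)
    -- the group distributions
    (ν : Fin k → Measure (Fin d → ℝ)) [∀ i, IsProbabilityMeasure (ν i)]
    (hwd : ∀ i, MCV.WellDefined v (ν i))
    (htp : ∀ i l, ¬ MCV.IsCondTwoPoint (ν i) l)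
    -- independent observations, identically distributed within each group
    (X : Fin k → ℕ → Ω → Fin d → ℝ)
    (hlaw : ∀ i j, HasLaw (X i j) (ν i) P)
    (hind : iIndepFun (fun p : Fin k × ℕ => X p.1 p.2) P)
    -- the sample sizes; the groups do not vanish
    (n : ℕ → Fin k → ℕ) (hn : Tendsto (fun m => MCV.total (n m)) atTop atTop)
    (κ : Fin k → ℝ) (hκ : ∀ i, κ i ∈ Set.Ioo (0 : ℝ) 1)
    (hnκ : ∀ i, Tendsto (fun m => (n m i : ℝ) / (MCV.total (n m) : ℝ)) atTop (𝓝 (κ i)))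
    -- the divisor of the sample covariance matrices is the group size minus `δ`
    (δ : ℕ) (hδ : δ = 0 ∨ δ = 1)
    -- the contrasts and the level
    (H : Matrix (Fin r) (Fin k) ℝ) (hH : ∀ l, ∑ i, H l i = 0) (hH0 : ∀ l, H l ≠ 0)
    (α : ℝ) (hα : α ∈ Set.Ioo (0 : ℝ) 1) :
    ∀ e : MCV.Effect,
      -- asymptotic exactness for the global null hypothesis
      (H *ᵥ MCV.effects e v ν = 0 →
        Tendsto (fun m => P.real {ω |
            MCV.critValue e v δ α H (n m) (fun i j => X i j ω)
              < MCV.maxStat e v δ H (n m) (fun i j => X i j ω)})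
          atTop (𝓝 α)) ∧
      -- asymptotic control of the familywise error over the true local null hypotheses
      limsup (fun m => P.real {ω | ∃ l, H l ⬝ᵥ MCV.effects e v ν = 0 ∧
            MCV.critValue e v δ α H (n m) (fun i j => X i j ω)
              < |MCV.studentized e v δ H (n m) (fun i j => X i j ω) l|}) atTop ≤ α ∧
      -- all false local null hypotheses are rejected with probability tending to one
      Tendsto (fun m => P.real {ω | ∀ l, H l ⬝ᵥ MCV.effects e v ν ≠ 0 →
            MCV.critValue e v δ α H (n m) (fun i j => X i j ω)
              < |MCV.studentized e v δ H (n m) (fun i j => X i j ω) l|})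
          atTop (𝓝 1) ∧
      -- asymptotically valid simultaneous confidence intervals
      Tendsto (fun m => P.real {ω | ∀ l, H l ⬝ᵥ MCV.effects e v ν ∈
            Set.Icc
              (H l ⬝ᵥ MCV.effectsHat e v δ (n m) (fun i j => X i j ω)
                - MCV.contrastSE e v δ H (n m) (fun i j => X i j ω) l
                  * MCV.critValue e v δ α H (n m) (fun i j => X i j ω))
              (H l ⬝ᵥ MCV.effectsHat e v δ (n m) (fun i j => X i j ω)
                + MCV.contrastSE e v δ H (n m) (fun i j => X i j ω) l
                  * MCV.critValue e v δ α H (n m) (fun i j => X i j ω))})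
          atTop (𝓝 (1 - α)) := by
  intro e
  have hS : MCV.IsMultiSample P v ν X n κ :=
    ⟨hwd, htp, hlaw, hind, hn, fun i => (hκ i).1, hnκ⟩
  obtain ⟨hle, hlt⟩ := hS.tendsto_real_norm_centredContrast δ e hr hH0 hα
  refine ⟨fun h0 => ?_, ?_, ?_, ?_⟩
  · refine hlt.congr fun m => ?_
    have hT : ∀ ω, MCV.maxStat e v δ H (n m) (fun i j => X i j ω) =
        ‖MCV.centredContrast e v δ H (MCV.effects e v ν) (n m) (fun i j => X i j ω)‖ := fun ω => by
      rw [MCV.maxStat, ← MCV.iSup_abs_eq_norm hr]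
      exact iSup_congr fun l =>
        congrArg abs (MCV.studentized_eq_centredContrast e v δ _ _ (congrFun h0 l))
    simp only [hT]
  -- A false rejection pushes some coordinate of the centred contrasts, hence their sup norm, above
  -- the critical value. That event has probability tending to `α`.
  · refine (limsup_le_limsup (Eventually.of_forall fun m => ?_)
      (isCoboundedUnder_le_of_le _ (x := 0) fun m => measureReal_nonneg)
      hlt.isBoundedUnder_le).trans_eq hlt.limsup_eq
    refine measureReal_mono ?_
    rintro ω ⟨l, hl, hlt⟩
    rw [MCV.studentized_eq_centredContrast e v δ _ _ hl] at hlt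
    rw [← Real.norm_eq_abs] at hlt
    exact hlt.trans_le (norm_le_pi_norm _ l)
  · obtain ⟨q₀, hq₀, hq⟩ := MCV.exists_maxNormCdf_eq hr
      (MCV.contrastFactor_ne_zero hH0 (hS.limitVar_pos e)) (p := 1 - α)
      ⟨by linarith [hα.2], by linarith [hα.1]⟩
    refine MCV.tendsto_real_one_of_eventually (p := fun q : ℕ × Ω =>
      ∀ l, H l ⬝ᵥ MCV.effects e v ν ≠ 0 → MCV.critValue e v δ α H (n q.1) (fun i j => X i j q.2)
        < |MCV.studentized e v δ H (n q.1) (fun i j => X i j q.2) l|) ?_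
    refine eventually_all.2 fun l => ?_
    by_cases hl : H l ⬝ᵥ MCV.effects e v ν = 0
    · exact Eventually.of_forall fun q h => absurd hl h
    -- With probability tending to one, the critical value is below `q₀ + 1` and the diverging
    -- statistic above it.
    · filter_upwards [(hS.tendsto_critValue δ e hr hH0 hα.2 hq₀ hq).eventually_lt_const
          (lt_add_one q₀), (hS.tendsto_abs_studentized δ e hH0 hl).eventually_gt_atTop (q₀ + 1)]
        with q h1 h2 _
      exact h1.trans h2
  -- Simultaneous coverage is equivalent to the sup-norm bound only if all standard errors are
  -- positive, so the two events are compared up to vanishing probability.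
  · refine MCV.tendsto_real_of_eventually_iff (p := fun q : ℕ × Ω =>
      ‖MCV.centredContrast e v δ H (MCV.effects e v ν) (n q.1) (fun i j => X i j q.2)‖
        ≤ MCV.critValue e v δ α H (n q.1) (fun i j => X i j q.2)) (p' := fun q : ℕ × Ω =>
      ∀ l, H l ⬝ᵥ MCV.effects e v ν ∈ Set.Icc
        (H l ⬝ᵥ MCV.effectsHat e v δ (n q.1) (fun i j => X i j q.2)
          - MCV.contrastSE e v δ H (n q.1) (fun i j => X i j q.2) l
            * MCV.critValue e v δ α H (n q.1) (fun i j => X i j q.2))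
        (H l ⬝ᵥ MCV.effectsHat e v δ (n q.1) (fun i j => X i j q.2)
          + MCV.contrastSE e v δ H (n q.1) (fun i j => X i j q.2) l
            * MCV.critValue e v δ α H (n q.1) (fun i j => X i j q.2))) ?_ hle
    have : Nonempty (Fin r) := ⟨⟨0, hr⟩⟩
    filter_upwards [MCV.eventually_pos_probFilter P hn, eventually_all.2 fun l =>
      (hS.tendsto_contrastVar δ e H l).eventually_const_lt (hS.sqrt_contrastVar_pos e hH0 l)]
      with q hq hs
    rw [pi_norm_le_iff_of_nonempty]
    exact forall_congr' fun l => (MCV.mem_Icc_iff_abs_centredContrast_le e v δ hq (hs l) _).symm
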